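/- **Setting.** Pixels are points of $\mathbb Z^2$; two pixels are 4-adjacent (8-adjacent) if their $\ell^1$ (respectively $\ell^\infty$) distance is $1$. For a finite 4-connected set $T\subset\mathbb Z^2$, let $P_4(T)$ be the set of pixels outside $T$ that are 4-adjacent to a pixel of $T$. Let $G_4(T)$ be the graph on $\mathbb Z^2$ in which the pixels of $P_4(T)$ are black, all others are white, white pixels are joined when 4-adjacent and black pixels when 8-adjacent. Let $E_4(T)$ be the infinite white component of $G_4(T)$, and let $P_4^{ext}(T)$ be the subgraph of $G_4(T)$ induced by the pixels of $P_4(T)$ that are 4-adjacent to a pixel of $E_4(T)$. Drawn with straight edges in $\mathbb R^2$, it is a simple closed polygon; $V_4(T)$ is the open region bounded by this polygon. The *polygonal tile* of $T$ is $\mathscr P_4(T):=V_4(T)\setminus\bigcup_{\tau}V_4(\tau)$, where $\tau$ runs over all connected white subgraphs of $G_4(T)$ contained in $(V_4(T)\cap\mathbb Z^2)\setminus T$. The *diamond spiral* $\mathcal Q_k$ is the set of the first $k$ points of the clockwise spiral $(0,0),(0,1),(1,0),(0,-1),(-1,0),(-1,1),(0,2),(1,1),(2,0),(1,-1),(0,-2),\dots$,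 that is, of the sequence that starts at $(0,0)$ and in which $(x,y)$ is followed by $(x,y+1)$ if $y=0,\ x\le 0$; by $(x+1,y+1)$ if $y\ge1,\ x\le-1$; by $(x+1,y-1)$ if $y\ge 1,\ x\ge 0$; by $(x-1,y-1)$ if $y\le 0,\ x\ge1$; and by $(x-1,y+1)$ if $y\le-1,\ x\le0$. For integers $1\le\ell\le n$ with $n\ge2$, let $\mathcal D_{\ell,n}:=\{x\in\mathbb Z^2:\ -n<x_2-x_1<n,\ -n<x_2+x_1<2\ell-n+1\}$. Put $s_1(n):=n(2n-1)$ and $s_3(n):=n(2n+1)$. An open set $\mathcal F\subset\mathbb R^2$ *tiles the plane with respect to a lattice* $\mathcal L$ if $\bigcup_{y\in\mathcal L}(\overline{\mathcal F}+y)=\mathbb R^2$ and the translates $\mathcal F+y$, $y\in\mathcal L$, are pairwise disjoint. It *tiles the plane* if there is a set of isometries $g$ of the plane such that the sets $g(\overline{\mathcal F})$ cover $\mathbb R^2$ and the sets $g(\mathcal F)$ are pairwise disjoint. The lattice generated by a matrix is the one generated by its columns. **Lemma 7.2.** Let $n\ge 1$ be an integer. 1. If $k=s_1(n)+j$ with $j\in\{1,\dots,n\}$,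 then $\mathscr P_4(\mathcal Q_k)$ is open and tiles the plane with respect to the lattice generated by $\mathcal V_k:=\begin{pmatrix} n& n+j\\ -n-1& n-j\end{pmatrix}$. 2. If $k=s_3(n-1)+j$ with $j\in\{1,\dots,n\}$, then $\mathscr P_4(\mathcal Q_k)$ and $-\mathscr P_4(\mathcal Q_k)+(n,n)$ are disjoint, and their union is open and tiles the plane with respect to the lattice generated by $\mathcal W_k:=\begin{pmatrix} n-1& 2n-1+j\\ -n-1& 2n-1-j\end{pmatrix}$. 3. If $n\ge2$ and $1\le\ell\le n$, then $\mathscr P_4(\mathcal D_{\ell,n})$ is the interior of a convex hexagon, and it does not tile the plane (not even with rotated and reflected copies). -/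

import Mathlib

open Set

noncomputable section

namespace DigitalPlane

/-- The Euclidean plane. -/
abbrev Plane := EuclideanSpace ℝ (Fin 2)

/-- Pixels, i.e. points of the integer lattice. -/
abbrev Pixel := ℤ × ℤ

/-- The inclusion of the integer lattice in the plane. -/
def emb (z : Pixel) : Plane := !₂[(z.1 : ℝ), (z.2 : ℝ)]

/-- The `ℓ¹` metric on pixels; 4-adjacency is `d4 x y = 1`. -/
def d4 (x y : Pixel) : ℤ := |x.1 - y.1| + |x.2 - y.2|

/-- The `ℓ^∞` metric on pixels; 8-adjacency is `d8 x y = 1`. -/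
def d8 (x y : Pixel) : ℤ := max |x.1 - y.1| |x.2 - y.2|

/-- The site perimeter `P₄(T)`: pixels outside `T` that are 4-adjacent to `T`. -/
def sitePerim (T : Set Pixel) : Set Pixel := {z | z ∉ T ∧ ∃ t ∈ T, d4 z t = 1}

/-- The characteristic graph `G₄(T)`: colour the pixels of `P₄(T)` black and all other pixels white;
white pixels are joined when 4-adjacent, black pixels when 8-adjacent. -/
def charGraph (T : Set Pixel) : SimpleGraph Pixel where
  Adj x y := (x ∉ sitePerim T ∧ y ∉ sitePerim T ∧ d4 x y = 1) ∨
    (x ∈ sitePerim T ∧ y ∈ sitePerim T ∧ d8 x y = 1)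
  symm := by
    constructor
    intro x y h
    have h4 : d4 y x = d4 x y := by simp only [d4, abs_sub_comm]
    have h8 : d8 y x = d8 x y := by simp only [d8, abs_sub_comm]
    rw [h4, h8]
    tauto
  loopless := ⟨by intro x h; simp [d4, d8] at h⟩

/-- `E₄(T)`: the infinite white component of `G₄(T)`. -/
def exterior (T : Set Pixel) : Set Pixel :=
  {z | z ∉ sitePerim T ∧ {w | (charGraph T).Reachable z w}.Infinite}

/-- The exterior site perimeter `P₄^ext(T)`. -/
def extPerim (T : Set Pixel) : Set Pixel :=
  {z | z ∈ sitePerim T ∧ ∃ e ∈ exterior T, d4 z e = 1}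

/-- The graph induced by `G₄(T)` on `P₄^ext(T)`, drawn in the plane with straight edges. -/
def extCurve (T : Set Pixel) : Set Plane :=
  {x | ∃ p ∈ extPerim T, ∃ q ∈ extPerim T, (charGraph T).Adj p q ∧ x ∈ segment ℝ (emb p) (emb q)}

/-- `V₄(T)`: the open region bounded by the closed polygon `P₄^ext(T)`, i.e. the points off the
polygon whose connected component in the complement of the polygon is bounded. -/
def enclosed (T : Set Pixel) : Set Plane :=
  {x | x ∉ extCurve T ∧ Bornology.IsBounded (connectedComponentIn (extCurve T)ᶜ x)}

/-- The family `𝓜` of connected white subgraphs of `G₄(T)` contained in `Z₄(T) \ T`, where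
`Z₄(T)` is the set of lattice points of `V₄(T)`. -/
def enclosedWhite (T : Set Pixel) : Set (Set Pixel) :=
  {S | (∀ z ∈ S, emb z ∈ enclosed T ∧ z ∉ T ∧ z ∉ sitePerim T) ∧
    ((charGraph T).induce S).Connected}

/-- The polygonal tile `𝒫₄(T)`. -/
def polygonalTile (T : Set Pixel) : Set Plane :=
  enclosed T \ ⋃ S ∈ enclosedWhite T, enclosed S

/-- One step of the clockwise diamond spiral
`(0,0), (0,1), (1,0), (0,-1), (-1,0), (-1,1), (0,2), (1,1), (2,0), (1,-1), (0,-2), …`. -/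
def spiralStep (p : Pixel) : Pixel :=
  if p.2 = 0 ∧ p.1 ≤ 0 then (p.1, p.2 + 1)
  else if 1 ≤ p.2 ∧ p.1 ≤ -1 then (p.1 + 1, p.2 + 1)
  else if 1 ≤ p.2 then (p.1 + 1, p.2 - 1)
  else if 1 ≤ p.1 then (p.1 - 1, p.2 - 1)
  else (p.1 - 1, p.2 + 1)

/-- The diamond spiral `𝓠ₖ`: the first `k` points of the spiral from the origin. -/
def spiral (k : ℕ) : Set Pixel := {z | ∃ i < k, z = spiralStep^[i] (0, 0)}

/-- Sieben's component `𝓓_{ℓ,n}`. -/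
def sieben (l n : ℕ) : Set Pixel :=
  {x | -(n : ℤ) < x.2 - x.1 ∧ x.2 - x.1 < n ∧
    -(n : ℤ) < x.2 + x.1 ∧ x.2 + x.1 < 2 * (l : ℤ) - n + 1}

/-- `s₁(n) = n(2n-1)`. -/
def s₁ (n : ℕ) : ℕ := n * (2 * n - 1)

/-- `s₃(n) = n(2n+1)`. -/
def s₃ (n : ℕ) : ℕ := n * (2 * n + 1)

/-- The subgroup of the plane generated by the columns of an integer matrix. -/
def columnLattice (M : Matrix (Fin 2) (Fin 2) ℤ) : AddSubgroup Plane :=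
  AddSubgroup.closure (Set.range fun c : Fin 2 => emb (M 0 c, M 1 c))

/-- The open region `F` tiles the plane with respect to `L`: the translates of its closure by `L`
cover the plane, and distinct translates of `F` are disjoint. -/
def TilesByLattice (F : Set Plane) (L : AddSubgroup Plane) : Prop :=
  IsOpen F ∧ (⋃ y ∈ L, (fun x => x + y) '' closure F) = univ ∧
    ∀ y ∈ L, ∀ z ∈ L, y ≠ z → Disjoint ((fun x => x + y) '' F) ((fun x => x + z) '' F)

/-- The open region `F` tiles the plane by congruent copies (rotations, reflections and
translations are all allowed, in any number). -/
def TilesPlane (F : Set Plane) : Prop :=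
  ∃ S : Set (Plane ≃ᵢ Plane), (⋃ g ∈ S, g '' closure F) = univ ∧
    ∀ g ∈ S, ∀ h ∈ S, g ≠ h → Disjoint (g '' F) (h '' F)

/-- `F` is the interior of a convex hexagon: of the convex hull of six points none of which is in
the convex hull of the other five. -/
def IsOpenConvexHexagon (F : Set Plane) : Prop :=
  ∃ v : Fin 6 → Plane, ConvexIndependent ℝ v ∧ F = interior (convexHull ℝ (Set.range v))

/-- The half turn `x ↦ -x + a` of the set `F`. -/
def halfTurn (a : Pixel) (F : Set Plane) : Set Plane := (fun x => -x + emb a) '' F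

end DigitalPlane

end

open DigitalPlane

namespace DigitalPlane

/-! Each tile is identified with an explicit open polygon cut out by linear inequalities in x, y, x
+ y and y - x (`polygonalTile_pix₁`, `polygonalTile_pix₃`, `polygonalTile_sieben`). No Jordan curve
theorem is needed: if R is open and bounded, the drawn curve is closure R minus R, and every point
off closure R escapes along a ray that misses it, then R is the enclosed region (`enclosed_eq`). All
lattice points of R lie in T, so no hole is removed (`polygonalTile_eq`). The pixels of the spiral
are found by induction over its full turns (`spiral_start`).

For the lattice tilings use u = x + y and v = y - x. The lower boundary of the region is one period
of the graph u = L v of a monotone staircase with L (v + H) = L v + c, which the first lattice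
generator preserves. The second generator carries this graph to u = L (v + s) + W, which is the
upper boundary. Successive translates of the staircase cut the plane into strips, and each strip
splits into pieces of width H in v (`tilesByLattice_of_between`). In the second case the tile and
its half turn, separated by the line x + y = n, together fill one such piece.

The hexagon has two adjacent right angles and four angles of 135 degrees. Measured in eighths of a
full turn, by area density in small disks, the tiles around a point contribute 2, 3, 4 or 8 each and
8 in total (`sum_density_eq_eight`). Hence an angle 3 never meets the interior of a side of another
tile (that would leave 1), and three angles 3 never meet. So a side between two obtuse corners
contains a whole side of a neighbour (`exists_side_in_side`). On each of the two unit sides the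
neighbour must match that side exactly, with obtuse corners at both ends. Between these lies the
side of length √2 (n - 1), both of whose ends now carry two obtuse angles already. The neighbour's
side contained in it must therefore join two right angles, but the only such side has length √2 n: a
contradiction. -/

/-! ### Pixels, adjacency and the exterior perimeter. -/

theorem emb_apply_zero (z : Pixel) : emb z 0 = z.1 := by simp [emb]

theorem emb_apply_one (z : Pixel) : emb z 1 = z.2 := by simp [emb]

theorem plane_ext {x y : Plane} (h0 : x 0 = y 0) (h1 : x 1 = y 1) : x = y := by
  ext i; fin_cases i
  · exact h0
  · exact h1

theorem d4_eq_one_iff (x y : Pixel) : d4 x y = 1 ↔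
    (x.1 = y.1 + 1 ∧ x.2 = y.2) ∨ (x.1 = y.1 - 1 ∧ x.2 = y.2) ∨
    (x.1 = y.1 ∧ x.2 = y.2 + 1) ∨ (x.1 = y.1 ∧ x.2 = y.2 - 1) := by
  unfold d4
  rcases abs_cases (x.1 - y.1) with h | h <;> rcases abs_cases (x.2 - y.2) with h' | h' <;> omega

theorem d8_eq_one_iff (x y : Pixel) : d8 x y = 1 ↔
    x ≠ y ∧ -1 ≤ y.1 - x.1 ∧ y.1 - x.1 ≤ 1 ∧ -1 ≤ y.2 - x.2 ∧ y.2 - x.2 ≤ 1 := by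
  unfold d8
  rw [Ne, Prod.ext_iff]
  rcases abs_cases (x.1 - y.1) with h | h <;> rcases abs_cases (x.2 - y.2) with h' | h' <;>
    rcases max_cases |x.1 - y.1| |x.2 - y.2| with h'' | h'' <;> omega

theorem mem_sitePerim_iff (T : Set Pixel) (a b : ℤ) : (a, b) ∈ sitePerim T ↔
    (a, b) ∉ T ∧ ((a + 1, b) ∈ T ∨ (a - 1, b) ∈ T ∨ (a, b + 1) ∈ T ∨ (a, b - 1) ∈ T) := by
  constructor
  · rintro ⟨h, ⟨c, d⟩, ht, hd⟩
    refine ⟨h, ?_⟩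
    rw [d4_eq_one_iff] at hd
    rcases hd with ⟨h1, h2⟩ | ⟨h1, h2⟩ | ⟨h1, h2⟩ | ⟨h1, h2⟩ <;> simp only at h1 h2 <;> subst h1 h2
    · right; left; simpa using ht
    · left; simpa using ht
    · right; right; right; simpa using ht
    · right; right; left; simpa using ht
  · rintro ⟨h, ht⟩
    refine ⟨h, ?_⟩
    rcases ht with h | h | h | h
    all_goals
      refine ⟨_, h, ?_⟩
      rw [d4_eq_one_iff]
      simp

/-- A pixel from which a straight white ray starts belongs to the exterior. -/
theorem mem_exterior_of_ray {T : Set Pixel} {z d : Pixel} (hd : d4 d 0 = 1)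
    (h : ∀ k : ℕ, (z.1 + k * d.1, z.2 + k * d.2) ∉ sitePerim T) : z ∈ exterior T := by
  have hz : ((z.1 + (0 : ℕ) * d.1, z.2 + (0 : ℕ) * d.2) : Pixel) = z := by simp
  have hreach : ∀ k : ℕ, (charGraph T).Reachable z (z.1 + k * d.1, z.2 + k * d.2) := by
    intro k
    induction k with
    | zero => rw [hz]
    | succ k ih =>
      refine ih.trans (SimpleGraph.Adj.reachable (Or.inl ⟨h k, h (k + 1), ?_⟩))
      rw [d4_eq_one_iff] at hd ⊢
      push_cast
      simp only [Prod.fst_zero, Prod.snd_zero] at hd ⊢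
      rcases hd with ⟨h1, h2⟩ | ⟨h1, h2⟩ | ⟨h1, h2⟩ | ⟨h1, h2⟩ <;> rw [h1, h2] <;> omega
  refine ⟨hz ▸ h 0, ?_⟩
  refine Set.infinite_of_injective_forall_mem (f := fun k : ℕ => ((z.1 + k * d.1, z.2 + k * d.2) : Pixel)) ?_ hreach
  intro a b hab
  simp only [Prod.mk.injEq] at hab
  rw [d4_eq_one_iff] at hd
  simp only [Prod.fst_zero, Prod.snd_zero] at hd
  rcases hd with ⟨h1, h2⟩ | ⟨h1, h2⟩ | ⟨h1, h2⟩ | ⟨h1, h2⟩ <;> rw [h1, h2] at hab <;> omega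

/-- If every black pixel starts a straight ray whose other pixels are white, then every black pixel
lies on the exterior perimeter. -/
theorem extPerim_eq_sitePerim {T : Set Pixel}
    (h : ∀ z ∈ sitePerim T, ∃ d : Pixel, d4 d 0 = 1 ∧
      ∀ k : ℤ, 0 < k → (z.1 + k * d.1, z.2 + k * d.2) ∉ sitePerim T) :
    extPerim T = sitePerim T := by
  refine Subset.antisymm (fun z hz => hz.1) fun z hz => ⟨hz, ?_⟩
  obtain ⟨d, hd, hray⟩ := h z hz
  refine ⟨(z.1 + d.1, z.2 + d.2), mem_exterior_of_ray hd fun k => ?_, ?_⟩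
  · have := hray (k + 1) (by omega)
    convert this using 2
    refine Prod.ext ?_ ?_ <;> simp <;> ring
  · rw [d4_eq_one_iff] at hd ⊢
    simp only [Prod.fst_zero, Prod.snd_zero] at hd ⊢
    omega

/-! ### Recognising the enclosed region and the drawn curve. -/

/-- Off the curve the plane is the disjoint union of the open sets R and the complement of closure
R. A component meeting R stays in the bounded set R; a component outside contains an unbounded ray.
-/
theorem enclosed_eq {T : Set Pixel} {R : Set Plane} (hR : IsOpen R) (hb : Bornology.IsBounded R)
    (hcurve : extCurve T = closure R \ R)
    (hout : ∀ x ∉ closure R, ∃ d : Plane, d ≠ 0 ∧ ∀ t : ℝ, 0 ≤ t → x + t • d ∉ closure R) :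
    enclosed T = R := by
  have hcompl : (extCurve T)ᶜ = R ∪ (closure R)ᶜ := by
    rw [hcurve]; ext x
    simp only [mem_compl_iff, mem_sdiff, mem_union]; tauto
  ext x
  constructor
  · rintro ⟨hx, hbd⟩
    by_contra hxR
    have hxc : x ∉ closure R := fun hc => hx (hcurve ▸ ⟨hc, hxR⟩)
    obtain ⟨d, hd, hray⟩ := hout x hxc
    have hsub : (fun t : ℝ => x + t • d) '' Ici 0 ⊆ connectedComponentIn (extCurve T)ᶜ x := by
      refine IsPreconnected.subset_connectedComponentIn ?_ ⟨0, by simp, by simp⟩ ?_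
      · exact isPreconnected_Ici.image _ (by fun_prop)
      · rintro _ ⟨t, ht, rfl⟩
        rw [hcompl]
        exact Or.inr (hray t ht)
    have hb2 := hbd.subset hsub
    obtain ⟨C, hC⟩ := hb2.exists_norm_le
    have hdpos : 0 < ‖d‖ := norm_pos_iff.2 hd
    have h0 : 0 ≤ C := (norm_nonneg _).trans (hC _ ⟨0, by simp, rfl⟩)
    -- At this parameter the ray has moved by C + ‖x‖ + 1, so it has left the ball of radius C.
    have ht : 0 ≤ (C + ‖x‖ + 1) / ‖d‖ := by positivity
    have h1 := hC _ ⟨(C + ‖x‖ + 1) / ‖d‖, ht, rfl⟩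
    have h2 : ‖((C + ‖x‖ + 1) / ‖d‖) • d‖ = C + ‖x‖ + 1 := by
      rw [norm_smul, Real.norm_of_nonneg ht]; field_simp
    have h3 : ‖((C + ‖x‖ + 1) / ‖d‖) • d‖ ≤ ‖x + ((C + ‖x‖ + 1) / ‖d‖) • d‖ + ‖x‖ := by
      have := norm_sub_le (x + ((C + ‖x‖ + 1) / ‖d‖) • d) x
      simpa using this
    simp only at h1
    linarith
  · intro hx
    refine ⟨fun h => (hcurve ▸ h).2 hx, hb.subset ?_⟩
    have hpre := isPreconnected_connectedComponentIn (F := (extCurve T)ᶜ) (x := x)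
    refine hpre.subset_left_of_subset_union hR (isClosed_closure (s := R)).isOpen_compl ?_ ?_ ?_
    · exact disjoint_compl_right.mono_left subset_closure
    · rw [← hcompl]; exact connectedComponentIn_subset _ _
    · exact ⟨x, mem_connectedComponentIn (by rw [hcompl]; exact Or.inl hx), hx⟩

/-- By `hpix`, no white pixel outside T lies in R, so the family of enclosed white subgraphs is
empty. Connectedness is used only for nonemptiness. -/
theorem polygonalTile_eq {T : Set Pixel} {R : Set Plane} (hR : IsOpen R)
    (hb : Bornology.IsBounded R) (hcurve : extCurve T = closure R \ R)
    (hout : ∀ x ∉ closure R, ∃ d : Plane, d ≠ 0 ∧ ∀ t : ℝ, 0 ≤ t → x + t • d ∉ closure R)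
    (hpix : ∀ z, emb z ∈ R → z ∈ T) : polygonalTile T = R := by
  have he := enclosed_eq hR hb hcurve hout
  have hempty : enclosedWhite T = ∅ := by
    refine eq_empty_of_forall_notMem fun S hS => ?_
    obtain ⟨h1, h2⟩ := hS
    obtain ⟨z⟩ := h2.nonempty
    obtain ⟨hz, hz', -⟩ := h1 z z.2
    rw [he] at hz
    exact hz' (hpix _ hz)
  rw [polygonalTile, he, hempty]
  simp

/-- A straight run of black pixels draws the whole segment from its first to its last pixel. -/
theorem mem_extCurve_of_run {T : Set Pixel} (hT : extPerim T = sitePerim T) {a b : ℤ} (c d m : ℤ)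
    (hcd : d8 (c, d) 0 = 1) (hm : 1 ≤ m)
    (hrun : ∀ i : ℤ, 0 ≤ i → i ≤ m → (a + i * c, b + i * d) ∈ sitePerim T) {x : Plane} (s : ℝ)
    (hs : 0 ≤ s) (hsm : s ≤ m) (h0 : x 0 = a + s * c) (h1 : x 1 = b + s * d) :
    x ∈ extCurve T := by
  -- The minimum matters at s = m, where the floor would select the last pixel, which has no
  -- successor in the run.
  set i : ℤ := min ⌊s⌋ (m - 1) with hi
  have hfl : (0 : ℤ) ≤ ⌊s⌋ := Int.floor_nonneg.2 hs
  have hi0 : 0 ≤ i := by omega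
  have him : i + 1 ≤ m := by omega
  have his : (i : ℝ) ≤ s := (Int.cast_le.2 (min_le_left _ _)).trans (Int.floor_le s)
  have his' : s ≤ i + 1 := by
    rcases min_cases ⌊s⌋ (m - 1) with h | h
    · rw [hi, h.1]; exact (Int.lt_floor_add_one s).le
    · rw [hi, h.1]; push_cast; linarith
  have hp := hrun i hi0 (by omega)
  have hq := hrun (i + 1) (by omega) him
  refine ⟨_, hT ▸ hp, _, hT ▸ hq, Or.inr ⟨hp, hq, ?_⟩, ?_⟩
  · rw [d8_eq_one_iff] at hcd ⊢
    have e1 : (i + 1) * c = i * c + c := by ring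
    have e2 : (i + 1) * d = i * d + d := by ring
    rw [Ne, Prod.ext_iff] at hcd ⊢
    simp only [e1, e2, Prod.fst_zero, Prod.snd_zero] at hcd ⊢
    omega
  · rw [segment_eq_image']
    refine ⟨s - i, ⟨by linarith, by linarith⟩, plane_ext ?_ ?_⟩
    · simp only [PiLp.add_apply, PiLp.smul_apply, PiLp.sub_apply, emb_apply_zero, smul_eq_mul, h0]
      push_cast; ring
    · simp only [PiLp.add_apply, PiLp.smul_apply, PiLp.sub_apply, emb_apply_one, smul_eq_mul, h1]
      push_cast; ring

/-- The drawn curve lies in `C` as soon as each segment between 8-adjacent black pixels does. -/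
theorem extCurve_subset {T : Set Pixel} {C : Set Plane} (hT : extPerim T = sitePerim T)
    (h : ∀ a b c d : ℤ, (a, b) ∈ sitePerim T → (a + c, b + d) ∈ sitePerim T → -1 ≤ c → c ≤ 1 →
      -1 ≤ d → d ≤ 1 → (c ≠ 0 ∨ d ≠ 0) → ∀ (t : ℝ) (x : Plane), 0 ≤ t → t ≤ 1 →
      x 0 = a + t * c → x 1 = b + t * d → x ∈ C) :
    extCurve T ⊆ C := by
  rintro x ⟨⟨a, b⟩, hp, ⟨a', b'⟩, hq, hadj, hx⟩
  rw [hT] at hp hq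
  have h8 : d8 (a, b) (a', b') = 1 := by
    rcases hadj with h | h
    · exact absurd hp h.1
    · exact h.2.2
  rw [d8_eq_one_iff, Ne, Prod.ext_iff] at h8
  simp only at h8
  rw [segment_eq_image'] at hx
  obtain ⟨t, ⟨ht0, ht1⟩, rfl⟩ := hx
  refine h a b (a' - a) (b' - b) hp (by simpa using hq) (by omega) (by omega) (by omega) (by omega)
    (by omega) t _ ht0 ht1 ?_ ?_
  · simp only [PiLp.add_apply, PiLp.smul_apply, PiLp.sub_apply, emb_apply_zero, smul_eq_mul]
    push_cast; ring
  · simp only [PiLp.add_apply, PiLp.smul_apply, PiLp.sub_apply, emb_apply_one, smul_eq_mul]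
    push_cast; ring

/-! ### The diamond spiral, turn by turn. -/

theorem spiral_succ {k : ℕ} {p : Pixel} (hp : spiralStep^[k] (0, 0) = p) :
    spiral (k + 1) = spiral k ∪ {p} := by
  ext z
  simp only [spiral, mem_ofPred_eq, mem_union, mem_singleton_iff]
  constructor
  · rintro ⟨i, hi, rfl⟩
    rcases Nat.lt_succ_iff_lt_or_eq.1 hi with h | rfl
    · exact Or.inl ⟨i, h, rfl⟩
    · exact Or.inr hp
  · rintro (⟨i, hi, rfl⟩ | rfl)
    · exact ⟨i, by omega, rfl⟩
    · exact ⟨k, by omega, hp.symm⟩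

/-- If the spiral passes through `q i` at time `k + i` for `i ≤ m`, and adding these points leads
from `A i` to `A (i + 1)`, then the initial pieces of the spiral are the `A i`. -/
theorem spiral_run {k m : ℕ} (q : ℕ → Pixel) (A : ℕ → Set Pixel)
    (hq : spiralStep^[k] (0, 0) = q 0) (hA : spiral k = A 0)
    (hstep : ∀ i < m, spiralStep (q i) = q (i + 1))
    (hadd : ∀ i < m, A (i + 1) = A i ∪ {q i}) :
    ∀ i ≤ m, spiralStep^[k + i] (0, 0) = q i ∧ spiral (k + i) = A i := by
  intro i
  induction i with
  | zero => exact fun _ => ⟨hq, hA⟩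
  | succ i ih =>
    intro hi
    obtain ⟨h1, h2⟩ := ih (by omega)
    refine ⟨?_, ?_⟩
    · rw [← add_assoc, Function.iterate_succ_apply', h1, hstep i (by omega)]
    · rw [← add_assoc, spiral_succ h1, h2, hadd i (by omega)]

/-- The pixels of the spiral `𝓠ₖ` for `k = s₁(n) + j`. -/
def pix₁ (n j : ℤ) : Set Pixel :=
  {z | -n < z.1 + z.2 ∧ -n < z.2 - z.1 ∧ z.2 - z.1 < n + 1 ∧
    (z.1 + z.2 < n ∨ (z.1 + z.2 < n + 1 ∧ z.1 < j))}

/-- The pixels of the spiral `𝓠ₖ` for `k = s₁(n) + n + j`. -/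
def pix₂ (n j : ℤ) : Set Pixel :=
  {z | -n < z.1 + z.2 ∧ z.1 + z.2 < n + 1 ∧ z.2 - z.1 < n + 1 ∧
    (-n < z.2 - z.1 ∨ (-n - 1 < z.2 - z.1 ∧ n - j < z.1))}

/-- The pixels of the spiral `𝓠ₖ` for `k = s₃(n) + j`. -/
def pix₃ (n j : ℤ) : Set Pixel :=
  {z | z.1 + z.2 < n + 1 ∧ -n - 1 < z.2 - z.1 ∧ z.2 - z.1 < n + 1 ∧
    (-n < z.1 + z.2 ∨ (-n - 1 < z.1 + z.2 ∧ -j < z.1))}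

/-- The pixels of the spiral `𝓠ₖ` for `k = s₃(n) + n + 1 + j`. -/
def pix₄ (n j : ℤ) : Set Pixel :=
  {z | -n - 1 < z.1 + z.2 ∧ z.1 + z.2 < n + 1 ∧ -n - 1 < z.2 - z.1 ∧
    (z.2 - z.1 < n + 1 ∨ (z.2 - z.1 < n + 2 ∧ z.1 < -n + j))}

theorem spiralStep_mk (a b : ℤ) : spiralStep (a, b) =
    if b = 0 ∧ a ≤ 0 then (a, b + 1) else if 1 ≤ b ∧ a ≤ -1 then (a + 1, b + 1)
    else if 1 ≤ b then (a + 1, b - 1) else if 1 ≤ a then (a - 1, b - 1) else (a - 1, b + 1) := rfl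

/-- The four phases of a turn traverse the upper right, lower right, lower left and upper left sides
in this order; each adds one diagonal row of pixels. -/
theorem spiral_phase₁ {k n : ℕ} (hq : spiralStep^[k] (0, 0) = (0, (n : ℤ)))
    (hA : spiral k = pix₁ n 0) : ∀ i ≤ n, spiralStep^[k + i] (0, 0) = ((i : ℤ), (n : ℤ) - i) ∧
      spiral (k + i) = pix₁ n i := by
  refine spiral_run (fun i => ((i : ℤ), (n : ℤ) - i)) (fun i => pix₁ n i) (by simpa using hq)
    (by simpa using hA) ?_ ?_
  · intro i hi
    simp only [spiralStep_mk]
    split_ifs <;> (ext <;> simp <;> omega)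
  · rintro i hi
    ext ⟨a, b⟩
    simp only [pix₁, mem_ofPred_eq, mem_union, mem_singleton_iff, Prod.mk.injEq]
    push_cast
    omega

theorem spiral_phase₂ {k n : ℕ} (hq : spiralStep^[k] (0, 0) = ((n : ℤ), 0))
    (hA : spiral k = pix₁ n n) : ∀ i ≤ n, spiralStep^[k + i] (0, 0) = ((n : ℤ) - i, -(i : ℤ)) ∧
      spiral (k + i) = pix₂ n i := by
  refine spiral_run (fun i => ((n : ℤ) - i, -(i : ℤ))) (fun i => pix₂ n i) (by simpa using hq)
    ?_ ?_ ?_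
  · rw [hA]
    ext ⟨a, b⟩
    simp only [pix₁, pix₂, mem_ofPred_eq]
    push_cast
    omega
  · intro i hi
    simp only [spiralStep_mk]
    split_ifs <;> (ext <;> simp <;> omega)
  · rintro i hi
    ext ⟨a, b⟩
    simp only [pix₂, mem_ofPred_eq, mem_union, mem_singleton_iff, Prod.mk.injEq]
    push_cast
    omega

/-- This row has n + 1 pixels, ending at (-n, 0). From there the spiral steps straight up instead of
diagonally, so the formula for the position stops at i = n while the one for the pixel set reaches i
= n + 1. -/
theorem spiral_phase₃ {k n : ℕ} (hq : spiralStep^[k] (0, 0) = (0, -(n : ℤ)))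
    (hA : spiral k = pix₃ n 0) :
    (∀ i ≤ n, spiralStep^[k + i] (0, 0) = (-(i : ℤ), -(n : ℤ) + i)) ∧
      ∀ i ≤ n + 1, spiral (k + i) = pix₃ n i := by
  have hadd : ∀ i < n + 1, pix₃ n (i + 1 : ℕ) = pix₃ n i ∪ {(-(i : ℤ), -(n : ℤ) + i)} := by
    rintro i hi
    ext ⟨a, b⟩
    simp only [pix₃, mem_ofPred_eq, mem_union, mem_singleton_iff, Prod.mk.injEq]
    push_cast
    omega
  have key := spiral_run (k := k) (m := n) (fun i => (-(i : ℤ), -(n : ℤ) + i)) (fun i => pix₃ n i)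
    (by simpa using hq) (by simpa using hA)
    (by
      intro i hi
      simp only [spiralStep_mk]
      split_ifs <;> (ext <;> simp <;> omega))
    (fun i hi => hadd i (by omega))
  refine ⟨fun i hi => (key i hi).1, fun i hi => ?_⟩
  rcases hi.lt_or_eq with h | rfl
  · exact (key i (by omega)).2
  · rw [← add_assoc, spiral_succ (key n le_rfl).1, (key n le_rfl).2, hadd n (by omega)]

theorem spiral_phase₄ {k n : ℕ} (hq : spiralStep^[k] (0, 0) = (-(n : ℤ), 1))
    (hA : spiral k = pix₃ n (n + 1)) :
    ∀ i ≤ n, spiralStep^[k + i] (0, 0) = (-(n : ℤ) + i, 1 + (i : ℤ)) ∧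
      spiral (k + i) = pix₄ n i := by
  refine spiral_run (fun i => (-(n : ℤ) + i, 1 + (i : ℤ))) (fun i => pix₄ n i) (by simpa using hq)
    ?_ ?_ ?_
  · rw [hA]
    ext ⟨a, b⟩
    simp only [pix₃, pix₄, mem_ofPred_eq]
    push_cast
    omega
  · intro i hi
    simp only [spiralStep_mk]
    split_ifs <;> (ext <;> simp <;> omega)
  · rintro i hi
    ext ⟨a, b⟩
    simp only [pix₄, mem_ofPred_eq, mem_union, mem_singleton_iff, Prod.mk.injEq]
    push_cast
    omega

theorem s₃_eq (n : ℕ) (hn : 1 ≤ n) : s₃ n = s₁ n + n + n := by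
  obtain ⟨m, rfl⟩ : ∃ m, n = m + 1 := ⟨n - 1, by omega⟩
  have : 2 * (m + 1) - 1 = 2 * m + 1 := by omega
  simp only [s₁, s₃, this]; ring

theorem s₁_succ (n : ℕ) : s₁ (n + 1) = s₃ n + n + 1 + n := by
  have : 2 * (n + 1) - 1 = 2 * n + 1 := by omega
  simp only [s₁, s₃, this]; ring

/-- The induction goes from one full turn to the next. `hturn` covers phases 3 and 4, from time `s₃
n` to `s₁ (n + 1)`; phases 1 and 2 lead on to `s₃ (n + 1)`. The base case is the empty spiral at
time `s₃ 0 = 0`. -/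
theorem spiral_start (n : ℕ) :
    spiralStep^[s₁ (n + 1)] (0, 0) = (0, ((n + 1 : ℕ) : ℤ)) ∧
      spiral (s₁ (n + 1)) = pix₁ (n + 1 : ℕ) 0 ∧
      ∀ i ≤ n + 1, spiral (s₃ n + i) = pix₃ n i := by
  have hturn : ∀ n : ℕ, spiralStep^[s₃ n] (0, 0) = (0, -(n : ℤ)) → spiral (s₃ n) = pix₃ n 0 →
      spiralStep^[s₁ (n + 1)] (0, 0) = (0, ((n + 1 : ℕ) : ℤ)) ∧
      spiral (s₁ (n + 1)) = pix₁ (n + 1 : ℕ) 0 ∧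
      ∀ i ≤ n + 1, spiral (s₃ n + i) = pix₃ n i := by
    intro n h1 h2
    have h3 := spiral_phase₃ h1 h2
    have h4 := spiral_phase₄ (k := s₃ n + n + 1) (n := n)
      (by rw [Function.iterate_succ_apply', h3.1 n le_rfl, spiralStep_mk]
          split_ifs <;> simp <;> omega)
      (by rw [add_assoc, h3.2 _ le_rfl]; simp) n le_rfl
    refine ⟨?_, ?_, h3.2⟩
    · rw [s₁_succ, h4.1]; simp [add_comm]
    · rw [s₁_succ, h4.2]
      ext ⟨a, b⟩
      simp only [pix₁, pix₄, mem_ofPred_eq]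
      push_cast
      omega
  induction n with
  | zero =>
    refine hturn 0 rfl ?_
    ext ⟨a, b⟩
    simp only [pix₃, spiral, s₃, mem_ofPred_eq]
    simp
    omega
  | succ n ih =>
    obtain ⟨h1, h2, -⟩ := ih
    have p1 := spiral_phase₁ h1 h2 _ le_rfl
    have p2 := spiral_phase₂ (k := s₁ (n + 1) + (n + 1)) (n := n + 1)
      (by rw [p1.1]; simp) p1.2 _ le_rfl
    refine hturn (n + 1) ?_ ?_
    · rw [s₃_eq _ (by omega), p2.1]; simp
    · rw [s₃_eq _ (by omega), p2.2]
      ext ⟨a, b⟩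
      simp only [pix₂, pix₃, mem_ofPred_eq]
      push_cast
      omega

theorem spiral_s₁_add {n j : ℕ} (hn : 1 ≤ n) (hj : j ≤ n) : spiral (s₁ n + j) = pix₁ n j := by
  obtain ⟨m, rfl⟩ : ∃ m, n = m + 1 := ⟨n - 1, by omega⟩
  exact (spiral_phase₁ (spiral_start m).1 (spiral_start m).2.1 j hj).2

theorem spiral_s₃_add {n j : ℕ} (hj : j ≤ n + 1) : spiral (s₃ n + j) = pix₃ n j :=
  (spiral_start n).2.2 j hj

/-! ### Interpolation estimates and closures of polygonal regions. -/

theorem add_mul_sub_lt {a b c t : ℝ} (ha : a ≤ c) (hb : b < c) (ht : 0 < t) (ht1 : t ≤ 1) :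
    a + t * (b - a) < c := by
  nlinarith [mul_pos ht (sub_pos.2 hb), mul_nonneg (sub_nonneg.2 ht1) (sub_nonneg.2 ha)]

theorem le_add_mul {a c d t : ℝ} (h0 : c ≤ a) (h1 : c ≤ a + d) (ht : 0 ≤ t) (ht1 : t ≤ 1) :
    c ≤ a + t * d := by
  nlinarith [mul_nonneg ht (sub_nonneg.2 h1), mul_nonneg (sub_nonneg.2 ht1) (sub_nonneg.2 h0)]

theorem add_mul_le {a c d t : ℝ} (h0 : a ≤ c) (h1 : a + d ≤ c) (ht : 0 ≤ t) (ht1 : t ≤ 1) :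
    a + t * d ≤ c := by
  nlinarith [mul_nonneg ht (sub_nonneg.2 h1), mul_nonneg (sub_nonneg.2 ht1) (sub_nonneg.2 h0)]

theorem isOpen_or {p q : Plane → Prop} (hp : IsOpen {x | p x}) (hq : IsOpen {x | q x}) :
    IsOpen {x | p x ∨ q x} := hp.union hq

theorem isClosed_or {p q : Plane → Prop} (hp : IsClosed {x | p x}) (hq : IsClosed {x | q x}) :
    IsClosed {x | p x ∨ q x} := hp.union hq

/-- Every point of K is a limit of points of R along a segment towards x₀. This needs no convexity,
so it also applies to the notched tiles. -/
theorem closure_eq_of_star {R K : Set Plane} (hK : IsClosed K) (hRK : R ⊆ K)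
    (h : ∀ x ∈ K, ∃ x₀ : Plane, ∀ t : ℝ, 0 < t → t ≤ 1 → x + t • (x₀ - x) ∈ R) :
    closure R = K := by
  refine Subset.antisymm (closure_minimal hRK hK) fun x hx => ?_
  obtain ⟨x₀, h⟩ := h x hx
  have hc : Filter.Tendsto (fun t : ℝ => x + t • (x₀ - x)) (nhdsWithin 0 (Ioi 0)) (nhds x) := by
    have : Continuous fun t : ℝ => x + t • (x₀ - x) := by fun_prop
    have h0 := this.tendsto 0
    simp only [zero_smul, add_zero] at h0
    exact h0.mono_left nhdsWithin_le_nhds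
  refine mem_closure_of_tendsto hc ?_
  filter_upwards [Ioc_mem_nhdsGT (zero_lt_one' ℝ)] with t ht
  exact h t ht.1 ht.2

theorem isBounded_of_coord {R : Set Plane} (C : ℝ) (h : ∀ p ∈ R, |p 0| ≤ C ∧ |p 1| ≤ C) :
    Bornology.IsBounded R := by
  refine isBounded_iff_forall_norm_le.2 ⟨2 * C, fun p hp => ?_⟩
  obtain ⟨h0, h1⟩ := h p hp
  have hC : 0 ≤ C := (abs_nonneg _).trans h0
  rw [EuclideanSpace.norm_eq, Real.sqrt_le_iff]
  refine ⟨by positivity, ?_⟩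
  simp only [Fin.sum_univ_two, Real.norm_eq_abs]
  nlinarith [abs_nonneg (p 0), abs_nonneg (p 1)]

theorem combo_apply (x y : Plane) (t : ℝ) (i : Fin 2) :
    (x + t • (y - x)) i = x i + t * (y i - x i) := by
  simp

theorem ray_apply (x y : Plane) (t : ℝ) (i : Fin 2) : (x + t • y) i = x i + t * y i := by
  simp

theorem vec_ne_zero {a b : ℝ} (h : a ≠ 0 ∨ b ≠ 0) : (!₂[a, b] : Plane) ≠ 0 := by
  intro h0
  have e0 := congrFun (congrArg WithLp.ofLp h0) 0
  have e1 := congrFun (congrArg WithLp.ofLp h0) 1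
  simp at e0 e1
  tauto

/-! ### The tile of the spiral for k = s₁(n) + j. -/

/-- The polygonal tile of the spiral `𝓠ₖ` for `k = s₁(n) + j`. -/
def reg₁ (n j : ℤ) : Set Plane :=
  {p | -(n : ℝ) < p 0 + p 1 ∧ -(n : ℝ) < p 1 - p 0 ∧ p 1 - p 0 < n + 1 ∧ -(n : ℝ) < p 0 ∧
    (p 0 + p 1 < n ∨ (p 0 + p 1 < n + 1 ∧ p 0 < j))}

theorem isOpen_reg₁ (n j : ℤ) : IsOpen (reg₁ n j) := by
  refine IsOpen.and ?_ (IsOpen.and ?_ (IsOpen.and ?_ (IsOpen.and ?_ (isOpen_or ?_ (IsOpen.and ?_ ?_)))))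
  all_goals exact isOpen_lt (by fun_prop) (by fun_prop)

theorem closure_reg₁ {n j : ℤ} (hj : 1 ≤ j) (hjn : j ≤ n) : closure (reg₁ n j) =
    {p | -(n : ℝ) ≤ p 0 + p 1 ∧ -(n : ℝ) ≤ p 1 - p 0 ∧ p 1 - p 0 ≤ (n : ℝ) + 1 ∧ -(n : ℝ) ≤ p 0 ∧
      (p 0 + p 1 ≤ (n : ℝ) ∨ (p 0 + p 1 ≤ (n : ℝ) + 1 ∧ p 0 ≤ (j : ℝ)))} := by
  have hj' : (1 : ℝ) ≤ j := by exact_mod_cast hj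
  have hjn' : (j : ℝ) ≤ n := by exact_mod_cast hjn
  refine closure_eq_of_star ?_ ?_ ?_
  · refine IsClosed.and ?_ (IsClosed.and ?_ (IsClosed.and ?_ (IsClosed.and ?_
      (isClosed_or ?_ (IsClosed.and ?_ ?_)))))
    all_goals exact isClosed_le (by fun_prop) (by fun_prop)
  · rintro p ⟨h1, h2, h3, h4, h5⟩
    exact ⟨h1.le, h2.le, h3.le, h4.le, h5.imp le_of_lt (fun h => ⟨h.1.le, h.2.le⟩)⟩
  · rintro p ⟨h1, h2, h3, h4, h5⟩
    refine ⟨0, fun t ht ht1 => ?_⟩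
    simp only [reg₁, mem_ofPred_eq, combo_apply, PiLp.zero_apply]
    have f : ∀ a c : ℝ, a ≤ c → 0 < c → a + t * (0 - a) < c :=
      fun a c ha hc => add_mul_sub_lt ha hc ht ht1
    have g1 := f (-(p 0 + p 1)) n (by linarith) (by linarith)
    have g2 := f (-(p 1 - p 0)) n (by linarith) (by linarith)
    have g3 := f (p 1 - p 0) (n + 1) (by linarith) (by linarith)
    have g4 := f (-p 0) n (by linarith) (by linarith)
    refine ⟨by linarith, by linarith, by linarith, by linarith, ?_⟩
    rcases h5 with h5 | ⟨h5, h6⟩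
    · have g5 := f (p 0 + p 1) n (by linarith) (by linarith)
      left; linarith
    · have g5 := f (p 0 + p 1) (n + 1) (by linarith) (by linarith)
      have g6 := f (p 0) j (by linarith) (by linarith)
      right; constructor <;> linarith

theorem mem_sitePerim_pix₁ {n j : ℤ} (hj : 1 ≤ j) (hjn : j ≤ n) (a b : ℤ) :
    (a, b) ∈ sitePerim (pix₁ n j) ↔
      -n ≤ a + b ∧ -n ≤ b - a ∧ b - a ≤ n + 1 ∧ -n ≤ a ∧ (a + b ≤ n ∨ (a + b ≤ n + 1 ∧ a ≤ j)) ∧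
      (a + b = -n ∨ b - a = -n ∨ b - a = n + 1 ∨ (n ≤ a + b ∧ (a + b = n + 1 ∨ j ≤ a))) := by
  rw [mem_sitePerim_iff]
  simp only [pix₁, mem_ofPred_eq]
  omega

theorem extPerim_pix₁ {n j : ℤ} (hj : 1 ≤ j) (hjn : j ≤ n) :
    extPerim (pix₁ n j) = sitePerim (pix₁ n j) := by
  refine extPerim_eq_sitePerim ?_
  rintro ⟨a, b⟩ hz
  simp only [mem_sitePerim_pix₁ hj hjn] at hz ⊢
  have : a + b = -n ∨ b - a = -n ∨ b - a = n + 1 ∨ (n ≤ a + b ∧ (a + b = n + 1 ∨ j ≤ a)) := hz.2.2.2.2.2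
  rcases this with h | h | h | h
  · exact ⟨(-1, 0), by simp [d4], fun k hk => by omega⟩
  · exact ⟨(0, -1), by simp [d4], fun k hk => by omega⟩
  · exact ⟨(0, 1), by simp [d4], fun k hk => by omega⟩
  · exact ⟨(1, 0), by simp [d4], fun k hk => by omega⟩

set_option maxHeartbeats 1000000 in
-- Each alternative is a closed convex condition incompatible with `reg₁`. When both ends of an edge
-- satisfy the same one, so does the whole segment, which therefore misses the open tile.
theorem pix₁_edge {n j a b c d : ℤ} (hj : 1 ≤ j) (hjn : j ≤ n) (hc : -1 ≤ c) (hc1 : c ≤ 1)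
    (hd : -1 ≤ d) (hd1 : d ≤ 1) (hcd : c ≠ 0 ∨ d ≠ 0)
    (hp : (a, b) ∈ sitePerim (pix₁ n j)) (hq : (a + c, b + d) ∈ sitePerim (pix₁ n j)) :
    (a + b ≤ -n ∧ a + b + (c + d) ≤ -n) ∨ (b - a ≤ -n ∧ b - a + (d - c) ≤ -n) ∨
      (n + 1 ≤ b - a ∧ n + 1 ≤ b - a + (d - c)) ∨ (a ≤ -n ∧ a + c ≤ -n) ∨
      (n + 1 ≤ a + b ∧ n + 1 ≤ a + b + (c + d)) ∨
      (n ≤ a + b ∧ n ≤ a + b + (c + d) ∧ j ≤ a ∧ j ≤ a + c) := by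
  rw [mem_sitePerim_pix₁ hj hjn] at hp hq
  obtain ⟨p1, p2, p3, p4, p5, p6⟩ := hp
  obtain ⟨q1, q2, q3, q4, q5, q6⟩ := hq
  have hc' : c = -1 ∨ c = 0 ∨ c = 1 := by omega
  have hd' : d = -1 ∨ d = 0 ∨ d = 1 := by omega
  rcases hc' with rfl | rfl | rfl <;> rcases hd' with rfl | rfl | rfl <;>
    rcases p6 with p6 | p6 | p6 | p6 <;> rcases q6 with q6 | q6 | q6 | q6 <;> omega

theorem extCurve_pix₁ {n j : ℤ} (hj : 1 ≤ j) (hjn : j ≤ n) :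
    extCurve (pix₁ n j) = closure (reg₁ n j) \ reg₁ n j := by
  have hT := extPerim_pix₁ hj hjn
  have hj' : (1 : ℝ) ≤ j := by exact_mod_cast hj
  have hjn' : (j : ℝ) ≤ n := by exact_mod_cast hjn
  rw [closure_reg₁ hj hjn]
  refine Subset.antisymm ?_ ?_
  · refine extCurve_subset hT ?_
    intro a b c d hp hq hc hc1 hd hd1 hcd t x ht ht1 h0 h1
    have k6 := pix₁_edge hj hjn hc hc1 hd hd1 hcd hp hq
    rw [mem_sitePerim_pix₁ hj hjn] at hp hq
    obtain ⟨p1, p2, p3, p4, p5, p6⟩ := hp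
    obtain ⟨q1, q2, q3, q4, q5, q6⟩ := hq
    -- The closed region is not convex at the notch, so both ends must satisfy the same alternative
    -- before interpolation is possible.
    have k5 : (a + b ≤ n ∧ a + b + (c + d) ≤ n) ∨
      (a + b ≤ n + 1 ∧ a + b + (c + d) ≤ n + 1 ∧ a ≤ j ∧ a + c ≤ j) := by omega
    have r1 : -n ≤ a + b + (c + d) := by omega
    have r2 : -n ≤ b - a + (d - c) := by omega
    have r3 : b - a + (d - c) ≤ n + 1 := by omega
    rify at p1 p2 p3 p4 q4 r1 r2 r3 k5 k6
    have e1 : x 0 + x 1 = (a + b : ℝ) + t * (c + d) := by rw [h0, h1]; ring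
    have e2 : x 1 - x 0 = (b - a : ℝ) + t * (d - c) := by rw [h0, h1]; ring
    simp only [reg₁, mem_sdiff, mem_ofPred_eq]
    rw [e1, e2, h0]
    refine ⟨⟨le_add_mul p1 r1 ht ht1, le_add_mul p2 r2 ht ht1, add_mul_le p3 r3 ht ht1,
      le_add_mul p4 q4 ht ht1, ?_⟩, ?_⟩
    · rcases k5 with ⟨k, k'⟩ | ⟨k, k', k'', k'''⟩
      · exact Or.inl (add_mul_le k k' ht ht1)
      · exact Or.inr ⟨add_mul_le k k' ht ht1, add_mul_le k'' k''' ht ht1⟩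
    · rintro ⟨s1, s2, s3, s4, s5⟩
      rcases k6 with ⟨k, k'⟩ | ⟨k, k'⟩ | ⟨k, k'⟩ | ⟨k, k'⟩ | ⟨k, k'⟩ | ⟨k, k', k'', k'''⟩
      · exact s1.not_ge (add_mul_le k k' ht ht1)
      · exact s2.not_ge (add_mul_le k k' ht ht1)
      · exact s3.not_ge (le_add_mul k k' ht ht1)
      · exact s4.not_ge (add_mul_le k k' ht ht1)
      · have := le_add_mul k k' ht ht1
        rcases s5 with s5 | ⟨s5, -⟩ <;> linarith
      · have := le_add_mul k k' ht ht1
        have := le_add_mul k'' k''' ht ht1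
        rcases s5 with s5 | ⟨-, s5⟩ <;> linarith
  · rintro x ⟨⟨h1, h2, h3, h4, h5⟩, hx⟩
    -- A boundary point makes some inequality tight; each of the cases below is one straight run of
    -- black pixels.
    have hx' : x 0 + x 1 = -n ∨ x 1 - x 0 = -n ∨ x 1 - x 0 = n + 1 ∨ x 0 = -n ∨
        (n ≤ x 0 + x 1 ∧ (n + 1 ≤ x 0 + x 1 ∨ j ≤ x 0)) := by
      by_contra hcon
      simp only [not_or, not_and, not_le] at hcon
      obtain ⟨c1, c2, c3, c4, c5⟩ := hcon
      refine hx ⟨lt_of_le_of_ne h1 (Ne.symm c1), lt_of_le_of_ne h2 (Ne.symm c2),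
        lt_of_le_of_ne h3 c3, lt_of_le_of_ne h4 (Ne.symm c4), ?_⟩
      rcases lt_or_ge (x 0 + x 1) n with h | h
      · exact Or.inl h
      · exact Or.inr (c5 h)
    have hu : x 0 + x 1 ≤ n + 1 := by rcases h5 with h | h <;> linarith
    rcases hx' with h | h | h | h | ⟨h, h'⟩
    · refine mem_extCurve_of_run hT (a := 0) (b := -n) (-1) 1 n (by simp [d8]) (by omega) ?_ (-x 0) ?_ ?_ ?_ ?_
      · intro i hi him; rw [mem_sitePerim_pix₁ hj hjn]; omega
      all_goals push_cast; linarith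
    · refine mem_extCurve_of_run hT (a := 0) (b := -n) 1 1 n (by simp [d8]) (by omega) ?_ (x 0) ?_ ?_ ?_ ?_
      · intro i hi him; rw [mem_sitePerim_pix₁ hj hjn]; omega
      · rcases h5 with h5 | h5 <;> linarith
      · rcases h5 with h5 | h5 <;> linarith
      all_goals push_cast; linarith
    · refine mem_extCurve_of_run hT (a := 0) (b := n + 1) (-1) (-1) n (by simp [d8]) (by omega) ?_ (-x 0) ?_ ?_ ?_ ?_
      · intro i hi him; rw [mem_sitePerim_pix₁ hj hjn]; omega
      all_goals push_cast; linarith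
    · refine mem_extCurve_of_run hT (a := -n) (b := 0) 0 1 1 (by simp [d8]) (by omega) ?_ (x 1) ?_ ?_ ?_ ?_
      · intro i hi him; rw [mem_sitePerim_pix₁ hj hjn]; omega
      all_goals push_cast; linarith
    · rcases le_or_gt (x 0) j with hxj | hxj
      · rcases h' with h' | h'
        · refine mem_extCurve_of_run hT (a := 0) (b := n + 1) 1 (-1) j (by simp [d8]) (by omega) ?_ (x 0) ?_ ?_ ?_ ?_
          · intro i hi him; rw [mem_sitePerim_pix₁ hj hjn]; omega
          all_goals push_cast; linarith
        · refine mem_extCurve_of_run hT (a := j) (b := n - j) 0 1 1 (by simp [d8]) (by omega) ?_ (x 0 + x 1 - n) ?_ ?_ ?_ ?_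
          · intro i hi him; rw [mem_sitePerim_pix₁ hj hjn]; omega
          all_goals push_cast; linarith
      · have hun : x 0 + x 1 = n := by rcases h5 with h5 | h5 <;> linarith
        have hlt : j < n := by
          have : (j : ℝ) < n := by linarith
          exact_mod_cast this
        refine mem_extCurve_of_run hT (a := n) (b := 0) (-1) 1 (n - j) (by simp [d8]) (by omega) ?_ (n - x 0) ?_ ?_ ?_ ?_
        · intro i hi him; rw [mem_sitePerim_pix₁ hj hjn]; omega
        all_goals push_cast; linarith

theorem polygonalTile_pix₁ {n j : ℤ} (hj : 1 ≤ j) (hjn : j ≤ n) :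
    polygonalTile (pix₁ n j) = reg₁ n j := by
  have hj' : (1 : ℝ) ≤ j := by exact_mod_cast hj
  have hjn' : (j : ℝ) ≤ n := by exact_mod_cast hjn
  refine polygonalTile_eq (isOpen_reg₁ n j) ?_ (extCurve_pix₁ hj hjn) ?_ ?_
  · refine isBounded_of_coord (2 * n + 2) ?_
    rintro p ⟨h1, h2, h3, h4, h5⟩
    have hu : p 0 + p 1 ≤ n + 1 := by rcases h5 with h | h <;> linarith
    constructor <;> rw [abs_le] <;> constructor <;> linarith
  · intro x hx
    rw [closure_reg₁ hj hjn] at hx ⊢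
    simp only [mem_ofPred_eq, ray_apply] at hx ⊢
    rcases lt_or_ge (x 0 + x 1) (-n) with h1 | h1
    · exact ⟨!₂[-1, -1], vec_ne_zero (by norm_num), fun t ht h => by simp at h; linarith [h.1]⟩
    rcases lt_or_ge (x 1 - x 0) (-n) with h2 | h2
    · exact ⟨!₂[1, -1], vec_ne_zero (by norm_num), fun t ht h => by simp at h; linarith [h.2.1]⟩
    rcases lt_or_ge (n + 1 : ℝ) (x 1 - x 0) with h3 | h3
    · exact ⟨!₂[-1, 1], vec_ne_zero (by norm_num), fun t ht h => by simp at h; linarith [h.2.2.1]⟩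
    rcases lt_or_ge (x 0) (-n) with h4 | h4
    · exact ⟨!₂[-1, 0], vec_ne_zero (by norm_num), fun t ht h => by simp at h; linarith [h.2.2.2.1]⟩
    -- Only the notched condition fails here, and moving to the right preserves its failure.
    refine ⟨!₂[1, 0], vec_ne_zero (by norm_num), fun t ht h => hx ⟨h1, h2, h3, h4, ?_⟩⟩
    simp at h
    refine h.2.2.2.2.imp (fun h => by linarith) fun h => ⟨by linarith [h.1], by linarith [h.2]⟩
  · rintro ⟨a, b⟩ h
    simp only [reg₁, mem_ofPred_eq, emb_apply_zero, emb_apply_one] at h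
    simp only [pix₁, mem_ofPred_eq]
    norm_cast at h
    omega

/-! ### The tile of the spiral for k = s₃(n - 1) + j. -/

/-- The polygonal tile of the spiral `𝓠ₖ` for `k = s₃(n - 1) + j`. -/
def reg₂ (n j : ℤ) : Set Plane :=
  {p | p 0 + p 1 < n ∧ -(n : ℝ) < p 1 - p 0 ∧ p 1 - p 0 < n ∧
    ((-(n : ℝ) + 1 < p 0 + p 1 ∧ -(n : ℝ) + 1 < p 0) ∨ (-(n : ℝ) < p 0 + p 1 ∧ -(j : ℝ) < p 0))}

theorem isOpen_reg₂ (n j : ℤ) : IsOpen (reg₂ n j) := by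
  refine IsOpen.and ?_ (IsOpen.and ?_ (IsOpen.and ?_ (isOpen_or (IsOpen.and ?_ ?_)
    (IsOpen.and ?_ ?_))))
  all_goals exact isOpen_lt (by fun_prop) (by fun_prop)

theorem closure_reg₂ {n j : ℤ} (hj : 1 ≤ j) (hjn : j ≤ n) : closure (reg₂ n j) =
    {p | p 0 + p 1 ≤ (n : ℝ) ∧ -(n : ℝ) ≤ p 1 - p 0 ∧ p 1 - p 0 ≤ (n : ℝ) ∧
      ((-(n : ℝ) + 1 ≤ p 0 + p 1 ∧ -(n : ℝ) + 1 ≤ p 0) ∨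
        (-(n : ℝ) ≤ p 0 + p 1 ∧ -(j : ℝ) ≤ p 0))} := by
  have hj' : (1 : ℝ) ≤ j := by exact_mod_cast hj
  have hjn' : (j : ℝ) ≤ n := by exact_mod_cast hjn
  refine closure_eq_of_star ?_ ?_ ?_
  · refine IsClosed.and ?_ (IsClosed.and ?_ (IsClosed.and ?_ (isClosed_or (IsClosed.and ?_ ?_)
      (IsClosed.and ?_ ?_))))
    all_goals exact isClosed_le (by fun_prop) (by fun_prop)
  · rintro p ⟨h1, h2, h3, h4⟩
    exact ⟨h1.le, h2.le, h3.le, h4.imp (fun h => ⟨h.1.le, h.2.le⟩) (fun h => ⟨h.1.le, h.2.le⟩)⟩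
  · rintro p ⟨h1, h2, h3, h4⟩
    refine ⟨0, fun t ht ht1 => ?_⟩
    simp only [reg₂, mem_ofPred_eq, combo_apply, PiLp.zero_apply]
    have f : ∀ a c : ℝ, a ≤ c → 0 < c → a + t * (0 - a) < c :=
      fun a c ha hc => add_mul_sub_lt ha hc ht ht1
    have g1 := f (p 0 + p 1) n (by linarith) (by linarith)
    have g2 := f (-(p 1 - p 0)) n (by linarith) (by linarith)
    have g3 := f (p 1 - p 0) n (by linarith) (by linarith)
    refine ⟨by linarith, by linarith, by linarith, ?_⟩
    have hB : (-(n : ℝ) ≤ p 0 + p 1 ∧ -(j : ℝ) ≤ p 0) → -(n : ℝ) < p 0 + t * (0 - p 0) +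
        (p 1 + t * (0 - p 1)) ∧ -(j : ℝ) < p 0 + t * (0 - p 0) := by
      rintro ⟨h5, h6⟩
      have g5 := f (-(p 0 + p 1)) n (by linarith) (by linarith)
      have g6 := f (-p 0) j (by linarith) (by linarith)
      constructor <;> linarith
    rcases h4 with ⟨h5, h6⟩ | h4
    -- If j < n then n ≥ 2 and the origin satisfies the first alternative strictly. If j = n the
    -- first alternative implies the second.
    · rcases hjn.lt_or_eq with hlt | rfl
      · have hlt' : (1 : ℝ) ≤ n - 1 := by
          have : (2 : ℤ) ≤ n := by omega
          have : (2 : ℝ) ≤ n := by exact_mod_cast this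
          linarith
        have g5 := f (-(p 0 + p 1)) (n - 1) (by linarith) (by linarith)
        have g6 := f (-p 0) (n - 1) (by linarith) (by linarith)
        left; constructor <;> linarith
      · exact Or.inr (hB ⟨by linarith, by linarith⟩)
    · exact Or.inr (hB h4)

theorem mem_sitePerim_pix₃ {n j : ℤ} (hj : 1 ≤ j) (hjn : j ≤ n) (a b : ℤ) :
    (a, b) ∈ sitePerim (pix₃ (n - 1) j) ↔
      a + b ≤ n ∧ -n ≤ b - a ∧ b - a ≤ n ∧
      ((-n + 1 ≤ a + b ∧ -n + 1 ≤ a) ∨ (-n ≤ a + b ∧ -j ≤ a)) ∧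
      (a + b = n ∨ b - a = -n ∨ b - a = n ∨ a + b = -n ∨ (a + b = -n + 1 ∧ a ≤ -j)) := by
  rw [mem_sitePerim_iff]
  simp only [pix₃, mem_ofPred_eq]
  omega

theorem extPerim_pix₃ {n j : ℤ} (hj : 1 ≤ j) (hjn : j ≤ n) :
    extPerim (pix₃ (n - 1) j) = sitePerim (pix₃ (n - 1) j) := by
  refine extPerim_eq_sitePerim ?_
  rintro ⟨a, b⟩ hz
  simp only [mem_sitePerim_pix₃ hj hjn] at hz ⊢
  rcases hz.2.2.2.2 with h | h | h | h
  · exact ⟨(1, 0), by simp [d4], fun k hk => by omega⟩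
  · exact ⟨(0, -1), by simp [d4], fun k hk => by omega⟩
  · exact ⟨(0, 1), by simp [d4], fun k hk => by omega⟩
  · exact ⟨(-1, 0), by simp [d4], fun k hk => by omega⟩

set_option maxHeartbeats 1000000 in
-- As for `pix₁_edge`. The last two alternatives carry a ≤ -j as well, since they must exclude both
-- halves of the disjunction that defines `reg₂`.
theorem pix₃_edge {n j a b c d : ℤ} (hj : 1 ≤ j) (hjn : j ≤ n) (hc : -1 ≤ c) (hc1 : c ≤ 1)
    (hd : -1 ≤ d) (hd1 : d ≤ 1) (hcd : c ≠ 0 ∨ d ≠ 0)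
    (hp : (a, b) ∈ sitePerim (pix₃ (n - 1) j)) (hq : (a + c, b + d) ∈ sitePerim (pix₃ (n - 1) j)) :
    (n ≤ a + b ∧ n ≤ a + b + (c + d)) ∨ (b - a ≤ -n ∧ b - a + (d - c) ≤ -n) ∨
      (n ≤ b - a ∧ n ≤ b - a + (d - c)) ∨ (a + b ≤ -n ∧ a + b + (c + d) ≤ -n) ∨
      (a + b ≤ -n + 1 ∧ a + b + (c + d) ≤ -n + 1 ∧ a ≤ -j ∧ a + c ≤ -j) ∨
      (a ≤ -n + 1 ∧ a + c ≤ -n + 1 ∧ a ≤ -j ∧ a + c ≤ -j) := by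
  rw [mem_sitePerim_pix₃ hj hjn] at hp hq
  obtain ⟨p1, p2, p3, p5, p6⟩ := hp
  obtain ⟨q1, q2, q3, q5, q6⟩ := hq
  have hc' : c = -1 ∨ c = 0 ∨ c = 1 := by omega
  have hd' : d = -1 ∨ d = 0 ∨ d = 1 := by omega
  rcases hc' with rfl | rfl | rfl <;> rcases hd' with rfl | rfl | rfl <;>
    rcases p6 with p6 | p6 | p6 | p6 | p6 <;> rcases q6 with q6 | q6 | q6 | q6 | q6 <;> omega

theorem extCurve_pix₃_subset {n j : ℤ} (hj : 1 ≤ j) (hjn : j ≤ n) :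
    extCurve (pix₃ (n - 1) j) ⊆ closure (reg₂ n j) \ reg₂ n j := by
  have hT := extPerim_pix₃ hj hjn
  rw [closure_reg₂ hj hjn]
  refine extCurve_subset hT ?_
  intro a b c d hp hq hc hc1 hd hd1 hcd t x ht ht1 h0 h1
  have k6 := pix₃_edge hj hjn hc hc1 hd hd1 hcd hp hq
  rw [mem_sitePerim_pix₃ hj hjn] at hp hq
  obtain ⟨p1, p2, p3, p5, -⟩ := hp
  obtain ⟨q1, q2, q3, q5, -⟩ := hq
  have k5 : (-n + 1 ≤ a + b ∧ -n + 1 ≤ a + b + (c + d) ∧ -n + 1 ≤ a ∧ -n + 1 ≤ a + c) ∨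
    (-n ≤ a + b ∧ -n ≤ a + b + (c + d) ∧ -j ≤ a ∧ -j ≤ a + c) := by omega
  have r1 : a + b + (c + d) ≤ n := by omega
  have r2 : -n ≤ b - a + (d - c) := by omega
  have r3 : b - a + (d - c) ≤ n := by omega
  rify at p1 p2 p3 r1 r2 r3 k5 k6
  have e1 : x 0 + x 1 = (a + b : ℝ) + t * (c + d) := by rw [h0, h1]; ring
  have e2 : x 1 - x 0 = (b - a : ℝ) + t * (d - c) := by rw [h0, h1]; ring
  simp only [reg₂, mem_sdiff, mem_ofPred_eq]
  rw [e1, e2, h0]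
  refine ⟨⟨add_mul_le p1 r1 ht ht1, le_add_mul p2 r2 ht ht1, add_mul_le p3 r3 ht ht1, ?_⟩, ?_⟩
  · rcases k5 with ⟨k, k', k'', k'''⟩ | ⟨k, k', k'', k'''⟩
    · exact Or.inl ⟨le_add_mul k k' ht ht1, le_add_mul k'' k''' ht ht1⟩
    · exact Or.inr ⟨le_add_mul k k' ht ht1, le_add_mul k'' k''' ht ht1⟩
  · have hjn' : (j : ℝ) ≤ n := by exact_mod_cast hjn
    rintro ⟨s1, s2, s3, s5⟩
    rcases k6 with ⟨k, k'⟩ | ⟨k, k'⟩ | ⟨k, k'⟩ | ⟨k, k'⟩ | ⟨k, k', k'', k'''⟩ | ⟨k, k', k'', k'''⟩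
    · exact s1.not_ge (le_add_mul k k' ht ht1)
    · exact s2.not_ge (add_mul_le k k' ht ht1)
    · exact s3.not_ge (le_add_mul k k' ht ht1)
    · have := add_mul_le k k' ht ht1
      rcases s5 with ⟨s5, s6⟩ | ⟨s5, s6⟩ <;> linarith
    · have := add_mul_le k k' ht ht1
      have := add_mul_le k'' k''' ht ht1
      rcases s5 with ⟨s5, s6⟩ | ⟨s5, s6⟩ <;> linarith
    · have := add_mul_le k k' ht ht1
      have := add_mul_le k'' k''' ht ht1
      rcases s5 with ⟨s5, s6⟩ | ⟨s5, s6⟩ <;> linarith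

theorem subset_extCurve_pix₃ {n j : ℤ} (hj : 1 ≤ j) (hjn : j ≤ n) :
    closure (reg₂ n j) \ reg₂ n j ⊆ extCurve (pix₃ (n - 1) j) := by
  have hT := extPerim_pix₃ hj hjn
  have hj' : (1 : ℝ) ≤ j := by exact_mod_cast hj
  have hjn' : (j : ℝ) ≤ n := by exact_mod_cast hjn
  rw [closure_reg₂ hj hjn]
  rintro x ⟨⟨h1, h2, h3, h5⟩, hx⟩
  have hx' : x 0 + x 1 = n ∨ x 1 - x 0 = -n ∨ x 1 - x 0 = n ∨
      ((x 0 + x 1 ≤ -n + 1 ∨ x 0 ≤ -n + 1) ∧ (x 0 + x 1 ≤ -n ∨ x 0 ≤ -j)) := by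
    by_contra hcon
    simp only [not_or, not_and_or, not_le] at hcon
    obtain ⟨c1, c2, c3, c4⟩ := hcon
    exact hx ⟨lt_of_le_of_ne h1 c1, lt_of_le_of_ne h2 (Ne.symm c2), lt_of_le_of_ne h3 c3, c4⟩
  have hu : -n ≤ x 0 + x 1 := by rcases h5 with h | h <;> linarith
  rcases hx' with h | h | h | ⟨h, h'⟩
  · refine mem_extCurve_of_run hT (a := n) (b := 0) (-1) 1 n (by simp [d8]) (by omega) ?_ (n - x 0) ?_ ?_ ?_ ?_
    · intro i hi him; rw [mem_sitePerim_pix₃ hj hjn]; omega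
    all_goals push_cast; linarith
  · refine mem_extCurve_of_run hT (a := 0) (b := -n) 1 1 n (by simp [d8]) (by omega) ?_ (x 0) ?_ ?_ ?_ ?_
    · intro i hi him; rw [mem_sitePerim_pix₃ hj hjn]; omega
    all_goals push_cast; linarith
  -- The upper left side ends at (-n + 1, 1), where a vertical edge begins, unless j = n: then it
  -- runs on to (-n, 0).
  · rcases hjn.lt_or_eq with hlt | rfl
    · have hlt' : (j : ℝ) ≤ n - 1 := by
        have : j ≤ n - 1 := by omega
        exact_mod_cast this
      refine mem_extCurve_of_run hT (a := 0) (b := n) (-1) (-1) (n - 1) (by simp [d8]) (by omega) ?_ (-x 0) ?_ ?_ ?_ ?_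
      · intro i hi him; rw [mem_sitePerim_pix₃ hj hjn]; omega
      · linarith
      · rcases h5 with h5 | h5 <;> push_cast <;> linarith
      all_goals push_cast; linarith
    · refine mem_extCurve_of_run hT (a := 0) (b := j) (-1) (-1) j (by simp [d8]) (by omega) ?_ (-x 0) ?_ ?_ ?_ ?_
      · intro i hi him; rw [mem_sitePerim_pix₃ hj hjn]; omega
      all_goals push_cast; linarith
  · rcases hu.eq_or_lt with hu | hu
    · refine mem_extCurve_of_run hT (a := 0) (b := -n) (-1) 1 j (by simp [d8]) (by omega) ?_ (-x 0) ?_ ?_ ?_ ?_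
      · intro i hi him; rw [mem_sitePerim_pix₃ hj hjn]; omega
      · linarith
      · rcases h5 with h5 | h5 <;> linarith
      all_goals push_cast; linarith
    have hxj : x 0 ≤ -j := by
      rcases h' with h' | h'
      · exact absurd hu h'.not_gt
      · exact h'
    have hlt : j < n := by
      by_contra hcon
      obtain rfl : j = n := by omega
      linarith
    have hlt' : (j : ℝ) ≤ n - 1 := by
      have : j ≤ n - 1 := by omega
      exact_mod_cast this
    have hxn : -n + 1 ≤ x 0 := by rcases h5 with h5 | h5 <;> linarith
    rcases le_or_gt (x 0 + x 1) (-n + 1) with h6 | h6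
    · rcases hxj.eq_or_lt with h7 | h7
      · refine mem_extCurve_of_run hT (a := -j) (b := -n + j) 0 1 1 (by simp [d8]) (by omega) ?_ (x 0 + x 1 + n) ?_ ?_ ?_ ?_
        · intro i hi him; rw [mem_sitePerim_pix₃ hj hjn]; omega
        all_goals push_cast; linarith
      · have h8 : x 0 + x 1 = -n + 1 := by rcases h5 with h5 | h5 <;> linarith
        have hlt2 : j < n - 1 := by
          have : (j : ℝ) < n - 1 := by linarith
          exact_mod_cast this
        refine mem_extCurve_of_run hT (a := -j) (b := -n + 1 + j) (-1) 1 (n - 1 - j) (by simp [d8]) (by omega) ?_ (-j - x 0) ?_ ?_ ?_ ?_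
        · intro i hi him; rw [mem_sitePerim_pix₃ hj hjn]; omega
        all_goals push_cast; linarith
    · have h8 : x 0 = -n + 1 := by
        rcases h with h | h <;> linarith
      refine mem_extCurve_of_run hT (a := -n + 1) (b := 0) 0 1 1 (by simp [d8]) (by omega) ?_ (x 1) ?_ ?_ ?_ ?_
      · intro i hi him; rw [mem_sitePerim_pix₃ hj hjn]; omega
      all_goals push_cast; linarith

theorem polygonalTile_pix₃ {n j : ℤ} (hj : 1 ≤ j) (hjn : j ≤ n) :
    polygonalTile (pix₃ (n - 1) j) = reg₂ n j := by
  have hj' : (1 : ℝ) ≤ j := by exact_mod_cast hj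
  have hjn' : (j : ℝ) ≤ n := by exact_mod_cast hjn
  refine polygonalTile_eq (isOpen_reg₂ n j) ?_
    (Subset.antisymm (extCurve_pix₃_subset hj hjn) (subset_extCurve_pix₃ hj hjn)) ?_ ?_
  · refine isBounded_of_coord (2 * n + 2) ?_
    rintro p ⟨h1, h2, h3, h5⟩
    have hu : -n ≤ p 0 + p 1 := by rcases h5 with h | h <;> linarith
    constructor <;> rw [abs_le] <;> constructor <;> linarith
  · intro x hx
    rw [closure_reg₂ hj hjn] at hx ⊢
    simp only [mem_ofPred_eq, ray_apply] at hx ⊢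
    rcases lt_or_ge (n : ℝ) (x 0 + x 1) with h1 | h1
    · exact ⟨!₂[1, 1], vec_ne_zero (by norm_num), fun t ht h => by simp at h; linarith [h.1]⟩
    rcases lt_or_ge (x 1 - x 0) (-n) with h2 | h2
    · exact ⟨!₂[1, -1], vec_ne_zero (by norm_num), fun t ht h => by simp at h; linarith [h.2.1]⟩
    rcases lt_or_ge (n : ℝ) (x 1 - x 0) with h3 | h3
    · exact ⟨!₂[-1, 1], vec_ne_zero (by norm_num), fun t ht h => by simp at h; linarith [h.2.2.1]⟩
    refine ⟨!₂[-1, 0], vec_ne_zero (by norm_num), fun t ht h => hx ⟨h1, h2, h3, ?_⟩⟩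
    have h' := h.2.2.2
    simp only [Matrix.cons_val_zero, Matrix.cons_val_one] at h'
    exact h'.imp (fun h => ⟨by linarith [h.1], by linarith [h.2]⟩)
      fun h => ⟨by linarith [h.1], by linarith [h.2]⟩
  · rintro ⟨a, b⟩ h
    simp only [reg₂, mem_ofPred_eq, emb_apply_zero, emb_apply_one] at h
    simp only [pix₃, mem_ofPred_eq]
    norm_cast at h
    omega

/-! ### Staircases and a criterion for lattice tilings. -/

theorem mem_columnLattice_iff (M : Matrix (Fin 2) (Fin 2) ℤ) (y : Plane) :
    y ∈ columnLattice M ↔ ∃ α β : ℤ, y 0 = α * M 0 0 + β * M 0 1 ∧ y 1 = α * M 1 0 + β * M 1 1 := by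
  have hr : (range fun c : Fin 2 => emb (M 0 c, M 1 c)) =
      {emb (M 0 0, M 1 0), emb (M 0 1, M 1 1)} := by
    ext x
    simp only [mem_range, Fin.exists_fin_two, mem_insert_iff, mem_singleton_iff, eq_comm]
  rw [columnLattice, hr, AddSubgroup.mem_closure_pair]
  refine exists_congr fun α => exists_congr fun β => ?_
  constructor
  · rintro rfl
    constructor <;> simp [emb]
  · rintro ⟨h0, h1⟩
    refine plane_ext ?_ ?_
    · rw [h0]; simp [emb]
    · rw [h1]; simp [emb]

/-- The extension of a function `L₀` on `[a, a + H)` by `L (v + H) = L v + c`. -/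
noncomputable def stair (a H c : ℝ) (L₀ : ℝ → ℝ) (v : ℝ) : ℝ :=
  ⌊(v - a) / H⌋ * c + L₀ (v - ⌊(v - a) / H⌋ * H)

section stair

variable {a H c : ℝ} {L₀ : ℝ → ℝ}

theorem stair_eq (hH : 0 < H) {v : ℝ} (m : ℤ) (h1 : a + m * H ≤ v) (h2 : v < a + (m + 1) * H) :
    stair a H c L₀ v = m * c + L₀ (v - m * H) := by
  have : ⌊(v - a) / H⌋ = m := by
    rw [Int.floor_eq_iff, le_div_iff₀ hH, div_lt_iff₀ hH]
    constructor <;> linarith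
  rw [stair, this]

theorem exists_stair_eq (hH : 0 < H) (v : ℝ) : ∃ m : ℤ, a + m * H ≤ v ∧ v < a + (m + 1) * H := by
  refine ⟨⌊(v - a) / H⌋, ?_, ?_⟩
  · have := Int.floor_le ((v - a) / H)
    rw [le_div_iff₀ hH] at this
    linarith
  · have := Int.lt_floor_add_one ((v - a) / H)
    rw [div_lt_iff₀ hH] at this
    linarith

theorem stair_add (hH : 0 < H) (v : ℝ) (k : ℤ) :
    stair a H c L₀ (v + k * H) = stair a H c L₀ v + k * c := by
  obtain ⟨m, h1, h2⟩ := exists_stair_eq (a := a) hH v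
  rw [stair_eq hH m h1 h2, stair_eq hH (m + k) (by push_cast; linarith) (by push_cast; linarith)]
  push_cast
  ring_nf

/-- `hend` forbids a downward jump where one period is glued to the next. -/
theorem monotone_stair (hH : 0 < H) (hc : 0 ≤ c) (hL : Monotone L₀) (hend : L₀ (a + H) ≤ L₀ a + c) :
    Monotone (stair a H c L₀) := by
  intro v w hvw
  obtain ⟨m, h1, h2⟩ := exists_stair_eq (a := a) hH v
  obtain ⟨k, h3, h4⟩ := exists_stair_eq (a := a) hH w
  rw [stair_eq hH m h1 h2, stair_eq hH k h3 h4]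
  have hmk : m ≤ k := by
    by_contra hcon
    have : (k : ℝ) + 1 ≤ m := by exact_mod_cast (not_le.1 hcon)
    nlinarith
  rcases hmk.eq_or_lt with rfl | hlt
  · linarith [hL (show v - m * H ≤ w - m * H by linarith)]
  · have hk : (m : ℝ) + 1 ≤ k := by exact_mod_cast hlt
    have e1 := hL (show v - m * H ≤ a + H by linarith)
    have e2 := hL (show a ≤ w - k * H by linarith)
    nlinarith

end stair

section tiling

variable {H c W s : ℝ} {L : ℝ → ℝ}

/-- The covering half of the criterion: β selects the strip between two consecutive translates of
the staircase, then α selects the period within that strip. -/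
theorem exists_translate_between (hH : 0 < H) (hW : 0 < W) (hs : 0 ≤ s) (hmono : Monotone L)
    (hL : ∀ (v : ℝ) (k : ℤ), L (v + k * H) = L v + k * c) (a u v : ℝ) :
    ∃ α β : ℤ, a ≤ v + H * α + s * β ∧ v + H * α + s * β < a + H ∧
      L (v + H * α + s * β) ≤ u + c * α - W * β ∧
      u + c * α - W * β ≤ L (v + H * α + s * β + s) + W := by
  -- The β-th translate of the staircase is u = L (v + s β) + W β; the chosen one is the last that
  -- does not pass above the point. Monotonicity of L together with W > 0 bounds β.
  obtain ⟨β, hβ, hmax⟩ := Int.exists_greatest_of_bdd (P := fun β : ℤ => L (v + s * β) ≤ u - W * β)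
    ⟨max 0 ⌈(u - L v) / W⌉, fun β hβ => by
      rcases le_or_gt β 0 with h | h
      · exact h.trans (le_max_left _ _)
      · refine le_trans ?_ (le_max_right _ _)
        have hpos : (0 : ℝ) ≤ β := by exact_mod_cast h.le
        have h1 := hmono (show v ≤ v + s * β by nlinarith)
        have h2 : (β : ℝ) ≤ (u - L v) / W := by rw [le_div_iff₀ hW]; linarith
        exact_mod_cast h2.trans (Int.le_ceil _)⟩
    ⟨min 0 ⌊(u - L v) / W⌋, by
      set β := min 0 ⌊(u - L v) / W⌋ with hβ
      have h0 : (β : ℝ) ≤ 0 := by exact_mod_cast min_le_left _ _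
      have h1 := hmono (show v + s * β ≤ v by nlinarith)
      have h2 : (β : ℝ) ≤ (u - L v) / W :=
        (Int.cast_le.2 (min_le_right _ _)).trans (Int.floor_le _)
      rw [le_div_iff₀ hW] at h2
      linarith⟩
  have hnext : u - W * β - W < L (v + s * β + s) := by
    by_contra hcon
    have := hmax (β + 1) (by
      push_cast
      rw [show v + s * ((β : ℝ) + 1) = v + s * β + s by ring]
      linarith)
    omega
  obtain ⟨m, h1, h2⟩ := exists_stair_eq (a := a) hH (v + s * β)
  refine ⟨-m, β, ?_, ?_, ?_, ?_⟩
  · push_cast; linarith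
  · push_cast; linarith
  · have := hL (v + s * β) (-m)
    rw [show v + H * ((-m : ℤ) : ℝ) + s * β = v + s * β + (-m : ℤ) * H by ring, this]
    linarith
  · have := hL (v + s * β + s) (-m)
    rw [show v + H * ((-m : ℤ) : ℝ) + s * β + s = v + s * β + s + (-m : ℤ) * H by ring, this]
    linarith

/-- The disjointness half: distinct open strips do not meet because L is monotone, which gives β =
0; then v and v - H α lie in one open interval of length H, which gives α = 0. -/
theorem eq_zero_of_translate_between (hH : 0 < H) (hW : 0 < W) (hs : 0 ≤ s) (hmono : Monotone L)
    (hL : ∀ (v : ℝ) (k : ℤ), L (v + k * H) = L v + k * c) {a u v u' v' : ℝ} {α β : ℤ}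
    (hu : u' = u - c * α + W * β) (hv : v' = v - H * α - s * β)
    (h1 : a < v) (h2 : v < a + H) (h3 : L v < u) (h4 : u < L (v + s) + W)
    (h1' : a < v') (h2' : v' < a + H) (h3' : L v' < u') (h4' : u' < L (v' + s) + W) :
    α = 0 ∧ β = 0 := by
  have e1 := hL v' α
  have e2 := hL (v' + s) α
  rw [show v' + α * H = v - s * β by rw [hv]; ring] at e1
  rw [show v' + s + α * H = v - s * β + s by rw [hv]; ring] at e2
  have hβ : β = 0 := by
    rcases lt_trichotomy β 0 with h | h | h
    · exfalso
      have hb : (β : ℝ) ≤ -1 := by exact_mod_cast (show β ≤ -1 by omega)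
      have := hmono (show v + s ≤ v - s * β by nlinarith)
      nlinarith
    · exact h
    · exfalso
      have hb : (1 : ℝ) ≤ β := by exact_mod_cast h
      have := hmono (show v - s * β + s ≤ v by nlinarith)
      nlinarith
  subst hβ
  refine ⟨?_, rfl⟩
  simp only [Int.cast_zero, mul_zero, sub_zero] at hv
  have ha : (α : ℝ) < 1 := by nlinarith
  have hb : (-1 : ℝ) < α := by nlinarith
  have ha' : α < 1 := by exact_mod_cast ha
  have hb' : -1 < α := by exact_mod_cast hb
  omega

/-- A region lying between a staircase and its translate, and dense there, tiles by translations. -/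
theorem tilesByLattice_of_between (hH : 0 < H) (hW : 0 < W) (hs : 0 ≤ s) (hmono : Monotone L)
    (hL : ∀ (v : ℝ) (k : ℤ), L (v + k * H) = L v + k * c) (a : ℝ) {F : Set Plane} (hF : IsOpen F)
    {M : Matrix (Fin 2) (Fin 2) ℤ} (hc' : (M 0 0 + M 1 0 : ℝ) = -c) (hH' : (M 1 0 - M 0 0 : ℝ) = -H)
    (hW' : (M 0 1 + M 1 1 : ℝ) = W) (hs' : (M 1 1 - M 0 1 : ℝ) = -s)
    (hsub : ∀ p ∈ F, a < p 1 - p 0 ∧ p 1 - p 0 < a + H ∧ L (p 1 - p 0) < p 0 + p 1 ∧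
      p 0 + p 1 < L (p 1 - p 0 + s) + W)
    (hcl : ∀ p : Plane, a ≤ p 1 - p 0 → p 1 - p 0 < a + H → L (p 1 - p 0) ≤ p 0 + p 1 →
      p 0 + p 1 ≤ L (p 1 - p 0 + s) + W → p ∈ closure F) :
    TilesByLattice F (columnLattice M) := by
  refine ⟨hF, eq_univ_of_forall fun p => ?_, ?_⟩
  · obtain ⟨α, β, h1, h2, h3, h4⟩ :=
      exists_translate_between hH hW hs hmono hL a (p 0 + p 1) (p 1 - p 0)
    simp only [mem_iUnion]
    set y : Plane := !₂[α * (M 0 0 : ℝ) + β * M 0 1, α * (M 1 0 : ℝ) + β * M 1 1] with hy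
    have y0 : y 0 = α * (M 0 0 : ℝ) + β * M 0 1 := rfl
    have y1 : y 1 = α * (M 1 0 : ℝ) + β * M 1 1 := rfl
    refine ⟨y, (mem_columnLattice_iff M y).2 ⟨α, β, y0, y1⟩, p - y, ?_, by simp⟩
    have ev : (p - y) 1 - (p - y) 0 = p 1 - p 0 + H * α + s * β := by
      simp only [PiLp.sub_apply, y0, y1]
      linear_combination (-(α : ℝ)) * hH' - β * hs'
    have eu : (p - y) 0 + (p - y) 1 = p 0 + p 1 + c * α - W * β := by
      simp only [PiLp.sub_apply, y0, y1]
      linear_combination (-(α : ℝ)) * hc' - β * hW'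
    apply hcl <;> rw [ev] <;> (try rw [eu]) <;> assumption
  · intro y hy z hz hyz
    rw [disjoint_left]
    rintro _ ⟨p, hp, rfl⟩ ⟨q, hq, hpq⟩
    obtain ⟨α, β, h0, h1⟩ := (mem_columnLattice_iff M _).1 (sub_mem hy hz)
    have hqp : q = p + (y - z) := by
      simp only at hpq
      rw [← add_sub_assoc, ← hpq]; simp
    obtain ⟨a1, a2, a3, a4⟩ := hsub p hp
    obtain ⟨b1, b2, b3, b4⟩ := hsub q hq
    have q0 : q 0 = p 0 + (y - z) 0 := by rw [hqp]; rfl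
    have q1 : q 1 = p 1 + (y - z) 1 := by rw [hqp]; rfl
    obtain ⟨rfl, rfl⟩ := eq_zero_of_translate_between (α := α) (β := β) hH hW hs hmono hL
      (by rw [q0, q1, h0, h1]; linear_combination (α : ℝ) * hc' + β * hW')
      (by rw [q0, q1, h0, h1]; linear_combination (α : ℝ) * hH' + β * hs')
      a1 a2 a3 a4 b1 b2 b3 b4
    refine hyz (sub_eq_zero.1 (plane_ext ?_ ?_))
    · rw [h0]; simp
    · rw [h1]; simp

end tiling

/-! ### The two lattice tilings. -/

theorem tilesByLattice_reg₁ {n j : ℤ} (hj : 1 ≤ j) (hjn : j ≤ n) :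
    TilesByLattice (reg₁ n j) (columnLattice !![n, n + j; -n - 1, n - j]) := by
  have hj' : (1 : ℝ) ≤ j := by exact_mod_cast hj
  have hjn' : (j : ℝ) ≤ n := by exact_mod_cast hjn
  -- With u = x + y and v = y - x, the condition x > -n reads u > v - 2n. Thus L₀ records the lower
  -- left side together with the vertical edge.
  set L₀ : ℝ → ℝ := fun v => max (-n) (v - 2 * n) with hL₀
  have hH : (0 : ℝ) < 2 * n + 1 := by linarith
  have key0 : ∀ v : ℝ, -n ≤ v → v < -n + (2 * n + 1) →
      stair (-n) (2 * n + 1) 1 L₀ v = max (-n : ℝ) (v - 2 * n) := by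
    intro v h1 h2
    rw [stair_eq hH 0 (by simpa using h1) (by simpa using h2)]
    simp [hL₀]
  have key1 : ∀ v : ℝ, -n + (2 * n + 1) ≤ v → v < -n + 2 * (2 * n + 1) →
      stair (-n) (2 * n + 1) 1 L₀ v = 1 + max (-n : ℝ) (v - (2 * n + 1) - 2 * n) := by
    intro v h1 h2
    rw [stair_eq hH 1 (by push_cast; linarith) (by push_cast; linarith)]
    simp [hL₀]
  -- The columns of the matrix change (u, v) by (-1, -(2n + 1)) and (2n, -2j), which gives c, H, W
  -- and s. The upper boundary is L (v + 2j) + 2n; for v + 2j < n + 1 this is max n (v + 2j), where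
  -- u < v + 2j means x < j.
  refine tilesByLattice_of_between (L := stair (-n) (2 * n + 1) 1 L₀) (H := 2 * n + 1) (c := 1)
    (W := 2 * n) (s := 2 * j) hH (by linarith) (by linarith)
    (monotone_stair hH zero_le_one ?_ ?_) (fun v k => stair_add hH v k) (-n) (isOpen_reg₁ n j)
    (by simp; ring) (by simp; ring) (by simp; ring) (by simp; ring) ?_ ?_
  · intro v w hvw
    exact max_le_max le_rfl (by linarith)
  · simp only [hL₀]
    refine max_le ?_ ?_ <;> linarith [le_max_left (-n : ℝ) (-n - 2 * n)]
  · rintro p ⟨h1, h2, h3, h4, h5⟩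
    refine ⟨h2, by linarith, ?_, ?_⟩
    · rw [key0 _ (by linarith) (by linarith)]
      exact max_lt h1 (by linarith)
    · rcases lt_or_ge (p 1 - p 0 + 2 * j) (-n + (2 * n + 1)) with h | h
      · rw [key0 _ (by linarith) h]
        rcases h5 with h5 | ⟨h5, h6⟩
        · linarith [le_max_left (-n : ℝ) (p 1 - p 0 + 2 * j - 2 * n)]
        · linarith [le_max_right (-n : ℝ) (p 1 - p 0 + 2 * j - 2 * n)]
      · rw [key1 _ h (by linarith)]
        have := le_max_left (-n : ℝ) (p 1 - p 0 + 2 * j - (2 * n + 1) - 2 * n)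
        rcases h5 with h5 | ⟨h5, h6⟩ <;> linarith
  · intro p h1 h2 h3 h4
    rw [closure_reg₁ hj hjn]
    rw [key0 _ h1 h2, max_le_iff] at h3
    refine ⟨h3.1, h1, by linarith, by linarith [h3.2], ?_⟩
    rcases lt_or_ge (p 1 - p 0 + 2 * j) (-n + (2 * n + 1)) with h | h
    · rw [key0 _ (by linarith) h] at h4
      rcases max_cases (-n : ℝ) (p 1 - p 0 + 2 * j - 2 * n) with ⟨h5, -⟩ | ⟨h5, -⟩ <;> rw [h5] at h4
      · left; linarith
      · right; constructor <;> linarith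
    · rw [key1 _ h (by linarith), max_eq_left (by linarith)] at h4
      right; constructor <;> linarith

theorem halfTurn_eq_preimage (a : Pixel) (F : Set Plane) :
    halfTurn a F = (fun x => -x + emb a) ⁻¹' F := by
  rw [halfTurn]
  refine congrFun (image_eq_preimage_of_inverse (g := fun x => -x + emb a) (fun x => ?_) (fun x => ?_)) F <;> simp

theorem mem_halfTurn_iff (a : Pixel) (F : Set Plane) (p : Plane) :
    p ∈ halfTurn a F ↔ -p + emb a ∈ F := by rw [halfTurn_eq_preimage]; rfl

theorem isOpen_halfTurn (a : Pixel) {F : Set Plane} (hF : IsOpen F) : IsOpen (halfTurn a F) := by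
  rw [halfTurn_eq_preimage]
  exact hF.preimage (by fun_prop)

theorem mem_closure_halfTurn (a : Pixel) {F : Set Plane} {p : Plane}
    (hp : -p + emb a ∈ closure F) : p ∈ closure (halfTurn a F) := by
  have hc : Continuous fun x : Plane => -x + emb a := by fun_prop
  have := map_mem_closure (t := halfTurn a F) hc hp fun x hx => mem_image_of_mem _ hx
  simpa using this

theorem mem_halfTurn_reg₂_iff {n j : ℤ} (p : Plane) : p ∈ halfTurn (n, n) (reg₂ n j) ↔
    n < p 0 + p 1 ∧ -(n : ℝ) < p 1 - p 0 ∧ p 1 - p 0 < n ∧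
    ((p 0 + p 1 < 3 * n - 1 ∧ p 0 < 2 * n - 1) ∨ (p 0 + p 1 < 3 * n ∧ p 0 < n + j)) := by
  rw [mem_halfTurn_iff]
  simp only [reg₂, mem_ofPred_eq, PiLp.add_apply, PiLp.neg_apply, emb_apply_zero, emb_apply_one]
  constructor
  · rintro ⟨h1, h2, h3, h4⟩
    exact ⟨by linarith, by linarith, by linarith,
      h4.imp (fun h => ⟨by linarith [h.1], by linarith [h.2]⟩)
        fun h => ⟨by linarith [h.1], by linarith [h.2]⟩⟩
  · rintro ⟨h1, h2, h3, h4⟩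
    exact ⟨by linarith, by linarith, by linarith,
      h4.imp (fun h => ⟨by linarith [h.1], by linarith [h.2]⟩)
        fun h => ⟨by linarith [h.1], by linarith [h.2]⟩⟩

/-- The line x + y = n separates the two. -/
theorem disjoint_reg₂_halfTurn (n j : ℤ) : Disjoint (reg₂ n j) (halfTurn (n, n) (reg₂ n j)) := by
  rw [disjoint_left]
  intro p hp hp'
  rw [mem_halfTurn_reg₂_iff] at hp'
  exact lt_asymm hp.1 hp'.1

theorem tilesByLattice_reg₂ {n j : ℤ} (hj : 1 ≤ j) (hjn : j ≤ n) :
    TilesByLattice (reg₂ n j ∪ halfTurn (n, n) (reg₂ n j))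
      (columnLattice !![n - 1, 2 * n - 1 + j; -n - 1, 2 * n - 1 - j]) := by
  have hj' : (1 : ℝ) ≤ j := by exact_mod_cast hj
  have hjn' : (j : ℝ) ≤ n := by exact_mod_cast hjn
  -- The two alternatives in `reg₂` bound u below by one maximum each; their union turns into the
  -- minimum. Here x > -n + 1 reads u > v - 2n + 2 and x > -j reads u > v - 2j.
  set L₀ : ℝ → ℝ := fun v => min (max (-n + 1) (v - 2 * n + 2)) (max (-n) (v - 2 * j)) with hL₀
  have hH : (0 : ℝ) < 2 * n := by linarith
  have key0 : ∀ v : ℝ, -n ≤ v → v < n → stair (-n) (2 * n) 2 L₀ v =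
      min (max (-n + 1 : ℝ) (v - 2 * n + 2)) (max (-n : ℝ) (v - 2 * j)) := by
    intro v h1 h2
    rw [stair_eq hH 0 (by simpa using h1) (by simp; linarith)]
    simp [hL₀]
  have key1 : ∀ v : ℝ, n ≤ v → v < 3 * n → stair (-n) (2 * n) 2 L₀ v =
      2 + min (max (-n + 1 : ℝ) (v - 2 * n - 2 * n + 2)) (max (-n : ℝ) (v - 2 * n - 2 * j)) := by
    intro v h1 h2
    rw [stair_eq hH 1 (by push_cast; linarith) (by push_cast; linarith)]
    simp [hL₀]
  have hmono : Monotone L₀ := fun v w hvw =>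
    min_le_min (max_le_max le_rfl (by linarith)) (max_le_max le_rfl (by linarith))
  -- `hright` and `hleft` compute the upper boundary, according to whether v + 2j reaches the next
  -- period. It is the upper boundary of the half turn.
  have hright : ∀ v : ℝ, -n ≤ v → v < n → n ≤ v + 2 * j →
      stair (-n) (2 * n) 2 L₀ (v + 2 * j) + (4 * n - 2) = 3 * n := by
    intro v h1 h2 h3
    rw [key1 _ h3 (by linarith), max_eq_left (a := (-n : ℝ)) (by linarith), min_eq_right]
    · ring
    · linarith [le_max_left (-n + 1 : ℝ) (v + 2 * j - 2 * n - 2 * n + 2)]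
  have hleft : ∀ v : ℝ, -n ≤ v → v < n → v + 2 * j < n →
      stair (-n) (2 * n) 2 L₀ (v + 2 * j) = min (max (-n + 1 : ℝ) (v + 2 * j - 2 * n + 2)) v := by
    intro v h1 h2 h3
    rw [key0 _ (by linarith) h3, max_eq_right (a := (-n : ℝ)) (by linarith)]
    simp
  refine tilesByLattice_of_between (L := stair (-n) (2 * n) 2 L₀) (H := 2 * n) (c := 2)
    (W := 4 * n - 2) (s := 2 * j) hH (by linarith) (by linarith)
    (monotone_stair hH zero_le_two hmono ?_) (fun v k => stair_add hH v k) (-n)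
    ((isOpen_reg₂ n j).union (isOpen_halfTurn _ (isOpen_reg₂ n j)))
    (by simp; ring) (by simp; ring) (by simp; ring) (by simp; ring) ?_ ?_
  · simp only [hL₀]
    refine (min_le_left _ _).trans ?_
    rw [max_eq_right (by linarith), max_eq_left (a := (-n : ℝ) + 1) (by linarith),
      max_eq_left (a := (-n : ℝ)) (by linarith), min_eq_right (by linarith)]
    linarith
  · rintro p (hp | hp)
    · obtain ⟨h1, h2, h3, h4⟩ := hp
      refine ⟨h2, by linarith, ?_, ?_⟩
      · rw [key0 _ h2.le h3, min_lt_iff, max_lt_iff, max_lt_iff]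
        exact h4.imp (fun h => ⟨h.1, by linarith [h.2]⟩) fun h => ⟨h.1, by linarith [h.2]⟩
      · rcases lt_or_ge (p 1 - p 0 + 2 * j) n with h | h
        · rw [hleft _ h2.le h3 h]
          have : (-n : ℝ) < min (max (-n + 1 : ℝ) (p 1 - p 0 + 2 * j - 2 * n + 2)) (p 1 - p 0) :=
            lt_min (lt_max_of_lt_left (by linarith)) h2
          linarith
        · rw [hright _ h2.le h3 h]; linarith
    · rw [mem_halfTurn_reg₂_iff] at hp
      obtain ⟨h1, h2, h3, h4⟩ := hp
      refine ⟨h2, by linarith, ?_, ?_⟩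
      · rw [key0 _ h2.le h3]
        refine (min_le_left _ _).trans_lt (max_lt (by linarith) (by linarith))
      · rcases lt_or_ge (p 1 - p 0 + 2 * j) n with h | h
        · rw [hleft _ h2.le h3 h]
          have hjlt : (j : ℝ) ≤ n - 1 := by
            have : (j : ℝ) < n := by linarith
            have : j < n := by exact_mod_cast this
            have : j ≤ n - 1 := by omega
            exact_mod_cast this
          have : p 0 + p 1 - (4 * n - 2) <
              min (max (-n + 1 : ℝ) (p 1 - p 0 + 2 * j - 2 * n + 2)) (p 1 - p 0) := by
            refine lt_min ?_ (by rcases h4 with h4 | h4 <;> linarith)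
            rcases h4 with h4 | h4
            · exact lt_max_of_lt_left (by linarith)
            · exact lt_max_of_lt_right (by linarith)
          linarith
        · rw [hright _ h2.le h3 h]; rcases h4 with h4 | h4 <;> linarith
  · intro p h1 h2 h3 h4
    have h2' : p 1 - p 0 < n := by linarith
    rw [closure_union]
    -- The line x + y = n belongs to neither open piece; it is covered by the closure of the first.
    rcases le_or_gt (p 0 + p 1) n with hu | hu
    · left
      rw [closure_reg₂ hj hjn]
      rw [key0 _ h1 h2', min_le_iff, max_le_iff, max_le_iff] at h3
      exact ⟨hu, h1, h2'.le,
        h3.imp (fun h => ⟨h.1, by linarith [h.2]⟩) fun h => ⟨h.1, by linarith [h.2]⟩⟩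
    · right
      refine mem_closure_halfTurn _ ?_
      rw [closure_reg₂ hj hjn]
      simp only [mem_ofPred_eq, PiLp.add_apply, PiLp.neg_apply, emb_apply_zero, emb_apply_one]
      refine ⟨by linarith, by linarith, by linarith, ?_⟩
      rcases lt_or_ge (p 1 - p 0 + 2 * j) n with h | h
      · rw [hleft _ h1 h2' h, ← sub_le_iff_le_add, le_min_iff, le_max_iff] at h4
        rcases h4 with ⟨h4 | h4, h5⟩
        · left; constructor <;> linarith
        · right; constructor <;> linarith
      · rw [hright _ h1 h2' h] at h4
        right; constructor <;> linarith

/-! ### The hexagon: its pixels, sides and vertices. -/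

/-- The polygonal tile of Sieben's component `𝓓_{ℓ,n}`. -/
def hexagon (l n : ℤ) : Set Plane :=
  {p | -(n : ℝ) < p 0 + p 1 ∧ p 0 + p 1 < 2 * l - n + 1 ∧ -(n : ℝ) < p 1 - p 0 ∧ p 1 - p 0 < n ∧
    p 0 < l ∧ p 1 < l}

theorem isOpen_hexagon (l n : ℤ) : IsOpen (hexagon l n) := by
  refine IsOpen.and ?_ (IsOpen.and ?_ (IsOpen.and ?_ (IsOpen.and ?_ (IsOpen.and ?_ ?_))))
  all_goals exact isOpen_lt (by fun_prop) (by fun_prop)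

theorem closure_hexagon {l n : ℤ} (hl : 1 ≤ l) (hn : 2 ≤ n) : closure (hexagon l n) =
    {p | -(n : ℝ) ≤ p 0 + p 1 ∧ p 0 + p 1 ≤ 2 * (l : ℝ) - n + 1 ∧ -(n : ℝ) ≤ p 1 - p 0 ∧
      p 1 - p 0 ≤ (n : ℝ) ∧ p 0 ≤ (l : ℝ) ∧ p 1 ≤ (l : ℝ)} := by
  have hl' : (1 : ℝ) ≤ l := by exact_mod_cast hl
  have hn' : (2 : ℝ) ≤ n := by exact_mod_cast hn
  refine closure_eq_of_star ?_ ?_ ?_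
  · refine IsClosed.and ?_ (IsClosed.and ?_ (IsClosed.and ?_ (IsClosed.and ?_ (IsClosed.and ?_ ?_))))
    all_goals exact isClosed_le (by fun_prop) (by fun_prop)
  · rintro p ⟨h1, h2, h3, h4, h5, h6⟩
    exact ⟨h1.le, h2.le, h3.le, h4.le, h5.le, h6.le⟩
  · rintro p ⟨h1, h2, h3, h4, h5, h6⟩
    -- The origin need not lie inside the hexagon. This point has x + y = 1 - n and y - x = 0, which
    -- satisfies every inequality strictly because l ≥ 1 and n ≥ 2.
    refine ⟨!₂[(1 - n) / 2, (1 - n) / 2], fun t ht ht1 => ?_⟩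
    simp only [hexagon, mem_ofPred_eq, combo_apply, Matrix.cons_val_zero,
      Matrix.cons_val_one]
    have f : ∀ a b c : ℝ, a ≤ c → b < c → a + t * (b - a) < c :=
      fun a b c ha hc => add_mul_sub_lt ha hc ht ht1
    have g1 := f (-(p 0 + p 1)) (n - 1) n (by linarith) (by linarith)
    have g2 := f (p 0 + p 1) (1 - n) (2 * l - n + 1) (by linarith) (by linarith)
    have g3 := f (-(p 1 - p 0)) 0 n (by linarith) (by linarith)
    have g4 := f (p 1 - p 0) 0 n (by linarith) (by linarith)
    have g5 := f (p 0) ((1 - n) / 2) l (by linarith) (by linarith)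
    have g6 := f (p 1) ((1 - n) / 2) l (by linarith) (by linarith)
    refine ⟨by linarith, by linarith, by linarith, by linarith, by linarith, by linarith⟩

theorem mem_sitePerim_sieben {l n : ℕ} (hl : 1 ≤ l) (hn : 2 ≤ n) (a b : ℤ) :
    (a, b) ∈ sitePerim (sieben l n) ↔
      -n ≤ a + b ∧ a + b ≤ 2 * (l : ℤ) - n + 1 ∧ -n ≤ b - a ∧ b - a ≤ n ∧ a ≤ l ∧ b ≤ l ∧
      (a + b = -n ∨ a + b = 2 * l - n + 1 ∨ b - a = -n ∨ b - a = n) := by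
  rw [mem_sitePerim_iff]
  simp only [sieben, mem_ofPred_eq]
  omega

theorem extPerim_sieben {l n : ℕ} (hl : 1 ≤ l) (hn : 2 ≤ n) :
    extPerim (sieben l n) = sitePerim (sieben l n) := by
  refine extPerim_eq_sitePerim ?_
  rintro ⟨a, b⟩ hz
  simp only [mem_sitePerim_sieben hl hn] at hz ⊢
  rcases hz.2.2.2.2.2.2 with h | h | h | h
  · exact ⟨(-1, 0), by simp [d4], fun k hk => by omega⟩
  · exact ⟨(1, 0), by simp [d4], fun k hk => by omega⟩
  · exact ⟨(0, -1), by simp [d4], fun k hk => by omega⟩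
  · exact ⟨(0, 1), by simp [d4], fun k hk => by omega⟩

set_option maxHeartbeats 1000000 in
theorem sieben_edge {l n : ℕ} {a b c d : ℤ} (hl : 1 ≤ l) (hn : 2 ≤ n)
    (hc : -1 ≤ c) (hc1 : c ≤ 1)
    (hd : -1 ≤ d) (hd1 : d ≤ 1) (hcd : c ≠ 0 ∨ d ≠ 0)
    (hp : (a, b) ∈ sitePerim (sieben l n)) (hq : (a + c, b + d) ∈ sitePerim (sieben l n)) :
    (a + b ≤ -n ∧ a + b + (c + d) ≤ -n) ∨
      (2 * (l : ℤ) - n + 1 ≤ a + b ∧ 2 * (l : ℤ) - n + 1 ≤ a + b + (c + d)) ∨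
      (b - a ≤ -n ∧ b - a + (d - c) ≤ -n) ∨ (n ≤ b - a ∧ n ≤ b - a + (d - c)) ∨
      (l ≤ a ∧ l ≤ a + c) ∨ (l ≤ b ∧ l ≤ b + d) := by
  rw [mem_sitePerim_sieben hl hn] at hp hq
  obtain ⟨p1, p2, p3, p4, p5, p6, p7⟩ := hp
  obtain ⟨q1, q2, q3, q4, q5, q6, q7⟩ := hq
  have hc' : c = -1 ∨ c = 0 ∨ c = 1 := by omega
  have hd' : d = -1 ∨ d = 0 ∨ d = 1 := by omega
  rcases hc' with rfl | rfl | rfl <;> rcases hd' with rfl | rfl | rfl <;>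
    rcases p7 with p6 | p6 | p6 | p6 <;> rcases q7 with q6 | q6 | q6 | q6 <;> omega

theorem extCurve_sieben_subset {l n : ℕ} (hl : 1 ≤ l) (hn : 2 ≤ n) :
    extCurve (sieben l n) ⊆ closure (hexagon l n) \ hexagon l n := by
  have hT := extPerim_sieben hl hn
  rw [closure_hexagon (by omega) (by omega)]
  refine extCurve_subset hT ?_
  intro a b c d hp hq hc hc1 hd hd1 hcd t x ht ht1 h0 h1
  have k6 := sieben_edge hl hn hc hc1 hd hd1 hcd hp hq
  rw [mem_sitePerim_sieben hl hn] at hp hq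
  obtain ⟨p1, p2, p3, p4, p5, p6, -⟩ := hp
  obtain ⟨q1, q2, q3, q4, q5, q6, -⟩ := hq
  have r1 : -n ≤ a + b + (c + d) := by omega
  have r2 : a + b + (c + d) ≤ 2 * (l : ℤ) - n + 1 := by omega
  have r3 : -n ≤ b - a + (d - c) := by omega
  have r4 : b - a + (d - c) ≤ n := by omega
  rify at p1 p2 p3 p4 p5 p6 q5 q6 r1 r2 r3 r4 k6
  have e1 : x 0 + x 1 = (a + b : ℝ) + t * (c + d) := by rw [h0, h1]; ring
  have e2 : x 1 - x 0 = (b - a : ℝ) + t * (d - c) := by rw [h0, h1]; ring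
  simp only [hexagon, mem_sdiff, mem_ofPred_eq, Int.cast_natCast]
  rw [e1, e2, h0, h1]
  refine ⟨⟨le_add_mul p1 r1 ht ht1, add_mul_le p2 r2 ht ht1, le_add_mul p3 r3 ht ht1,
    add_mul_le p4 r4 ht ht1, add_mul_le p5 q5 ht ht1, add_mul_le p6 q6 ht ht1⟩, ?_⟩
  rintro ⟨s1, s2, s3, s4, s5, s6⟩
  rcases k6 with ⟨k, k'⟩ | ⟨k, k'⟩ | ⟨k, k'⟩ | ⟨k, k'⟩ | ⟨k, k'⟩ | ⟨k, k'⟩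
  · exact s1.not_ge (add_mul_le k k' ht ht1)
  · exact s2.not_ge (le_add_mul k k' ht ht1)
  · exact s3.not_ge (add_mul_le k k' ht ht1)
  · exact s4.not_ge (le_add_mul k k' ht ht1)
  · exact s5.not_ge (le_add_mul k k' ht ht1)
  · exact s6.not_ge (le_add_mul k k' ht ht1)

theorem subset_extCurve_sieben {l n : ℕ} (hl : 1 ≤ l) (hn : 2 ≤ n) :
    closure (hexagon l n) \ hexagon l n ⊆ extCurve (sieben l n) := by
  have hT := extPerim_sieben hl hn
  have hl' : (1 : ℝ) ≤ l := by exact_mod_cast hl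
  have hn' : (2 : ℝ) ≤ n := by exact_mod_cast hn
  rw [closure_hexagon (by omega) (by omega)]
  simp only [hexagon, Int.cast_natCast]
  rintro x ⟨⟨h1, h2, h3, h4, h5, h6⟩, hx⟩
  have hx' : x 0 + x 1 = -n ∨ x 0 + x 1 = 2 * l - n + 1 ∨ x 1 - x 0 = -n ∨ x 1 - x 0 = n ∨
      x 0 = l ∨ x 1 = l := by
    by_contra hcon
    simp only [not_or] at hcon
    obtain ⟨c1, c2, c3, c4, c5, c6⟩ := hcon
    exact hx ⟨lt_of_le_of_ne h1 (Ne.symm c1), lt_of_le_of_ne h2 c2, lt_of_le_of_ne h3 (Ne.symm c3),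
      lt_of_le_of_ne h4 c4, lt_of_le_of_ne h5 c5, lt_of_le_of_ne h6 c6⟩
  rcases hx' with h | h | h | h | h | h
  · refine mem_extCurve_of_run hT (a := 0) (b := -n) (-1) 1 n (by simp [d8]) (by omega) ?_ (-x 0) ?_ ?_ ?_ ?_
    · intro i hi him; rw [mem_sitePerim_sieben hl hn]; omega
    all_goals push_cast; linarith
  · refine mem_extCurve_of_run hT (a := l - n + 1) (b := l) 1 (-1) (n - 1) (by simp [d8]) (by omega) ?_ (x 0 - (l - n + 1)) ?_ ?_ ?_ ?_
    · intro i hi him; rw [mem_sitePerim_sieben hl hn]; omega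
    all_goals push_cast; linarith
  · refine mem_extCurve_of_run hT (a := 0) (b := -n) 1 1 l (by simp [d8]) (by omega) ?_ (x 0) ?_ ?_ ?_ ?_
    · intro i hi him; rw [mem_sitePerim_sieben hl hn]; omega
    all_goals push_cast; linarith
  · refine mem_extCurve_of_run hT (a := -n) (b := 0) 1 1 l (by simp [d8]) (by omega) ?_ (x 1) ?_ ?_ ?_ ?_
    · intro i hi him; rw [mem_sitePerim_sieben hl hn]; omega
    all_goals push_cast; linarith
  · refine mem_extCurve_of_run hT (a := l) (b := l - n) 0 1 1 (by simp [d8]) (by omega) ?_ (x 1 - (l - n)) ?_ ?_ ?_ ?_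
    · intro i hi him; rw [mem_sitePerim_sieben hl hn]; omega
    all_goals push_cast; linarith
  · refine mem_extCurve_of_run hT (a := l - n) (b := l) 1 0 1 (by simp [d8]) (by omega) ?_ (x 0 - (l - n)) ?_ ?_ ?_ ?_
    · intro i hi him; rw [mem_sitePerim_sieben hl hn]; omega
    all_goals push_cast; linarith

theorem isBounded_hexagon {l n : ℤ} (hl : 1 ≤ l) (hn : 2 ≤ n) :
    Bornology.IsBounded (hexagon l n) := by
  have hl' : (1 : ℝ) ≤ l := by exact_mod_cast hl
  have hn' : (2 : ℝ) ≤ n := by exact_mod_cast hn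
  refine isBounded_of_coord (2 * n + 2 * l) ?_
  rintro p ⟨h1, h2, h3, h4, h5, h6⟩
  constructor <;> rw [abs_le] <;> constructor <;> linarith

theorem polygonalTile_sieben {l n : ℕ} (hl : 1 ≤ l) (hn : 2 ≤ n) :
    polygonalTile (sieben l n) = hexagon l n := by
  refine polygonalTile_eq (isOpen_hexagon l n) (isBounded_hexagon (by omega) (by omega))
    (Subset.antisymm (extCurve_sieben_subset hl hn) (subset_extCurve_sieben hl hn)) ?_ ?_
  · intro x hx
    rw [closure_hexagon (by omega) (by omega)] at hx ⊢
    simp only [mem_ofPred_eq, ray_apply] at hx ⊢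
    rcases lt_or_ge (x 0 + x 1) (-(n : ℤ)) with h1 | h1
    · exact ⟨!₂[-1, -1], vec_ne_zero (by norm_num), fun t ht h => by simp at h h1; linarith [h.1]⟩
    rcases lt_or_ge (2 * (l : ℤ) - (n : ℤ) + 1 : ℝ) (x 0 + x 1) with h2 | h2
    · exact ⟨!₂[1, 1], vec_ne_zero (by norm_num), fun t ht h => by simp at h h2; linarith [h.2.1]⟩
    rcases lt_or_ge (x 1 - x 0) (-(n : ℤ)) with h3 | h3
    · exact ⟨!₂[1, -1], vec_ne_zero (by norm_num), fun t ht h => by simp at h h3; linarith [h.2.2.1]⟩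
    rcases lt_or_ge ((n : ℤ) : ℝ) (x 1 - x 0) with h4 | h4
    · exact ⟨!₂[-1, 1], vec_ne_zero (by norm_num), fun t ht h => by simp at h h4; linarith [h.2.2.2.1]⟩
    rcases lt_or_ge ((l : ℤ) : ℝ) (x 0) with h5 | h5
    · exact ⟨!₂[1, 0], vec_ne_zero (by norm_num), fun t ht h => by simp at h h5; linarith [h.2.2.2.2.1]⟩
    rcases lt_or_ge ((l : ℤ) : ℝ) (x 1) with h6 | h6
    · exact ⟨!₂[0, 1], vec_ne_zero (by norm_num), fun t ht h => by simp at h h6; linarith [h.2.2.2.2.2]⟩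
    exact absurd ⟨h1, h2, h3, h4, h5, h6⟩ hx
  · rintro ⟨a, b⟩ h
    simp only [hexagon, mem_ofPred_eq, emb_apply_zero, emb_apply_one] at h
    simp only [sieben, mem_ofPred_eq]
    obtain ⟨h1, h2, h3, h4, -, -⟩ := h
    have h2' : (a : ℝ) + b + (n : ℤ) < 2 * (l : ℤ) + 1 := by linarith
    norm_cast at h1 h2' h3 h4
    omega

/-- The vertices of `hexagon l n` in clockwise order. -/
noncomputable def hexVertex (l n : ℤ) : Fin 6 → Plane :=
  ![!₂[0, -(n : ℝ)], !₂[-(n : ℝ), 0], !₂[(l : ℝ) - n, l], !₂[(l : ℝ) - n + 1, l],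
    !₂[(l : ℝ), l - n + 1], !₂[(l : ℝ), l - n]]

theorem convex_linear_lt (a b c : ℝ) : Convex ℝ {p : Plane | a * p 0 + b * p 1 < c} := by
  refine convex_halfSpace_lt (f := fun p : Plane => a * p 0 + b * p 1) ⟨fun x y => ?_, fun t x => ?_⟩ c
  · simp; ring
  · simp; ring

theorem convex_hexagon (l n : ℤ) : Convex ℝ (hexagon l n) := by
  have : hexagon l n = {p : Plane | -1 * p 0 + -1 * p 1 < (n : ℝ)} ∩
      ({p : Plane | 1 * p 0 + 1 * p 1 < (2 * l - n + 1 : ℝ)} ∩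
      ({p : Plane | 1 * p 0 + -1 * p 1 < (n : ℝ)} ∩ ({p : Plane | -1 * p 0 + 1 * p 1 < (n : ℝ)} ∩
      ({p : Plane | 1 * p 0 + 0 * p 1 < (l : ℝ)} ∩ {p : Plane | 0 * p 0 + 1 * p 1 < (l : ℝ)})))) := by
    ext p
    simp only [hexagon, mem_ofPred_eq, mem_inter_iff]
    constructor
    · rintro ⟨h1, h2, h3, h4, h5, h6⟩
      refine ⟨?_, ?_, ?_, ?_, ?_, ?_⟩ <;> linarith
    · rintro ⟨h1, h2, h3, h4, h5, h6⟩
      refine ⟨?_, ?_, ?_, ?_, ?_, ?_⟩ <;> linarith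
  rw [this]
  exact (convex_linear_lt _ _ _).inter ((convex_linear_lt _ _ _).inter ((convex_linear_lt _ _ _).inter
    ((convex_linear_lt _ _ _).inter ((convex_linear_lt _ _ _).inter (convex_linear_lt _ _ _)))))

theorem convexIndependent_hexVertex {l n : ℤ} (hl : 1 ≤ l) (hn : 2 ≤ n) :
    ConvexIndependent ℝ (hexVertex l n) := by
  have hl' : (1 : ℝ) ≤ l := by exact_mod_cast hl
  have hn' : (2 : ℝ) ≤ n := by exact_mod_cast hn
  rw [convexIndependent_iff_notMem_convexHull_sdiff]
  intro i s hi
  -- Each vertex is the unique maximiser of a linear functional, taken strictly between the outer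
  -- normals of its two sides.
  have key : ∃ a b : ℝ, ∀ k, k ≠ i → a * hexVertex l n k 0 + b * hexVertex l n k 1 <
      a * hexVertex l n i 0 + b * hexVertex l n i 1 := by
    fin_cases i
    · refine ⟨0, -1, fun k hk => ?_⟩
      fin_cases k <;> simp [hexVertex] at hk ⊢ <;> linarith
    · refine ⟨-1, 0, fun k hk => ?_⟩
      fin_cases k <;> simp [hexVertex] at hk ⊢ <;> linarith
    · refine ⟨-1, 3, fun k hk => ?_⟩
      fin_cases k <;> simp [hexVertex] at hk ⊢ <;> linarith
    · refine ⟨1, 3, fun k hk => ?_⟩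
      fin_cases k <;> simp [hexVertex] at hk ⊢ <;> linarith
    · refine ⟨3, 1, fun k hk => ?_⟩
      fin_cases k <;> simp [hexVertex] at hk ⊢ <;> linarith
    · refine ⟨3, -1, fun k hk => ?_⟩
      fin_cases k <;> simp [hexVertex] at hk ⊢ <;> linarith
  obtain ⟨a, b, h⟩ := key
  have hsub := convexHull_min (s := hexVertex l n '' (s \ {i})) (t := {p : Plane | a * p 0 + b * p 1 <
    a * hexVertex l n i 0 + b * hexVertex l n i 1}) (by
      rintro _ ⟨k, hk, rfl⟩
      exact h k hk.2) (convex_linear_lt _ _ _)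
  exact (lt_irrefl (a * hexVertex l n i 0 + b * hexVertex l n i 1)) (hsub hi)

theorem hexVertex_mem_closure {l n : ℤ} (hl : 1 ≤ l) (hn : 2 ≤ n) (i : Fin 6) :
    hexVertex l n i ∈ closure (hexagon l n) := by
  have hl' : (1 : ℝ) ≤ l := by exact_mod_cast hl
  have hn' : (2 : ℝ) ≤ n := by exact_mod_cast hn
  rw [closure_hexagon hl hn]
  simp only [mem_ofPred_eq]
  fin_cases i <;> refine ⟨?_, ?_, ?_, ?_, ?_, ?_⟩ <;> simp [hexVertex] <;> linarith

theorem convexHull_hexVertex {l n : ℤ} (hl : 1 ≤ l) (hn : 2 ≤ n) :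
    convexHull ℝ (range (hexVertex l n)) = closure (hexagon l n) := by
  have hl' : (1 : ℝ) ≤ l := by exact_mod_cast hl
  have hn' : (2 : ℝ) ≤ n := by exact_mod_cast hn
  refine Subset.antisymm (convexHull_min ?_ (convex_hexagon l n).closure) ?_
  · rintro _ ⟨i, rfl⟩
    exact hexVertex_mem_closure hl hn i
  · rw [closure_hexagon hl hn]
    rintro x ⟨h1, h2, h3, h4, h5, h6⟩
    have hc := convex_convexHull ℝ (range (hexVertex l n))
    have hm : ∀ i, hexVertex l n i ∈ convexHull ℝ (range (hexVertex l n)) := fun i =>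
      subset_convexHull ℝ _ (mem_range_self i)
    -- The diagonal between vertices 2 and 5 cuts the hexagon into a rectangle and a trapezoid. In
    -- each, s is the position across in the direction of x + y and r the position along the
    -- resulting chord.
    rcases le_or_gt (x 0 + x 1) (2 * l - n) with hu | hu
    · have hs : (x 0 + x 1 + n) / (2 * l) ∈ Icc (0 : ℝ) 1 := by
        constructor
        · apply div_nonneg <;> linarith
        · rw [div_le_one (by linarith)]; linarith
      have hr : (x 1 - x 0 + n) / (2 * n) ∈ Icc (0 : ℝ) 1 := by
        constructor
        · apply div_nonneg <;> linarith
        · rw [div_le_one (by linarith)]; linarith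
      have q1 := hc.add_smul_sub_mem (hm 0) (hm 5) hs
      have q2 := hc.add_smul_sub_mem (hm 1) (hm 2) hs
      convert hc.add_smul_sub_mem q1 q2 hr using 1
      refine plane_ext ?_ ?_
      · simp [hexVertex]; field_simp; ring
      · simp [hexVertex]; field_simp; ring
    · obtain ⟨s, hs_def⟩ : ∃ s, s = x 0 + x 1 - (2 * l - n) := ⟨_, rfl⟩
      have hs : s ∈ Icc (0 : ℝ) 1 := ⟨by linarith, by linarith⟩
      have hd : (0 : ℝ) < 2 * n - 2 * s := by linarith [hs.2]
      obtain ⟨r, hr_def⟩ : ∃ r, r = (x 1 - x 0 + n - s) / (2 * n - 2 * s) := ⟨_, rfl⟩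
      have hr : r ∈ Icc (0 : ℝ) 1 := by
        rw [hr_def]
        constructor
        · apply div_nonneg <;> linarith
        · rw [div_le_one hd]; linarith
      rw [eq_div_iff hd.ne'] at hr_def
      have q1 := hc.add_smul_sub_mem (hm 5) (hm 4) hs
      have q2 := hc.add_smul_sub_mem (hm 2) (hm 3) hs
      convert hc.add_smul_sub_mem q1 q2 hr using 1
      refine plane_ext ?_ ?_
      · simp [hexVertex]; linear_combination (1 / 2) * hr_def - (1 / 2) * hs_def
      · simp [hexVertex]; linear_combination (-1 / 2) * hr_def - (1 / 2) * hs_def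

theorem isOpenConvexHexagon_hexagon {l n : ℤ} (hl : 1 ≤ l) (hn : 2 ≤ n) :
    IsOpenConvexHexagon (hexagon l n) := by
  refine ⟨hexVertex l n, convexIndependent_hexVertex hl hn, ?_⟩
  rw [convexHull_hexVertex hl hn]
  have ho := isOpen_hexagon l n
  have hne : (hexagon l n).Nonempty := by
    rw [← closure_nonempty_iff]; exact ⟨_, hexVertex_mem_closure hl hn 0⟩
  rw [(convex_hexagon l n).interior_closure_eq_interior_of_nonempty_interior
    (by rwa [ho.interior_eq]), ho.interior_eq]

/-! ### Angles as area densities in small disks. -/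

open MeasureTheory Metric Topology

/-- Hausdorff measure is visibly invariant under isometries, and in the plane it is Lebesgue measure
after normalisation. -/
theorem volume_isometry_image (g : Plane ≃ᵢ Plane) (X : Set Plane) :
    volume (g '' X) = volume X := by
  rw [← EuclideanSpace.euclideanHausdorffMeasure_eq_volume 2]
  exact g.isometry.euclideanHausdorffMeasure_image X

/-- In all sufficiently small disks around `p`, the set `X` takes up `k` eighths of the area. -/
def HasDensity (X : Set Plane) (p : Plane) (k : ℕ) : Prop :=
  ∃ r₀ > 0, ∀ r, 0 < r → r ≤ r₀ → 8 * volume (X ∩ ball p r) = k * volume (ball p r)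

theorem volume_ball_ne_zero {p : Plane} {r : ℝ} (hr : 0 < r) : volume (ball p r) ≠ 0 :=
  (measure_ball_pos volume p hr).ne'

theorem volume_ball_ne_top {p : Plane} {r : ℝ} : volume (ball p r) ≠ ⊤ := measure_ball_lt_top.ne

theorem HasDensity.unique {X : Set Plane} {p : Plane} {k m : ℕ} (hk : HasDensity X p k)
    (hm : HasDensity X p m) : k = m := by
  obtain ⟨r, hr, h⟩ := hk
  obtain ⟨s, hs, h'⟩ := hm
  have e1 := h (min r s) (lt_min hr hs) (min_le_left _ _)
  rw [h' (min r s) (lt_min hr hs) (min_le_right _ _)] at e1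
  have := (ENNReal.mul_left_inj (volume_ball_ne_zero (lt_min hr hs)) volume_ball_ne_top).1 e1
  exact_mod_cast this.symm

theorem HasDensity.image {X : Set Plane} {p : Plane} {k : ℕ} (h : HasDensity X p k)
    (g : Plane ≃ᵢ Plane) : HasDensity (g '' X) (g p) k := by
  obtain ⟨r₀, hr₀, h⟩ := h
  refine ⟨r₀, hr₀, fun r hr hrr => ?_⟩
  rw [← g.image_ball, ← image_inter g.injective, volume_isometry_image, volume_isometry_image,
    h r hr hrr]

theorem HasDensity.congr {X Y : Set Plane} {p : Plane} {k : ℕ} (h : HasDensity Y p k)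
    (hXY : ∀ᶠ x in 𝓝 p, x ∈ X ↔ x ∈ Y) : HasDensity X p k := by
  obtain ⟨r₀, hr₀, h⟩ := h
  obtain ⟨ε, hε, hb⟩ := Metric.eventually_nhds_iff_ball.1 hXY
  refine ⟨min r₀ ε, lt_min hr₀ hε, fun r hr hrr => ?_⟩
  have : X ∩ ball p r = Y ∩ ball p r := by
    ext x
    refine and_congr_left fun hx => hb x (ball_subset_ball (hrr.trans (min_le_right _ _)) hx)
  rw [this, h r hr (hrr.trans (min_le_left _ _))]

theorem hasDensity_univ (p : Plane) : HasDensity univ p 8 :=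
  ⟨1, one_pos, fun r _ _ => by simp⟩

theorem hasDensity_empty (p : Plane) : HasDensity ∅ p 0 :=
  ⟨1, one_pos, fun r _ _ => by simp⟩

/-- The line lies in the frontier of a half-plane, and convex sets have null frontier. -/
theorem volume_linear_eq_zero {a b : ℝ} (h : a ≠ 0 ∨ b ≠ 0) :
    volume {x : Plane | a * x 0 + b * x 1 = 0} = 0 := by
  have hf := (convex_linear_lt a b 0).addHaar_frontier (volume : Measure Plane)
  refine measure_mono_null (fun x hx => ?_) hf
  simp only [mem_ofPred_eq] at hx
  rw [(isOpen_lt (by fun_prop) (by fun_prop) : IsOpen {p : Plane | a * p 0 + b * p 1 < 0}).frontier_eq]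
  refine ⟨?_, by simp [hx]⟩
  have hcl : closure {p : Plane | a * p 0 + b * p 1 < 0} = {p : Plane | a * p 0 + b * p 1 ≤ 0} := by
    refine closure_eq_of_star (isClosed_le (by fun_prop) (by fun_prop))
      (fun p (hp : a * p 0 + b * p 1 < 0) => hp.le) fun y hy => ?_
    refine ⟨!₂[-a, -b], fun t ht ht1 => ?_⟩
    simp only [mem_ofPred_eq, combo_apply, Matrix.cons_val_zero, Matrix.cons_val_one] at hy ⊢
    have h2 : a * (-a) + b * (-b) < 0 := by
      rcases h with h | h
      · nlinarith [sq_pos_of_ne_zero h, sq_nonneg b]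
      · nlinarith [sq_pos_of_ne_zero h, sq_nonneg a]
    have := add_mul_sub_lt hy h2 ht ht1
    linarith
  rw [hcl]
  exact hx.le

/-- A set with density `2k` at the origin that is symmetric about a line under an isometry fixing
the origin is cut by the line in two parts of density `k`. -/
theorem HasDensity.half {Y : Set Plane} {k : ℕ} (hY : HasDensity Y 0 (2 * k)) (a b : ℝ)
    (hab : a ≠ 0 ∨ b ≠ 0) (σ : Plane ≃ᵢ Plane) (hσ0 : σ 0 = 0) (hσY : ∀ x ∈ Y, σ x ∈ Y)
    (hσY' : ∀ x, σ x ∈ Y → x ∈ Y)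
    (hσ : ∀ x, a * σ x 0 + b * σ x 1 = -(a * x 0 + b * x 1)) :
    HasDensity (Y ∩ {x | a * x 0 + b * x 1 < 0}) 0 k := by
  obtain ⟨r₀, hr₀, h⟩ := hY
  refine ⟨r₀, hr₀, fun r hr hrr => ?_⟩
  have hY := h r hr hrr
  set P := Y ∩ {x | a * x 0 + b * x 1 < 0} ∩ ball 0 r with hP
  set N := (Y ∩ ball 0 r) \ {x | a * x 0 + b * x 1 < 0} with hN
  have hmeas : MeasurableSet {x : Plane | a * x 0 + b * x 1 < 0} :=
    (isOpen_lt (by fun_prop) (by fun_prop)).measurableSet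
  have hsplit : volume (Y ∩ ball 0 r) = volume P + volume N := by
    rw [← measure_inter_add_sdiff (Y ∩ ball 0 r) hmeas, hP, inter_right_comm]
  have hball : ∀ x, σ x ∈ ball (0 : Plane) r ↔ x ∈ ball (0 : Plane) r := by
    intro x
    rw [mem_ball, mem_ball]
    nth_rw 1 [← hσ0]
    rw [σ.dist_eq]
  have hNP : volume N = volume P := by
    rw [← volume_isometry_image σ P]
    refine le_antisymm ?_ (measure_mono ?_)
    · have : N ⊆ σ '' P ∪ {x | a * x 0 + b * x 1 = 0} := by
        rintro x ⟨⟨hxY, hxb⟩, hx⟩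
        simp only [mem_ofPred_eq, not_lt] at hx
        rcases hx.eq_or_lt with h0 | h0
        · exact Or.inr h0.symm
        · refine Or.inl ⟨σ.symm x, ⟨⟨hσY' _ (by simpa using hxY), ?_⟩, ?_⟩, by simp⟩
          · have := hσ (σ.symm x)
            simp only [IsometryEquiv.apply_symm_apply] at this
            simp only [mem_ofPred_eq]
            linarith
          · rw [← hball]; simpa using hxb
      refine (measure_mono this).trans ((measure_union_le _ _).trans ?_)
      rw [volume_linear_eq_zero hab, add_zero]
    · rintro _ ⟨x, ⟨⟨hxY, hx⟩, hxb⟩, rfl⟩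
      refine ⟨⟨hσY x hxY, (hball x).2 hxb⟩, ?_⟩
      simp only [mem_ofPred_eq, hσ] at hx ⊢
      linarith
  rw [hsplit, hNP, ← two_mul] at hY
  have h2 : (2 : ENNReal) * (8 * volume P) = 2 * (k * volume (ball (0 : Plane) r)) := by
    rw [← mul_assoc, mul_comm (2 : ENNReal) 8, mul_assoc, hY]
    push_cast
    rw [mul_assoc]
  exact (ENNReal.mul_right_inj two_ne_zero ENNReal.ofNat_ne_top).1 h2

theorem HasDensity.sdiff {X Y : Set Plane} {p : Plane} {k m : ℕ} (hX : HasDensity X p (k + m))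
    (hY : HasDensity Y p m) (hYX : Y ⊆ X) (hm : MeasurableSet Y) : HasDensity (X \ Y) p k := by
  obtain ⟨r, hr, h⟩ := hX
  obtain ⟨s, hs, h'⟩ := hY
  refine ⟨min r s, lt_min hr hs, fun t ht htt => ?_⟩
  have e1 := h t ht (htt.trans (min_le_left _ _))
  have e2 := h' t ht (htt.trans (min_le_right _ _))
  rw [← measure_inter_add_sdiff (X ∩ ball p t) hm, inter_right_comm, inter_eq_right.2 hYX,
    ← sdiff_inter_right_comm, mul_add, e2] at e1
  have hfin : (m : ENNReal) * volume (ball p t) ≠ ⊤ :=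
    ENNReal.mul_ne_top (ENNReal.natCast_ne_top m) volume_ball_ne_top
  have : (m : ENNReal) * volume (ball p t) + 8 * volume (X \ Y ∩ ball p t) =
      m * volume (ball p t) + k * volume (ball p t) := by
    rw [e1]; push_cast; ring
  exact (ENNReal.add_right_inj hfin).1 this

theorem HasDensity.union {X Y : Set Plane} {p : Plane} {k m : ℕ} (hX : HasDensity X p k)
    (hY : HasDensity Y p m) (hXY : Disjoint X Y) (hm : MeasurableSet Y) :
    HasDensity (X ∪ Y) p (k + m) := by
  obtain ⟨r, hr, h⟩ := hX
  obtain ⟨s, hs, h'⟩ := hY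
  refine ⟨min r s, lt_min hr hs, fun t ht htt => ?_⟩
  have e1 := h t ht (htt.trans (min_le_left _ _))
  have e2 := h' t ht (htt.trans (min_le_right _ _))
  rw [union_inter_distrib_right, measure_union (hXY.mono inter_subset_left inter_subset_left)
    (hm.inter measurableSet_ball), mul_add, e1, e2]
  push_cast
  ring

/-- The isometry of the plane given by an orthogonal symmetric matrix. -/
noncomputable def planeIsometry (a b d : ℝ) (h1 : a * a + b * b = 1) (h2 : b * b + d * d = 1)
    (h3 : a * b + b * d = 0) : Plane ≃ᵢ Plane :=
  IsometryEquiv.mk' (fun x => !₂[a * x 0 + b * x 1, b * x 0 + d * x 1])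
    (fun x => !₂[a * x 0 + b * x 1, b * x 0 + d * x 1])
    (fun x => by
      refine plane_ext ?_ ?_
      · simp; linear_combination x 0 * h1 + x 1 * h3
      · simp; linear_combination x 1 * h2 + x 0 * h3)
    (Isometry.of_dist_eq fun x y => by
      rw [EuclideanSpace.dist_eq, EuclideanSpace.dist_eq]
      congr 1
      simp only [Fin.sum_univ_two, Real.dist_eq, sq_abs, Matrix.cons_val_zero, Matrix.cons_val_one]
      linear_combination (x 0 - y 0) ^ 2 * h1 + (x 1 - y 1) ^ 2 * h2 +
        2 * (x 0 - y 0) * (x 1 - y 1) * h3)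

theorem planeIsometry_apply_zero {a b d : ℝ} (h1 h2 h3) (x : Plane) :
    planeIsometry a b d h1 h2 h3 x 0 = a * x 0 + b * x 1 := rfl

theorem planeIsometry_apply_one {a b d : ℝ} (h1 h2 h3) (x : Plane) :
    planeIsometry a b d h1 h2 h3 x 1 = b * x 0 + d * x 1 := rfl

theorem planeIsometry_zero {a b d : ℝ} (h1 h2 h3) : planeIsometry a b d h1 h2 h3 0 = 0 :=
  plane_ext (by simp [planeIsometry_apply_zero]) (by simp [planeIsometry_apply_one])

theorem HasDensity.translate {Y : Set Plane} {k : ℕ} (h : HasDensity Y 0 k) (p : Plane) :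
    HasDensity {x | x - p ∈ Y} p k := by
  have := h.image (IsometryEquiv.addRight p)
  simp only [IsometryEquiv.addRight_apply, zero_add] at this
  convert this using 1
  ext x
  simp only [mem_ofPred_eq, mem_image]
  constructor
  · exact fun hx => ⟨_, hx, by simp⟩
  · rintro ⟨y, hy, rfl⟩; simpa using hy

theorem hasDensity_halfPlane {a b : ℝ} (hab : a ≠ 0 ∨ b ≠ 0) :
    HasDensity {x : Plane | a * x 0 + b * x 1 < 0} 0 4 := by
  have h : HasDensity (univ : Set Plane) 0 (2 * 4) := hasDensity_univ 0
  have := h.half a b hab (planeIsometry (-1) 0 (-1) (by norm_num) (by norm_num) (by norm_num))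
    (planeIsometry_zero _ _ _) (fun _ _ => trivial) (fun _ _ => trivial) fun x => by
      rw [planeIsometry_apply_zero, planeIsometry_apply_one]; ring
  rwa [univ_inter] at this

theorem measurableSet_linear_lt (a b c : ℝ) :
    MeasurableSet {x : Plane | a * x 0 + b * x 1 < c} :=
  (isOpen_lt (by fun_prop) (by fun_prop)).measurableSet

/-- The reflection in the diagonal. -/
noncomputable def planeSwap : Plane ≃ᵢ Plane :=
  planeIsometry 0 1 0 (by norm_num) (by norm_num) (by norm_num)

/-- The reflection in the vertical axis. -/
noncomputable def planeFlip : Plane ≃ᵢ Plane :=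
  planeIsometry (-1) 0 1 (by norm_num) (by norm_num) (by norm_num)

theorem planeSwap_apply_zero (x : Plane) : planeSwap x 0 = x 1 := by
  simp [planeSwap, planeIsometry_apply_zero]

theorem planeSwap_apply_one (x : Plane) : planeSwap x 1 = x 0 := by
  simp [planeSwap, planeIsometry_apply_one]

theorem planeFlip_apply_zero (x : Plane) : planeFlip x 0 = -x 0 := by
  simp [planeFlip, planeIsometry_apply_zero]

theorem planeFlip_apply_one (x : Plane) : planeFlip x 1 = x 1 := by
  simp [planeFlip, planeIsometry_apply_one]

theorem HasDensity.image_involution {X Y : Set Plane} {k : ℕ} (h : HasDensity X 0 k)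
    {σ : Plane ≃ᵢ Plane} (hσ0 : σ 0 = 0) (hσ : ∀ x, σ (σ x) = x) (hY : ∀ x, x ∈ Y ↔ σ x ∈ X) :
    HasDensity Y 0 k := by
  have := h.image σ
  rw [hσ0] at this
  convert this using 1
  ext x
  rw [hY]
  constructor
  · exact fun hx => ⟨_, hx, hσ x⟩
  · rintro ⟨y, hy, rfl⟩; rwa [hσ]

theorem planeSwap_zero : planeSwap 0 = 0 := planeIsometry_zero _ _ _

theorem planeFlip_zero : planeFlip 0 = 0 := planeIsometry_zero _ _ _

theorem planeSwap_planeSwap (x : Plane) : planeSwap (planeSwap x) = x :=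
  plane_ext (by rw [planeSwap_apply_zero, planeSwap_apply_one])
    (by rw [planeSwap_apply_one, planeSwap_apply_zero])

theorem planeFlip_planeFlip (x : Plane) : planeFlip (planeFlip x) = x :=
  plane_ext (by rw [planeFlip_apply_zero, planeFlip_apply_zero, neg_neg])
    (by rw [planeFlip_apply_one, planeFlip_apply_one])

/-- Swapping the coordinates exchanges the two halves of the half-plane x + y > 0; the sign of c
selects the half. -/
theorem hasDensity_diagonalQuadrant (c : ℝ) (hc : c ≠ 0) :
    HasDensity ({x : Plane | -1 * x 0 + -1 * x 1 < 0} ∩ {x | c * x 0 + -c * x 1 < 0}) 0 2 := by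
  have h : HasDensity {x : Plane | -1 * x 0 + -1 * x 1 < 0} 0 (2 * 2) :=
    hasDensity_halfPlane (Or.inl (by norm_num))
  refine h.half c (-c) (Or.inl hc) planeSwap (planeIsometry_zero _ _ _) (fun x hx => ?_)
    (fun x hx => ?_) fun x => ?_
  · simp only [mem_ofPred_eq, planeSwap_apply_zero, planeSwap_apply_one] at hx ⊢; linarith
  · simp only [mem_ofPred_eq, planeSwap_apply_zero, planeSwap_apply_one] at hx ⊢; linarith
  · rw [planeSwap_apply_zero, planeSwap_apply_one]; ring

/-- A half-plane (4) loses a quadrant (2) and regains half of that quadrant (1). The other obtuse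
cones are mirror images of this one. -/
theorem hasDensity_obtuse : HasDensity {x : Plane | x 1 - x 0 < 0 ∧ x 1 < 0} 0 3 := by
  have h4 : HasDensity {x : Plane | 0 * x 0 + 1 * x 1 < 0} 0 (2 + 2) :=
    hasDensity_halfPlane (Or.inr (by norm_num))
  have h2 : HasDensity ({x : Plane | 0 * x 0 + 1 * x 1 < 0} ∩ {x | 1 * x 0 + 0 * x 1 < 0}) 0
      (2 * 1) := by
    refine HasDensity.half (k := 2) h4 1 0 (Or.inl one_ne_zero) planeFlip (planeIsometry_zero _ _ _)
      (fun x hx => ?_) (fun x hx => ?_) fun x => ?_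
    · simpa only [mem_ofPred_eq, planeFlip_apply_zero, planeFlip_apply_one, mul_neg, zero_mul,
        neg_zero] using hx
    · simpa only [mem_ofPred_eq, planeFlip_apply_zero, planeFlip_apply_one, mul_neg, zero_mul,
        neg_zero] using hx
    · rw [planeFlip_apply_zero, planeFlip_apply_one]; ring
  have h1 := h2.half (-1) 1 (Or.inr one_ne_zero) planeSwap (planeIsometry_zero _ _ _)
    (fun x hx => by
      simp only [mem_inter_iff, mem_ofPred_eq, planeSwap_apply_zero, planeSwap_apply_one] at hx ⊢
      constructor <;> linarith [hx.1, hx.2])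
    (fun x hx => by
      simp only [mem_inter_iff, mem_ofPred_eq, planeSwap_apply_zero, planeSwap_apply_one] at hx ⊢
      constructor <;> linarith [hx.1, hx.2])
    (fun x => by rw [planeSwap_apply_zero, planeSwap_apply_one]; ring)
  have hmQ := (measurableSet_linear_lt 0 1 0).inter (measurableSet_linear_lt 1 0 0)
  have h3 := (h4.sdiff h2 inter_subset_left hmQ).union h1
    (disjoint_sdiff_left.mono_right inter_subset_left) (hmQ.inter (measurableSet_linear_lt _ _ _))
  convert h3 using 1
  ext x
  simp only [mem_ofPred_eq, mem_union, mem_sdiff, mem_inter_iff]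
  constructor
  · rintro ⟨e1, e2⟩
    rcases lt_or_ge (x 0) 0 with h | h
    · right; refine ⟨⟨?_, ?_⟩, ?_⟩ <;> linarith
    · left; exact ⟨by linarith, fun h' => by linarith [h'.2]⟩
  · rintro (⟨e1, e2⟩ | ⟨⟨e1, e2⟩, e3⟩)
    · have : 0 ≤ x 0 := by
        by_contra hcon
        exact e2 ⟨e1, by linarith⟩
      constructor <;> linarith
    · constructor <;> linarith

theorem hasDensity_obtuse_flip : HasDensity {x : Plane | x 0 + x 1 < 0 ∧ x 1 < 0} 0 3 := by
  refine hasDensity_obtuse.image_involution planeFlip_zero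
    planeFlip_planeFlip fun x => ?_
  simp only [mem_ofPred_eq, planeFlip_apply_zero, planeFlip_apply_one, sub_neg_eq_add, add_comm (x 0)]

theorem hasDensity_obtuse_flip_swap : HasDensity {x : Plane | x 0 + x 1 < 0 ∧ x 0 < 0} 0 3 := by
  refine hasDensity_obtuse_flip.image_involution planeSwap_zero
    planeSwap_planeSwap fun x => ?_
  simp only [mem_ofPred_eq, planeSwap_apply_zero, planeSwap_apply_one, add_comm (x 0)]

theorem hasDensity_obtuse_swap : HasDensity {x : Plane | x 0 - x 1 < 0 ∧ x 0 < 0} 0 3 := by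
  refine hasDensity_obtuse.image_involution planeSwap_zero
    planeSwap_planeSwap fun x => ?_
  simp only [mem_ofPred_eq, planeSwap_apply_zero, planeSwap_apply_one]

theorem eventually_linear_lt {a b c : ℝ} {p : Plane} (h : a * p 0 + b * p 1 < c) :
    ∀ᶠ x : Plane in 𝓝 p, a * x 0 + b * x 1 < c :=
  (isOpen_lt (by fun_prop) (by fun_prop) : IsOpen {x : Plane | a * x 0 + b * x 1 < c}).mem_nhds h

/-! ### Local densities of the hexagon. -/

/-- The numbers of eighths of a full turn in the angles of `hexagon l n`. -/
def hexAngle : Fin 6 → ℕ := ![2, 2, 3, 3, 3, 3]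

/-- Inequalities that are strict at p persist near p, so only the tight ones matter locally. The
implications give a single form for interior points of sides and for vertices. -/
theorem eventually_hexagon_iff (l n : ℤ) (p : Plane) : ∀ᶠ x in 𝓝 p,
    (-(n : ℝ) < p 0 + p 1 → -(n : ℝ) < x 0 + x 1) ∧
    (p 0 + p 1 < 2 * (l : ℝ) - n + 1 → x 0 + x 1 < 2 * (l : ℝ) - n + 1) ∧
    (-(n : ℝ) < p 1 - p 0 → -(n : ℝ) < x 1 - x 0) ∧ (p 1 - p 0 < (n : ℝ) → x 1 - x 0 < (n : ℝ)) ∧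
    (p 0 < (l : ℝ) → x 0 < (l : ℝ)) ∧ (p 1 < (l : ℝ) → x 1 < (l : ℝ)) := by
  have key : ∀ a b c : ℝ, ∀ᶠ x : Plane in 𝓝 p, a * p 0 + b * p 1 < c → a * x 0 + b * x 1 < c := by
    intro a b c
    by_cases h : a * p 0 + b * p 1 < c
    · filter_upwards [eventually_linear_lt h] with x hx _ using hx
    · exact Filter.Eventually.of_forall fun x h' => absurd h' h
  filter_upwards [key (-1) (-1) n, key 1 1 (2 * l - n + 1), key 1 (-1) n, key (-1) 1 n, key 1 0 l,
    key 0 1 l] with x h1 h2 h3 h4 h5 h6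
  refine ⟨fun h => ?_, fun h => ?_, fun h => ?_, fun h => ?_, fun h => ?_, fun h => ?_⟩
  · linarith [h1 (by linarith)]
  · linarith [h2 (by linarith)]
  · linarith [h3 (by linarith)]
  · linarith [h4 (by linarith)]
  · linarith [h5 (by linarith)]
  · linarith [h6 (by linarith)]

/-- A vertex of the hexagon at which the hexagon agrees with the translate of the cone `Y`. -/
theorem HasDensity.hexagon_of_cone {l n : ℤ} {Y : Set Plane} {k : ℕ} (hY : HasDensity Y 0 k)
    (p : Plane) (h : ∀ x : Plane, (-(n : ℝ) < p 0 + p 1 → -(n : ℝ) < x 0 + x 1) →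
      (p 0 + p 1 < 2 * (l : ℝ) - n + 1 → x 0 + x 1 < 2 * (l : ℝ) - n + 1) →
      (-(n : ℝ) < p 1 - p 0 → -(n : ℝ) < x 1 - x 0) →
      (p 1 - p 0 < (n : ℝ) → x 1 - x 0 < (n : ℝ)) →
      (p 0 < (l : ℝ) → x 0 < (l : ℝ)) → (p 1 < (l : ℝ) → x 1 < (l : ℝ)) →
      (x ∈ hexagon l n ↔ x - p ∈ Y)) :
    HasDensity (hexagon l n) p k := by
  refine (hY.translate p).congr ?_
  filter_upwards [eventually_hexagon_iff l n p] with x ⟨g1, g2, g3, g4, g5, g6⟩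
  exact h x g1 g2 g3 g4 g5 g6

theorem hasDensity_hexVertex {l n : ℤ} (hl : 1 ≤ l) (hn : 2 ≤ n) (i : Fin 6) :
    HasDensity (hexagon l n) (hexVertex l n i) (hexAngle i) := by
  have hl' : (1 : ℝ) ≤ l := by exact_mod_cast hl
  have hn' : (2 : ℝ) ≤ n := by exact_mod_cast hn
  fin_cases i
  on_goal 1 => refine HasDensity.hexagon_of_cone (hasDensity_diagonalQuadrant 1 one_ne_zero) !₂[0, -(n : ℝ)] ?_
  on_goal 2 => refine HasDensity.hexagon_of_cone (hasDensity_diagonalQuadrant (-1) (by norm_num)) !₂[-(n : ℝ), 0] ?_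
  on_goal 3 => refine HasDensity.hexagon_of_cone (hasDensity_obtuse) !₂[(l : ℝ) - n, l] ?_
  on_goal 4 => refine HasDensity.hexagon_of_cone (hasDensity_obtuse_flip) !₂[(l : ℝ) - n + 1, l] ?_
  on_goal 5 => refine HasDensity.hexagon_of_cone (hasDensity_obtuse_flip_swap) !₂[(l : ℝ), l - n + 1] ?_
  on_goal 6 => refine HasDensity.hexagon_of_cone (hasDensity_obtuse_swap) !₂[(l : ℝ), l - n] ?_
  all_goals
    simp only [Matrix.cons_val_zero, Matrix.cons_val_one, hexagon, mem_ofPred_eq, mem_inter_iff,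
      PiLp.sub_apply]
    intro x g1 g2 g3 g4 g5 g6
    constructor
    · rintro ⟨h1, h2, h3, h4, h5, h6⟩
      constructor <;> linarith
    · rintro ⟨h1, h2⟩
      refine ⟨?_, ?_, ?_, ?_, ?_, ?_⟩
      -- Tight inequalities come from the cone; the others persist from p.
      · first | linarith | exact g1 (by linarith)
      · first | linarith | exact g2 (by linarith)
      · first | linarith | exact g3 (by linarith)
      · first | linarith | exact g4 (by linarith)
      · first | linarith | exact g5 (by linarith)
      · first | linarith | exact g6 (by linarith)

/-- The outer normals of the sides of the hexagon; the `i`-th side joins the vertices `i`, `i + 1`. -/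
def hexNormal : Fin 6 → ℝ × ℝ := ![(-1, -1), (-1, 1), (0, 1), (1, 1), (1, 0), (1, -1)]

/-- The support numbers of the sides of the hexagon. -/
def hexSupport (l n : ℤ) : Fin 6 → ℝ := ![(n : ℝ), n, l, 2 * l - n + 1, l, n]

theorem hexNormal_ne_zero (i : Fin 6) : (hexNormal i).1 ≠ 0 ∨ (hexNormal i).2 ≠ 0 := by
  fin_cases i <;> simp [hexNormal]

theorem hexNormal_left (l n : ℤ) (i : Fin 6) : (hexNormal i).1 * hexVertex l n i 0 +
    (hexNormal i).2 * hexVertex l n i 1 = hexSupport l n i := by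
  fin_cases i <;> simp [hexNormal, hexVertex, hexSupport] <;> ring

theorem hexNormal_right (l n : ℤ) (i : Fin 6) : (hexNormal i).1 * hexVertex l n (i + 1) 0 +
    (hexNormal i).2 * hexVertex l n (i + 1) 1 = hexSupport l n i := by
  fin_cases i <;> simp [hexNormal, hexVertex, hexSupport] <;> ring

/-- Near an interior point of a side, the hexagon is a half-plane. -/
theorem eventually_hexagon_of_mem_side {l n : ℤ} (hl : 1 ≤ l) (hn : 2 ≤ n) (i : Fin 6) {p : Plane}
    (hp : p ∈ openSegment ℝ (hexVertex l n i) (hexVertex l n (i + 1))) :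
    ∀ᶠ x in 𝓝 p, x ∈ hexagon l n ↔
      (hexNormal i).1 * x 0 + (hexNormal i).2 * x 1 < hexSupport l n i := by
  have hl' : (1 : ℝ) ≤ l := by exact_mod_cast hl
  have hn' : (2 : ℝ) ≤ n := by exact_mod_cast hn
  filter_upwards [eventually_hexagon_iff l n p] with x ⟨g1, g2, g3, g4, g5, g6⟩
  rw [openSegment_eq_image'] at hp
  obtain ⟨t, ⟨ht0, ht1⟩, rfl⟩ := hp
  have a1 : 0 < t * n := by positivity
  have a2 : t * n < n := by nlinarith
  have a3 : 0 < t * l := by positivity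
  have a4 : t * l < l := by nlinarith
  have a5 : 0 < t * (n - 1) := mul_pos ht0 (by linarith)
  have a6 : t * (n - 1) < n - 1 := by nlinarith
  simp only [hexagon, mem_ofPred_eq]
  simp only [combo_apply] at g1 g2 g3 g4 g5 g6
  fin_cases i
  all_goals
    simp [hexVertex] at g1 g2 g3 g4 g5 g6
    simp [hexNormal, hexSupport]
    constructor
    · rintro ⟨h1, h2, h3, h4, h5, h6⟩
      linarith
    · intro h
      refine ⟨?_, ?_, ?_, ?_, ?_, ?_⟩
      · first | linarith | exact g1 (by linarith)
      · first | linarith | exact g2 (by linarith)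
      · first | linarith | exact g3 (by linarith)
      · first | linarith | exact g4 (by linarith)
      · first | linarith | exact g5 (by linarith)
      · first | linarith | exact g6 (by linarith)

theorem linear_eq_of_mem_openSegment {a b c : ℝ} {P Q p : Plane} (hP : a * P 0 + b * P 1 = c)
    (hQ : a * Q 0 + b * Q 1 = c) (hp : p ∈ openSegment ℝ P Q) : a * p 0 + b * p 1 = c := by
  rw [openSegment_eq_image'] at hp
  obtain ⟨t, -, rfl⟩ := hp
  simp only [combo_apply]
  linear_combination (1 - t) * hP + t * hQ

theorem hasDensity_side {l n : ℤ} (hl : 1 ≤ l) (hn : 2 ≤ n) (i : Fin 6) {p : Plane}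
    (hp : p ∈ openSegment ℝ (hexVertex l n i) (hexVertex l n (i + 1))) :
    HasDensity (hexagon l n) p 4 := by
  refine ((hasDensity_halfPlane (hexNormal_ne_zero i)).translate p).congr ?_
  have hc := linear_eq_of_mem_openSegment (hexNormal_left l n i) (hexNormal_right l n i) hp
  filter_upwards [eventually_hexagon_of_mem_side hl hn i hp] with x hx
  rw [hx]
  simp only [PiLp.sub_apply]
  constructor <;> intro h <;> linarith

theorem exists_hexVertex_or_side {l n : ℤ} (hl : 1 ≤ l) (hn : 2 ≤ n) {p : Plane}
    (hp : p ∈ closure (hexagon l n)) (hp' : p ∉ hexagon l n) : (∃ i, p = hexVertex l n i) ∨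
      ∃ i, p ∈ openSegment ℝ (hexVertex l n i) (hexVertex l n (i + 1)) := by
  have hl' : (1 : ℝ) ≤ l := by exact_mod_cast hl
  have hn' : (2 : ℝ) ≤ n := by exact_mod_cast hn
  -- The position along side i is s / m; the values s = 0 and s = m give its endpoints.
  have key : ∀ (i : Fin 6) (s m : ℝ), 0 < m → 0 ≤ s → s ≤ m →
      m * (p 0 - hexVertex l n i 0) = s * (hexVertex l n (i + 1) 0 - hexVertex l n i 0) →
      m * (p 1 - hexVertex l n i 1) = s * (hexVertex l n (i + 1) 1 - hexVertex l n i 1) →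
      (∃ i, p = hexVertex l n i) ∨
        ∃ i, p ∈ openSegment ℝ (hexVertex l n i) (hexVertex l n (i + 1)) := by
    intro i s m hm hs hsm e0 e1
    rcases hs.eq_or_lt with rfl | hs
    · left; refine ⟨i, plane_ext ?_ ?_⟩
      · rw [zero_mul, mul_eq_zero, or_iff_right hm.ne', sub_eq_zero] at e0; exact e0
      · rw [zero_mul, mul_eq_zero, or_iff_right hm.ne', sub_eq_zero] at e1; exact e1
    rcases hsm.eq_or_lt with rfl | hsm
    · left; refine ⟨i + 1, plane_ext ?_ ?_⟩
      · linarith [mul_left_cancel₀ hm.ne' e0]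
      · linarith [mul_left_cancel₀ hm.ne' e1]
    right
    refine ⟨i, ?_⟩
    rw [openSegment_eq_image']
    refine ⟨s / m, ⟨by positivity, by rwa [div_lt_one hm]⟩, plane_ext ?_ ?_⟩
    · rw [combo_apply]; field_simp; linarith
    · rw [combo_apply]; field_simp; linarith
  rw [closure_hexagon hl hn] at hp
  obtain ⟨h1, h2, h3, h4, h5, h6⟩ := hp
  have hx' : p 0 + p 1 = -n ∨ p 0 + p 1 = 2 * l - n + 1 ∨ p 1 - p 0 = -n ∨ p 1 - p 0 = n ∨
      p 0 = l ∨ p 1 = l := by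
    by_contra hcon
    simp only [not_or] at hcon
    obtain ⟨c1, c2, c3, c4, c5, c6⟩ := hcon
    exact hp' ⟨lt_of_le_of_ne h1 (Ne.symm c1), lt_of_le_of_ne h2 c2, lt_of_le_of_ne h3 (Ne.symm c3),
      lt_of_le_of_ne h4 c4, lt_of_le_of_ne h5 c5, lt_of_le_of_ne h6 c6⟩
  rcases hx' with h | h | h | h | h | h
  · refine key 0 (-p 0) n (by linarith) (by linarith) (by linarith) ?_ ?_
    · simp [hexVertex]; ring
    · simp [hexVertex]; linear_combination (n : ℝ) * h
  · refine key 3 (p 0 - (l - n + 1)) (n - 1) (by linarith) (by linarith) (by linarith) ?_ ?_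
    · simp [hexVertex]; ring
    · simp [hexVertex]; linear_combination (n - 1 : ℝ) * h
  · refine key 5 (l - p 0) l (by linarith) (by linarith) (by linarith) ?_ ?_
    · simp [hexVertex]; ring
    · simp [hexVertex]; linear_combination (l : ℝ) * h
  · refine key 1 (p 1) l (by linarith) (by linarith) (by linarith) ?_ ?_
    · simp [hexVertex]; linear_combination (-l : ℝ) * h
    · simp [hexVertex]; ring
  · refine key 4 (l - n + 1 - p 1) 1 (by linarith) (by linarith) (by linarith) ?_ ?_
    · simp [hexVertex]; linear_combination h
    · simp [hexVertex]
  · refine key 2 (p 0 - (l - n)) 1 (by linarith) (by linarith) (by linarith) ?_ ?_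
    · simp [hexVertex]
    · simp [hexVertex]; linear_combination h

theorem hexAngle_eq (i : Fin 6) : hexAngle i = 2 ∨ hexAngle i = 3 := by
  fin_cases i <;> simp [hexAngle]

theorem exists_hexDensity {l n : ℤ} (hl : 1 ≤ l) (hn : 2 ≤ n) : ∃ κ : Plane → ℕ,
    (∀ p, HasDensity (hexagon l n) p (κ p)) ∧ (∀ p, κ p ≠ 1) ∧
    (∀ p, κ p ≠ 0 → p ∈ closure (hexagon l n)) ∧ (∀ p ∈ hexagon l n, κ p = 8) ∧
    (∀ p ∈ closure (hexagon l n), κ p ≠ 0) ∧ (∀ i, κ (hexVertex l n i) = hexAngle i) ∧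
    ∀ i, ∀ p ∈ openSegment ℝ (hexVertex l n i) (hexVertex l n (i + 1)), κ p = 4 := by
  have h8 : ∀ p ∈ hexagon l n, HasDensity (hexagon l n) p 8 := fun p hp =>
    (hasDensity_univ p).congr (by
      filter_upwards [(isOpen_hexagon l n).mem_nhds hp] with x hx using by simp [hx])
  have h0 : ∀ p ∉ closure (hexagon l n), HasDensity (hexagon l n) p 0 := fun p hp =>
    (hasDensity_empty p).congr (by
      filter_upwards [isClosed_closure.isOpen_compl.mem_nhds hp] with x hx
      simpa using fun h => hx (subset_closure h))
  have hex : ∀ p, ∃ k, HasDensity (hexagon l n) p k ∧ k ≠ 1 ∧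
      (k ≠ 0 ↔ p ∈ closure (hexagon l n)) := by
    intro p
    by_cases hp : p ∈ closure (hexagon l n)
    · by_cases hp' : p ∈ hexagon l n
      · exact ⟨8, h8 p hp', by norm_num, by simp [hp]⟩
      rcases exists_hexVertex_or_side hl hn hp hp' with ⟨i, rfl⟩ | ⟨i, hi⟩
      · refine ⟨_, hasDensity_hexVertex hl hn i, ?_, ?_⟩ <;> rcases hexAngle_eq i with h | h <;>
          simp [h, hp]
      · exact ⟨4, hasDensity_side hl hn i hi, by norm_num, by simp [hp]⟩
    · exact ⟨0, h0 p hp, by norm_num, by simp [hp]⟩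
  choose κ hκ h1 hc using hex
  exact ⟨κ, hκ, h1, fun p => (hc p).1, fun p hp => (hκ p).unique (h8 p hp), fun p => (hc p).2,
    fun i => (hκ _).unique (hasDensity_hexVertex hl hn i),
    fun i p hp => (hκ p).unique (hasDensity_side hl hn i hp)⟩

/-! ### The angle sum at a point of a tiling. -/

/-- The densities at a point of the tiles of a tiling add up to one. -/
theorem sum_density_eq_eight {F : Set Plane} (hF : IsOpen F) (hne : F.Nonempty)
    (hb : Bornology.IsBounded F) (hfr : volume (frontier F) = 0) {S : Set (Plane ≃ᵢ Plane)}
    (hcov : (⋃ g ∈ S, g '' closure F) = univ)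
    (hdisj : ∀ g ∈ S, ∀ h ∈ S, g ≠ h → Disjoint (g '' F) (h '' F)) (p : Plane)
    (κ : (Plane ≃ᵢ Plane) → ℕ) (hκ : ∀ g ∈ S, HasDensity (g '' F) p (κ g)) :
    ∃ T : Finset (Plane ≃ᵢ Plane), (∀ g ∈ T, g ∈ S) ∧ (∀ g ∈ S, g ∉ T → κ g = 0) ∧
      ∑ g ∈ T, κ g = 8 := by
  have hopen : ∀ g : Plane ≃ᵢ Plane, IsOpen (g '' F) := fun g => g.toHomeomorph.isOpenMap F hF
  have hcl : ∀ g : Plane ≃ᵢ Plane, g '' closure F = closure (g '' F) :=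
    fun g => g.toHomeomorph.image_closure F
  -- Local finiteness: tiles meeting the unit disk about p lie in one larger disk, are disjoint, and
  -- all have the same positive area.
  have hfin : {g ∈ S | (g '' F ∩ ball p 1).Nonempty}.Finite := by
    have hpos : 0 < volume F := hF.measure_pos volume hne
    obtain ⟨D, hD0, hD⟩ : ∃ D, 0 ≤ D ∧ ∀ x ∈ F, ∀ y ∈ F, dist x y ≤ D := by
      obtain ⟨D, hD⟩ := isBounded_iff.1 hb
      exact ⟨max D 0, le_max_right _ _, fun x hx y hy => (hD hx hy).trans (le_max_left _ _)⟩
    have := Measure.finite_const_le_meas_of_disjoint_iUnion (volume : Measure Plane) hpos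
      (As := fun g : {g ∈ S | (g '' F ∩ ball p 1).Nonempty} => g.1 '' F)
      (fun g => (hopen _).measurableSet)
      (fun g h hgh => hdisj _ g.2.1 _ h.2.1 (fun h' => hgh (Subtype.ext h'))) (by
        refine measure_ne_top_of_subset (iUnion_subset ?_)
          (volume_ball_ne_top (p := p) (r := D + 2))
        rintro ⟨g, hg, _, ⟨y, hy, rfl⟩, hyb⟩ _ ⟨x, hx, rfl⟩
        have h1 : dist (g x) (g y) ≤ D := by rw [g.dist_eq]; exact hD x hx y hy
        rw [mem_ball] at hyb ⊢
        linarith [dist_triangle (g x) (g y) p])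
    simp only [volume_isometry_image, le_refl, ofPred_true] at this
    exact Set.finite_coe_iff.1 (Set.finite_univ_iff.1 this)
  have hmem : ∀ g, g ∈ hfin.toFinset ↔ g ∈ S ∧ (g '' F ∩ ball p 1).Nonempty := by simp
  refine ⟨hfin.toFinset, fun g hg => ((hmem g).1 hg).1, fun g hg hgT => ?_, ?_⟩
  · have hemp : g '' F ∩ ball p 1 = ∅ := by
      rw [← not_nonempty_iff_eq_empty]
      exact fun h => hgT ((hmem g).2 ⟨hg, h⟩)
    refine (hκ g hg).unique ⟨1, one_pos, fun r _ hr1 => ?_⟩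
    have : g '' F ∩ ball p r = ∅ :=
      subset_empty_iff.1 (hemp ▸ inter_subset_inter_right _ (ball_subset_ball hr1))
    simp [this]
  · have hev : ∀ᶠ r in 𝓝[>] (0 : ℝ), (r ∈ Ioc (0 : ℝ) 1) ∧ ∀ g ∈ hfin.toFinset,
        8 * volume (g '' F ∩ ball p r) = κ g * volume (ball p r) := by
      refine Filter.Eventually.and (Ioc_mem_nhdsGT one_pos) ?_
      rw [Filter.eventually_all_finset]
      intro g hg
      obtain ⟨r₀, hr₀, h⟩ := hκ g ((hmem g).1 hg).1
      filter_upwards [Ioc_mem_nhdsGT hr₀] with r hr using h r hr.1 hr.2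
    obtain ⟨r, ⟨hr0, hr1⟩, hr⟩ := hev.exists
    -- The closed tiles cover the disk and their frontiers are null, so the disjoint open tiles
    -- account for its full area.
    have hsum : volume (ball p r) = ∑ g ∈ hfin.toFinset, volume (g '' F ∩ ball p r) := by
      refine le_antisymm ?_ ?_
      · have hsub : ball p r ⊆ ⋃ g ∈ hfin.toFinset, closure (g '' F) ∩ ball p r := by
          intro x hx
          have hxu : x ∈ ⋃ g ∈ S, g '' closure F := hcov ▸ mem_univ x
          simp only [mem_iUnion] at hxu ⊢
          obtain ⟨g, hg, hxg⟩ := hxu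
          rw [hcl] at hxg
          have hx1 := ball_subset_ball hr1 hx
          obtain ⟨y, hy⟩ := mem_closure_iff.1 hxg _ isOpen_ball hx1
          exact ⟨g, (hmem g).2 ⟨hg, y, hy.2, hy.1⟩, hxg, hx⟩
        refine (measure_mono hsub).trans ((measure_biUnion_finset_le _ _).trans
          (Finset.sum_le_sum fun g _ => ?_))
        have hfr' : volume (frontier (g '' F)) = 0 := by
          have : frontier (g '' F) = g '' frontier F := (g.toHomeomorph.image_frontier F).symm
          rw [this, volume_isometry_image, hfr]
        have : closure (g '' F) ∩ ball p r ⊆ (g '' F ∩ ball p r) ∪ frontier (g '' F) := by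
          rintro x ⟨hx, hxb⟩
          by_cases hxF : x ∈ g '' F
          · exact Or.inl ⟨hxF, hxb⟩
          · exact Or.inr ⟨hx, by rwa [(hopen g).interior_eq]⟩
        refine (measure_mono this).trans ((measure_union_le _ _).trans ?_)
        rw [hfr', add_zero]
      · rw [← measure_biUnion_finset]
        · exact measure_mono (iUnion₂_subset fun g _ => inter_subset_right)
        · intro g hg h hh hgh
          exact (hdisj g ((hmem g).1 hg).1 h ((hmem h).1 hh).1 hgh).mono inter_subset_left
            inter_subset_left
        · exact fun g _ => ((hopen g).inter isOpen_ball).measurableSet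
    have h8 : ((∑ g ∈ hfin.toFinset, κ g : ℕ) : ENNReal) * volume (ball p r) =
        (8 : ℕ) * volume (ball p r) := by
      conv_rhs => rw [hsum, Finset.mul_sum]
      push_cast
      rw [Finset.sum_mul]
      exact Finset.sum_congr rfl fun g hg => (hr g hg).symm
    have := (ENNReal.mul_left_inj (volume_ball_ne_zero hr0) volume_ball_ne_top).1 h8
    exact_mod_cast this

/-- Bijective isometries of a real normed space are affine (Mazur–Ulam). -/
theorem isometryEquiv_combo (g : Plane ≃ᵢ Plane) (x y : Plane) (t : ℝ) :
    g (x + t • (y - x)) = g x + t • (g y - g x) := by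
  have h := g.toRealAffineIsometryEquiv.toAffineEquiv.toAffineMap.apply_lineMap x y t
  simp only [AffineMap.lineMap_apply_module', add_comm _ x, add_comm _ (_ : Plane)] at h
  rw [add_comm x, add_comm (g x)]
  simpa [add_comm] using h

/-- The three consequences of the angle sum that are used below. -/
theorem tiling_density_facts {F : Set Plane} (hF : IsOpen F) (hne : F.Nonempty)
    (hb : Bornology.IsBounded F) (hfr : volume (frontier F) = 0) {S : Set (Plane ≃ᵢ Plane)}
    (hcov : (⋃ g ∈ S, g '' closure F) = univ)
    (hdisj : ∀ g ∈ S, ∀ h ∈ S, g ≠ h → Disjoint (g '' F) (h '' F))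
    {κ : Plane → ℕ} (hκ : ∀ p, HasDensity F p (κ p)) (hκ1 : ∀ p, κ p ≠ 1) (p : Plane) :
    (∀ g ∈ S, κ (g.symm p) = 4 → ∃ h ∈ S, h ≠ g ∧ κ (h.symm p) ≠ 0 ∧ κ (h.symm p) ≤ 4) ∧
    (∀ g ∈ S, ∀ h ∈ S, g ≠ h → κ (g.symm p) = 3 → κ (h.symm p) ≠ 4) ∧
    (∀ g ∈ S, ∀ h ∈ S, ∀ k ∈ S, g ≠ h → g ≠ k → h ≠ k → κ (g.symm p) = 3 → κ (h.symm p) = 3 →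
      κ (k.symm p) ≠ 3) := by
  classical
  obtain ⟨T, hTS, hT0, hsum⟩ := sum_density_eq_eight hF hne hb hfr hcov hdisj p
    (fun g => κ (g.symm p)) (fun g _ => by simpa using (hκ (g.symm p)).image g)
  have hmem : ∀ g ∈ S, κ (g.symm p) ≠ 0 → g ∈ T := fun g hg h => by
    by_contra hgT; exact h (hT0 g hg hgT)
  refine ⟨fun g hg h4 => ?_, fun g hg h hh hgh h3 h4 => ?_,
    fun g hg h hh k hk hgh hgk hhk h3 h3' h3'' => ?_⟩
  · have hgT := hmem g hg (by omega)
    rw [← Finset.add_sum_erase _ _ hgT, h4] at hsum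
    obtain ⟨h, hhT, hh0⟩ := Finset.exists_ne_zero_of_sum_ne_zero
      (s := T.erase g) (f := fun g => κ (g.symm p)) (by omega)
    have hle := Finset.single_le_sum (f := fun g : Plane ≃ᵢ Plane => κ (g.symm p))
      (fun _ _ => Nat.zero_le _) hhT
    exact ⟨h, hTS h (Finset.mem_of_mem_erase hhT), Finset.ne_of_mem_erase hhT, hh0,
      by omega⟩
  · have hgT := hmem g hg (by omega)
    have hhT := Finset.mem_erase.2 ⟨hgh.symm, hmem h hh (by omega)⟩
    rw [← Finset.add_sum_erase _ _ hgT, ← Finset.add_sum_erase _ _ hhT, h3, h4] at hsum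
    obtain ⟨k, hkT, hk0⟩ := Finset.exists_ne_zero_of_sum_ne_zero
      (s := (T.erase g).erase h) (f := fun g => κ (g.symm p)) (by omega)
    have hle := Finset.single_le_sum (f := fun g : Plane ≃ᵢ Plane => κ (g.symm p))
      (fun _ _ => Nat.zero_le _) hkT
    -- Since 3 + 4 leaves exactly 1, a further tile would need density 1.
    exact hκ1 (k.symm p) (by omega)
  · have hsub : ({g, h, k} : Finset (Plane ≃ᵢ Plane)) ⊆ T := by
      intro x hx
      simp only [Finset.mem_insert, Finset.mem_singleton] at hx
      rcases hx with rfl | rfl | rfl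
      · exact hmem _ hg (by omega)
      · exact hmem _ hh (by omega)
      · exact hmem _ hk (by omega)
    have hle := Finset.sum_le_sum_of_subset (f := fun g : Plane ≃ᵢ Plane => κ (g.symm p)) hsub
    rw [Finset.sum_insert (by simp [hgh, hgk]), Finset.sum_insert (by simp [hhk]),
      Finset.sum_singleton] at hle
    omega

/-- Moving the whole tiling by the inverse of one of its isometries makes F itself a tile. -/
theorem exists_tiling_with_refl {F : Set Plane} (h : TilesPlane F) :
    ∃ S : Set (Plane ≃ᵢ Plane), IsometryEquiv.refl Plane ∈ S ∧
      (⋃ g ∈ S, g '' closure F) = univ ∧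
      ∀ g ∈ S, ∀ h ∈ S, g ≠ h → Disjoint (g '' F) (h '' F) := by
  obtain ⟨S, hcov, hdisj⟩ := h
  obtain ⟨g₀, hg₀⟩ : S.Nonempty := by
    by_contra hS
    rw [not_nonempty_iff_eq_empty] at hS
    have : (0 : Plane) ∈ ⋃ g ∈ S, g '' closure F := hcov ▸ mem_univ _
    simp [hS] at this
  refine ⟨(fun g => g.trans g₀.symm) '' S, ⟨g₀, hg₀, IsometryEquiv.ext fun x => g₀.symm_apply_apply x⟩, ?_, ?_⟩
  · refine eq_univ_of_forall fun x => ?_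
    have : g₀ x ∈ ⋃ g ∈ S, g '' closure F := hcov ▸ mem_univ _
    simp only [mem_iUnion] at this ⊢
    obtain ⟨g, hg, y, hy, hyx⟩ := this
    exact ⟨_, ⟨g, hg, rfl⟩, y, hy, by simp [hyx]⟩
  · rintro _ ⟨g, hg, rfl⟩ _ ⟨h, hh, rfl⟩ hgh
    have hne : g ≠ h := fun e => hgh (by rw [e])
    have := hdisj g hg h hh hne
    rw [show ⇑(g.trans g₀.symm) = g₀.symm ∘ g from rfl,
      show ⇑(h.trans g₀.symm) = g₀.symm ∘ h from rfl, image_comp, image_comp]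
    exact (disjoint_image_iff g₀.symm.injective).2 this

/-! ### Sides of neighbouring tiles along a given side. -/

theorem exists_param {a b c : ℝ} (hab : a ≠ 0 ∨ b ≠ 0) {P Q x : Plane} (hPQ : P ≠ Q)
    (hP : a * P 0 + b * P 1 = c) (hQ : a * Q 0 + b * Q 1 = c) (hx : a * x 0 + b * x 1 = c) :
    ∃ α : ℝ, x = P + α • (Q - P) := by
  set w0 := Q 0 - P 0 with hw0
  set w1 := Q 1 - P 1 with hw1
  have hw : 0 < w0 ^ 2 + w1 ^ 2 := by
    by_contra hcon
    have e0 : w0 = 0 := by nlinarith [sq_nonneg w0, sq_nonneg w1]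
    have e1 : w1 = 0 := by nlinarith [sq_nonneg w0, sq_nonneg w1]
    exact hPQ (plane_ext (by linarith) (by linarith))
  have h1 : a * w0 + b * w1 = 0 := by rw [hw0, hw1]; linear_combination hQ - hP
  have h2 : a * (x 0 - P 0) + b * (x 1 - P 1) = 0 := by linear_combination hx - hP
  have hdet : (x 0 - P 0) * w1 - (x 1 - P 1) * w0 = 0 := by
    rcases hab with h | h
    · refine (mul_eq_zero.1 ?_).resolve_left h
      linear_combination w1 * h2 - (x 1 - P 1) * h1
    · refine (mul_eq_zero.1 ?_).resolve_left h
      linear_combination (x 0 - P 0) * h1 - w0 * h2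
  refine ⟨((x 0 - P 0) * w0 + (x 1 - P 1) * w1) / (w0 ^ 2 + w1 ^ 2), plane_ext ?_ ?_⟩
  · rw [combo_apply, ← hw0]; field_simp; linear_combination w1 * hdet
  · rw [combo_apply, ← hw1]; field_simp; linear_combination (-w0) * hdet

/-- The squared length of the `i`-th side of the hexagon. -/
noncomputable def hexSideSq (l n : ℤ) : Fin 6 → ℝ :=
  ![2 * (n : ℝ) ^ 2, 2 * (l : ℝ) ^ 2, 1, 2 * ((n : ℝ) - 1) ^ 2, 1, 2 * (l : ℝ) ^ 2]

theorem norm_side_sq (l n : ℤ) (i : Fin 6) :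
    ‖hexVertex l n (i + 1) - hexVertex l n i‖ ^ 2 = hexSideSq l n i := by
  rw [EuclideanSpace.norm_sq_eq]
  fin_cases i <;> simp [hexVertex, hexSideSq, Fin.sum_univ_two] <;> ring_nf

theorem hexVertex_ne {l n : ℤ} (hl : 1 ≤ l) (hn : 2 ≤ n) (i : Fin 6) :
    hexVertex l n i ≠ hexVertex l n (i + 1) := fun h => by
  have := (convexIndependent_hexVertex hl hn).injective h
  revert this
  fin_cases i <;> decide

theorem exists_Ioo_notMem_countable (P w : Plane) (hw : w ≠ 0) {B : Set Plane} (hB : B.Countable) :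
    ∃ t ∈ Ioo (0 : ℝ) 1, P + t • w ∉ B := by
  by_contra! hcon
  have hinj : Function.Injective fun t : ℝ => P + t • w := fun s t hst => by
    have := add_left_cancel hst
    exact smul_left_injective ℝ hw this
  have hc : (Ioo (0 : ℝ) 1).Countable := (hB.preimage_of_injOn hinj.injOn).mono hcon
  exact (Cardinal.mk_Ioo_real (zero_lt_one' ℝ)).not_lt
    (lt_of_le_of_lt (Cardinal.le_aleph0_iff_set_countable.2 hc) Cardinal.aleph0_lt_continuum)

theorem mem_openSegment_combo {x y : Plane} {t : ℝ} (h0 : 0 < t) (h1 : t < 1) :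
    x + t • (y - x) ∈ openSegment ℝ x y := by
  rw [openSegment_eq_image']; exact ⟨t, ⟨h0, h1⟩, rfl⟩

section tiling

variable {l n : ℤ} {S : Set (Plane ≃ᵢ Plane)} {κ : Plane → ℕ}

theorem countable_tiles {F : Set Plane} (hF : IsOpen F) (hne : F.Nonempty)
    (hdisj : ∀ g ∈ S, ∀ h ∈ S, g ≠ h → Disjoint (g '' F) (h '' F)) : S.Countable :=
  PairwiseDisjoint.countable_of_isOpen (s := fun g : Plane ≃ᵢ Plane => g '' F)
    (fun g hg h hh hgh => hdisj g hg h hh hgh) (fun g _ => g.toHomeomorph.isOpenMap F hF)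
    fun g _ => hne.image g

/-- Points of the closure of another tile lie on the outer side of a side of the hexagon, if that
tile touches the side at an interior point. -/
theorem support_le_of_mem_closure (hl : 1 ≤ l) (hn : 2 ≤ n) {g : Plane ≃ᵢ Plane}
    (hdisj : Disjoint (hexagon l n) (g '' hexagon l n)) (i : Fin 6) {p x : Plane}
    (hp : p ∈ openSegment ℝ (hexVertex l n i) (hexVertex l n (i + 1)))
    (hpg : g.symm p ∈ closure (hexagon l n)) (hxg : g.symm x ∈ closure (hexagon l n)) :
    hexSupport l n i ≤ (hexNormal i).1 * x 0 + (hexNormal i).2 * x 1 := by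
  by_contra hcon
  rw [not_le] at hcon
  have hc := linear_eq_of_mem_openSegment (hexNormal_left l n i) (hexNormal_right l n i) hp
  have htend : Filter.Tendsto (fun t : ℝ => p + t • (x - p)) (𝓝[>] 0) (𝓝 p) := by
    have : Continuous fun t : ℝ => p + t • (x - p) := by fun_prop
    have h0 := this.tendsto 0
    simp only [zero_smul, add_zero] at h0
    exact h0.mono_left nhdsWithin_le_nhds
  have hev := htend.eventually (eventually_hexagon_of_mem_side hl hn i hp)
  obtain ⟨t, ht, ht0, ht1⟩ := (hev.and (Ioc_mem_nhdsGT (zero_lt_one' ℝ))).exists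
  have hin : p + t • (x - p) ∈ hexagon l n := by
    rw [ht, combo_apply, combo_apply]
    nlinarith
  have hcl : p + t • (x - p) ∈ closure (g '' hexagon l n) := by
    have := (convex_hexagon l n).closure.add_smul_sub_mem hpg hxg ⟨ht0.le, ht1⟩
    rw [← isometryEquiv_combo] at this
    have h2 := mem_image_of_mem g this
    rw [g.apply_symm_apply] at h2
    rwa [← show g '' closure (hexagon l n) = closure (g '' hexagon l n) from
      g.toHomeomorph.image_closure _]
  exact (hdisj.closure_right (isOpen_hexagon l n)).le_bot ⟨hin, hcl⟩

/-- Neither 0 nor 1 lies strictly between α and β, yet some point between them lies in (0, 1); so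
both α and β are in [0, 1]. -/
theorem mem_Icc_of_mul_nonneg {α β s : ℝ} (h0 : 0 ≤ (0 - α) * (0 - β))
    (h1 : 0 ≤ (1 - α) * (1 - β)) (hs0 : 0 < s) (hs1 : s < 1) (ht0 : 0 < α + s * (β - α))
    (ht1 : α + s * (β - α) < 1) : α ∈ Icc (0 : ℝ) 1 ∧ β ∈ Icc (0 : ℝ) 1 := by
  have hs1' : 0 < 1 - s := by linarith
  have key : ∀ a b : ℝ, 0 ≤ a * b → 0 < (1 - s) * a + s * b → 0 ≤ a ∧ 0 ≤ b := by
    intro a b hab hpos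
    rcases mul_nonneg_iff.1 hab with h | ⟨ha, hb⟩
    · exact h
    · have e1 := mul_nonneg_of_nonpos_of_nonpos ha (neg_nonpos.2 hs1'.le)
      have e2 := mul_nonneg_of_nonpos_of_nonpos hb (neg_nonpos.2 hs0.le)
      linarith
  have k0 := key α β (by linarith) (by linarith)
  have k1 := key (1 - α) (1 - β) h1 (by linarith)
  exact ⟨⟨k0.1, by linarith [k1.1]⟩, ⟨k0.2, by linarith [k1.2]⟩⟩

/-- A side of a tile of the tiling which joins two obtuse corners contains a side of another
tile. -/
theorem exists_side_in_side (hl : 1 ≤ l) (hn : 2 ≤ n) (hrefl : IsometryEquiv.refl Plane ∈ S)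
    (hdisj : ∀ g ∈ S, ∀ h ∈ S, g ≠ h → Disjoint (g '' hexagon l n) (h '' hexagon l n))
    (hκc : ∀ p, κ p ≠ 0 → p ∈ closure (hexagon l n)) (hκ8 : ∀ p ∈ hexagon l n, κ p = 8)
    (hκv : ∀ i, κ (hexVertex l n i) = hexAngle i)
    (hκs : ∀ i, ∀ p ∈ openSegment ℝ (hexVertex l n i) (hexVertex l n (i + 1)), κ p = 4)
    (hA : ∀ p, ∀ g ∈ S, κ (g.symm p) = 4 → ∃ h ∈ S, h ≠ g ∧ κ (h.symm p) ≠ 0 ∧ κ (h.symm p) ≤ 4)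
    (hB : ∀ p, ∀ g ∈ S, ∀ h ∈ S, g ≠ h → κ (g.symm p) = 3 → κ (h.symm p) ≠ 4)
    (i : Fin 6) (hi : hexAngle i = 3) (hi' : hexAngle (i + 1) = 3) :
    ∃ g ∈ S, g ≠ IsometryEquiv.refl Plane ∧ ∃ (m : Fin 6) (α β : ℝ),
      α ∈ Icc (0 : ℝ) 1 ∧ β ∈ Icc (0 : ℝ) 1 ∧
      g (hexVertex l n m) = hexVertex l n i + α • (hexVertex l n (i + 1) - hexVertex l n i) ∧
      g (hexVertex l n (m + 1)) =
        hexVertex l n i + β • (hexVertex l n (i + 1) - hexVertex l n i) ∧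
      (β - α) ^ 2 * hexSideSq l n i = hexSideSq l n m := by
  set V := hexVertex l n with hV
  have hne : (hexagon l n).Nonempty := by
    rw [← closure_nonempty_iff]; exact ⟨_, hexVertex_mem_closure hl hn 0⟩
  have hPQ : V i ≠ V (i + 1) := hexVertex_ne hl hn i
  set w := V (i + 1) - V i with hw
  have hw0 : w ≠ 0 := sub_ne_zero.2 hPQ.symm
  -- A tiling has only countably many corners, so some interior point p of the side is not a corner
  -- of any tile.
  have hcount : (⋃ g ∈ S, ⋃ k, {g (V k)}).Countable :=
    (countable_tiles (isOpen_hexagon l n) hne hdisj).biUnion fun g _ =>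
      countable_iUnion fun k => countable_singleton _
  obtain ⟨t, ⟨ht0, ht1⟩, htB⟩ := exists_Ioo_notMem_countable (V i) w hw0 hcount
  have hp := mem_openSegment_combo (x := V i) (y := V (i + 1)) ht0 ht1
  rw [← hw] at hp
  set p := V i + t • w with hpdef
  obtain ⟨g, hg, hgr, hg0, hg4⟩ := hA p _ hrefl (hκs i p hp)
  have hdg : Disjoint (hexagon l n) (g '' hexagon l n) := by
    have := hdisj _ hrefl g hg hgr.symm
    rwa [show ⇑(IsometryEquiv.refl Plane) = id from rfl, image_id] at this
  have hgc := hκc _ hg0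
  have hgH : g.symm p ∉ hexagon l n := fun h => by have := hκ8 _ h; omega
  rcases exists_hexVertex_or_side hl hn hgc hgH with ⟨k, hk⟩ | ⟨m, hm⟩
  · refine absurd ?_ htB
    simp only [mem_iUnion]
    exact ⟨g, hg, k, by rw [mem_singleton_iff, hV, ← hk, g.apply_symm_apply]⟩
  have hsup : ∀ k, hexSupport l n i ≤ (hexNormal i).1 * g (V k) 0 + (hexNormal i).2 * g (V k) 1 :=
    fun k => support_le_of_mem_closure hl hn hdg i hp hgc (by
      rw [g.symm_apply_apply]; exact hexVertex_mem_closure hl hn k)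
  have hc := linear_eq_of_mem_openSegment (hexNormal_left l n i) (hexNormal_right l n i) hp
  rw [openSegment_eq_image'] at hm
  obtain ⟨s, ⟨hs0, hs1⟩, hs⟩ := hm
  have hps : p = g (V m) + s • (g (V (m + 1)) - g (V m)) := by
    rw [← isometryEquiv_combo]
    simp only at hs
    rw [hV, hs, g.apply_symm_apply]
  -- The point p on the supporting line is a proper average of two corners on its outer side, so
  -- both corners lie on the line.
  have hlin : (1 - s) * ((hexNormal i).1 * g (V m) 0 + (hexNormal i).2 * g (V m) 1) +
      s * ((hexNormal i).1 * g (V (m + 1)) 0 + (hexNormal i).2 * g (V (m + 1)) 1) =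
      hexSupport l n i := by
    rw [hps, combo_apply, combo_apply] at hc
    linear_combination hc
  have ha : (hexNormal i).1 * g (V m) 0 + (hexNormal i).2 * g (V m) 1 = hexSupport l n i := by
    refine le_antisymm ?_ (hsup m)
    nlinarith [hsup m, hsup (m + 1), mul_le_mul_of_nonneg_left (hsup (m + 1)) hs0.le]
  have hb : (hexNormal i).1 * g (V (m + 1)) 0 + (hexNormal i).2 * g (V (m + 1)) 1 =
      hexSupport l n i := by
    refine le_antisymm ?_ (hsup (m + 1))
    rw [ha] at hlin
    nlinarith [hsup (m + 1)]
  obtain ⟨α, hα⟩ := exists_param (hexNormal_ne_zero i) hPQ (hexNormal_left l n i)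
    (hexNormal_right l n i) ha
  obtain ⟨β, hβ⟩ := exists_param (hexNormal_ne_zero i) hPQ (hexNormal_left l n i)
    (hexNormal_right l n i) hb
  rw [← hw] at hα hβ
  have htαβ : t = α + s * (β - α) := by
    have h1 : t • w = (α + s * (β - α)) • w := by
      have : V i + t • w = V i + (α + s * (β - α)) • w := by
        rw [← hpdef, hps, hα, hβ]; module
      exact add_left_cancel this
    exact smul_left_injective ℝ hw0 h1
  -- An obtuse corner strictly inside the neighbour's side would bring densities 3 and 4 together.
  have hout : ∀ τ : ℝ, κ (V i + τ • w) = 3 → 0 ≤ (τ - α) * (τ - β) := by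
    intro τ hτ
    by_contra hneg
    rw [not_le] at hneg
    have hba : β - α ≠ 0 := by
      intro h0
      have : β = α := by linarith
      rw [this] at hneg
      nlinarith [mul_self_nonneg (τ - α)]
    have hσ0 : 0 < (τ - α) / (β - α) := by
      have : (τ - α) / (β - α) = (τ - α) * (β - α) / (β - α) ^ 2 := by field_simp
      rw [this]
      have h2 : 0 < (τ - α) * (β - α) := by nlinarith [mul_self_nonneg (τ - α)]
      positivity
    have hσ1 : (τ - α) / (β - α) < 1 := by
      have : 1 - (τ - α) / (β - α) = (β - τ) * (β - α) / (β - α) ^ 2 := by field_simp; ring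
      have h2 : 0 < (β - τ) * (β - α) := by nlinarith [mul_self_nonneg (τ - β)]
      have h3 : 0 < (β - τ) * (β - α) / (β - α) ^ 2 := by positivity
      linarith
    have hx : g.symm (V i + τ • w) = V m + ((τ - α) / (β - α)) • (V (m + 1) - V m) := by
      refine g.injective ?_
      rw [g.apply_symm_apply, isometryEquiv_combo, hα, hβ]
      have : τ = α + (τ - α) / (β - α) * (β - α) := by field_simp; ring
      conv_lhs => rw [this]
      module
    refine hB (V i + τ • w) _ hrefl g hg hgr.symm hτ ?_
    rw [hx]
    exact hκs m _ (mem_openSegment_combo hσ0 hσ1)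
  have h0 := hout 0 (by rw [zero_smul, add_zero, hκv, hi])
  have h1 := hout 1 (by rw [one_smul, hw, add_sub_cancel, hκv, hi'])
  have hα01 := mem_Icc_of_mul_nonneg h0 h1 hs0 hs1 (htαβ ▸ ht0) (htαβ ▸ ht1)
  refine ⟨g, hg, hgr, m, α, β, hα01.1, hα01.2, hα, hβ, ?_⟩
  rw [← norm_side_sq, ← norm_side_sq, ← dist_eq_norm (V (m + 1)) (V m), ← g.dist_eq, dist_eq_norm,
    hα, hβ, show V i + β • w - (V i + α • w) = (β - α) • w by module, norm_smul, mul_pow,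
    Real.norm_eq_abs, sq_abs]

end tiling

/-! ### The hexagon does not tile. -/

theorem hexSideSq_pos {l n : ℤ} (hl : 1 ≤ l) (hn : 2 ≤ n) (m : Fin 6) : 0 < hexSideSq l n m := by
  have hl' : (1 : ℝ) ≤ l := by exact_mod_cast hl
  have hn' : (2 : ℝ) ≤ n := by exact_mod_cast hn
  fin_cases m <;> simp [hexSideSq] <;> apply pow_pos <;> linarith

theorem hexAngle_of_hexSideSq_le_one {l n : ℤ} (hl : 1 ≤ l) (hn : 2 ≤ n) (m : Fin 6)
    (hm : hexSideSq l n m ≤ 1) :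
    hexSideSq l n m = 1 ∧ hexAngle m = 3 ∧ hexAngle (m + 1) = 3 := by
  have hl' : (1 : ℝ) ≤ l := by exact_mod_cast hl
  have hn' : (2 : ℝ) ≤ n := by exact_mod_cast hn
  fin_cases m <;> simp [hexSideSq, hexAngle] at hm ⊢ <;> nlinarith

theorem endpoints_of_sq_eq_one {α β : ℝ} (hα : α ∈ Icc (0 : ℝ) 1) (hβ : β ∈ Icc (0 : ℝ) 1)
    (h : (β - α) ^ 2 = 1) : (α = 0 ∧ β = 1) ∨ (α = 1 ∧ β = 0) := by
  obtain ⟨a0, a1⟩ := hα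
  obtain ⟨b0, b1⟩ := hβ
  rcases sq_eq_one_iff.1 h with h | h
  · exact Or.inl ⟨by linarith, by linarith⟩
  · exact Or.inr ⟨by linarith, by linarith⟩

theorem not_tilesPlane_hexagon {l n : ℤ} (hl : 1 ≤ l) (hn : 2 ≤ n) : ¬ TilesPlane (hexagon l n) := by
  intro htile
  have hne : (hexagon l n).Nonempty := by
    rw [← closure_nonempty_iff]; exact ⟨_, hexVertex_mem_closure hl hn 0⟩
  obtain ⟨S, hrefl, hcov, hdisj⟩ := exists_tiling_with_refl htile
  obtain ⟨κ, hκ, hκ1, hκc, hκ8, -, hκv, hκs⟩ := exists_hexDensity hl hn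
  have facts := tiling_density_facts (isOpen_hexagon l n) hne (isBounded_hexagon hl hn)
    ((convex_hexagon l n).addHaar_frontier volume) hcov hdisj hκ hκ1
  have side := exists_side_in_side hl hn hrefl hdisj hκc hκ8 hκv hκs
    (fun p => (facts p).1) (fun p => (facts p).2.1)
  -- A side contained in a unit side has length at most 1, hence exactly 1, so it is the full side
  -- and its obtuse corners coincide with those at the ends.
  have short : ∀ i, hexSideSq l n i = 1 → hexAngle i = 3 → hexAngle (i + 1) = 3 →
      ∃ g ∈ S, g ≠ IsometryEquiv.refl Plane ∧ κ (g.symm (hexVertex l n i)) = 3 ∧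
        κ (g.symm (hexVertex l n (i + 1))) = 3 := by
    intro i hs hi hi'
    obtain ⟨g, hg, hgr, m, α, β, hα, hβ, hgα, hgβ, hlen⟩ := side i hi hi'
    rw [hs, mul_one] at hlen
    obtain ⟨hm1, hm, hm'⟩ := hexAngle_of_hexSideSq_le_one hl hn m
      (by nlinarith [hα.1, hα.2, hβ.1, hβ.2])
    refine ⟨g, hg, hgr, ?_⟩
    rw [hm1] at hlen
    rcases endpoints_of_sq_eq_one hα hβ hlen with ⟨rfl, rfl⟩ | ⟨rfl, rfl⟩
    · rw [zero_smul, add_zero] at hgα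
      rw [one_smul, add_sub_cancel] at hgβ
      rw [← hgα, ← hgβ, g.symm_apply_apply, g.symm_apply_apply, hκv, hκv]
      exact ⟨hm, hm'⟩
    · rw [zero_smul, add_zero] at hgβ
      rw [one_smul, add_sub_cancel] at hgα
      rw [← hgα, ← hgβ, g.symm_apply_apply, g.symm_apply_apply, hκv, hκv]
      exact ⟨hm', hm⟩
  obtain ⟨g₂, hg₂, hg₂r, hC₂, hD₂⟩ := short 2 (by simp [hexSideSq]) rfl rfl
  obtain ⟨g₄, hg₄, hg₄r, hE₄, hF₄⟩ := short 4 (by simp [hexSideSq]) rfl rfl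
  obtain ⟨h, hh, hhr, m, α, β, hα, hβ, hhα, hhβ, hlen⟩ := side 3 rfl rfl
  have hαβ : α ≠ β := by
    rintro rfl
    have := hexSideSq_pos hl hn m
    simp at hlen
    linarith
  -- The midpoint of the neighbour's side is an interior point of side 3, so the supporting line of
  -- side 3 separates the tiles.
  have hp : h (hexVertex l n m + (1 / 2 : ℝ) • (hexVertex l n (m + 1) - hexVertex l n m)) ∈
      openSegment ℝ (hexVertex l n 3) (hexVertex l n (3 + 1)) := by
    rw [isometryEquiv_combo, hhα, hhβ]
    have : ∀ P w : Plane, P + α • w + (1 / 2 : ℝ) • (P + β • w - (P + α • w)) =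
        P + ((α + β) / 2) • w := fun P w => by module
    rw [this]
    obtain ⟨a0, a1⟩ := hα
    obtain ⟨b0, b1⟩ := hβ
    refine mem_openSegment_combo ?_ ?_ <;> rcases lt_or_gt_of_ne hαβ with h | h <;> linarith
  have hdh : Disjoint (hexagon l n) (h '' hexagon l n) := by
    have := hdisj _ hrefl h hh hhr.symm
    rwa [show ⇑(IsometryEquiv.refl Plane) = id from rfl, image_id] at this
  -- Vertices 2 and 5 lie strictly inside the supporting line of side 3, so h has no corner there.
  -- This distinguishes h from `g₂` and `g₄`.
  have hout : ∀ x, 2 * (l : ℝ) - n = x 0 + x 1 → κ (h.symm x) ≠ 3 := by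
    intro x hx h3
    have := support_le_of_mem_closure hl hn hdh 3 hp (x := x)
      (by
        rw [h.symm_apply_apply]
        exact (convex_hexagon l n).closure.add_smul_sub_mem (hexVertex_mem_closure hl hn m)
          (hexVertex_mem_closure hl hn (m + 1)) ⟨by norm_num, by norm_num⟩)
      (hκc _ (by omega))
    simp [hexNormal, hexSupport] at this
    linarith
  -- An obtuse corner of h inside side 3 would meet a density 4; at an end of side 3 it would be the
  -- third density 3.
  have hend : ∀ k, ∀ γ ∈ Icc (0 : ℝ) 1, h (hexVertex l n k) = hexVertex l n 3 +
      γ • (hexVertex l n (3 + 1) - hexVertex l n 3) → hexAngle k = 2 := by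
    intro k γ ⟨h0, h1⟩ hk
    refine (hexAngle_eq k).resolve_right fun h3 => ?_
    have hκk : κ (h.symm (h (hexVertex l n k))) = 3 := by rw [h.symm_apply_apply, hκv, h3]
    rw [hk] at hκk
    rcases h0.eq_or_lt with rfl | h0
    · rw [zero_smul, add_zero] at hκk
      have hne2 : h ≠ g₂ := by
        rintro rfl
        exact hout _ (by simp [hexVertex]; ring) hC₂
      exact (facts _).2.2 _ hrefl h hh g₂ hg₂ hhr.symm hg₂r.symm hne2 (hκv 3) hκk hD₂
    · rcases h1.eq_or_lt with rfl | h1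
      · rw [one_smul, add_sub_cancel] at hκk
        have hne4 : h ≠ g₄ := by
          rintro rfl
          exact hout _ (by simp [hexVertex]; ring) hF₄
        exact (facts _).2.2 _ hrefl h hh g₄ hg₄ hhr.symm hg₄r.symm hne4 (hκv 4) hκk hE₄
      · exact (facts _).2.1 h hh _ hrefl hhr hκk (hκs 3 _ (mem_openSegment_combo h0 h1))
  have hm := hend m α hα hhα
  have hm' := hend (m + 1) β hβ hhβ
  have hm0 : m = 0 := by
    have key : ∀ m, hexAngle m = 2 → hexAngle (m + 1) = 2 → m = 0 := by decide
    exact key m hm hm'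
  have hn' : (2 : ℝ) ≤ n := by exact_mod_cast hn
  have hle : (β - α) ^ 2 ≤ 1 := by
    rw [sq_le_one_iff_abs_le_one, abs_le]
    constructor <;> linarith [hα.1, hα.2, hβ.1, hβ.2]
  rw [hm0] at hlen
  simp [hexSideSq] at hlen
  -- The containment would force 2n² ≤ 2(n - 1)².
  nlinarith [mul_le_mul_of_nonneg_right hle (sq_nonneg ((n : ℝ) - 1))]

end DigitalPlane


theorem lemma7p2 :
    (∀ n j : ℕ, 1 ≤ j → j ≤ n →
      TilesByLattice (polygonalTile (spiral (s₁ n + j)))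
        (columnLattice !![(n : ℤ), n + j; -n - 1, n - j])) ∧
    (∀ n j : ℕ, 1 ≤ j → j ≤ n →
      Disjoint (polygonalTile (spiral (s₃ (n - 1) + j)))
        (halfTurn (n, n) (polygonalTile (spiral (s₃ (n - 1) + j)))) ∧
      TilesByLattice (polygonalTile (spiral (s₃ (n - 1) + j)) ∪
          halfTurn (n, n) (polygonalTile (spiral (s₃ (n - 1) + j))))
        (columnLattice !![(n : ℤ) - 1, 2 * n - 1 + j; -n - 1, 2 * n - 1 - j])) ∧
    (∀ l n : ℕ, 1 ≤ l → l ≤ n → 2 ≤ n →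
      IsOpenConvexHexagon (polygonalTile (sieben l n)) ∧
      ¬ TilesPlane (polygonalTile (sieben l n))) := by
  refine ⟨fun n j hj hjn => ?_, fun n j hj hjn => ?_, fun l n hl _ hn => ?_⟩
  · rw [spiral_s₁_add (by omega) hjn, polygonalTile_pix₁ (by omega) (by omega)]
    exact tilesByLattice_reg₁ (by omega) (by omega)
  · rw [spiral_s₃_add (by omega), Nat.cast_sub (by omega), Nat.cast_one,
      polygonalTile_pix₃ (by omega) (by omega)]
    exact ⟨disjoint_reg₂_halfTurn _ _, tilesByLattice_reg₂ (by omega) (by omega)⟩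
  · rw [polygonalTile_sieben hl hn]
    exact ⟨isOpenConvexHexagon_hexagon (by omega) (by omega),
      not_tilesPlane_hexagon (by omega) (by omega)⟩
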